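/- Proposition 3.1. For $n\in\mathbb N_0$ and $\alpha,\beta\in\mathbb C$ let $$P_n^{(\alpha,\beta)}(z)=2^{-n}\sum_{k=0}^n\binom{n+\alpha}{n-k}\binom{n+\beta}{k}(z-1)^k(z+1)^{n-k}$$ be the Jacobi polynomial, where $\binom{x}{k}=x(x-1)\cdots(x-k+1)/k!$. Let $\xi\in(-1,1)$ and let $\Gamma\subset\mathbb C\setminus\{1,-1\}$ be an oriented closed contour that begins and ends at $\xi$, has a regular $C^1$ parametrization (closing up in a $C^1$ way, with nowhere vanishing derivative), has exactly three points of self-intersection, and encircles $1$ and $-1$ first in the positive and then in the negative sense. That is, $\Gamma$ is homotopic in $\mathbb C\setminus\{1,-1\}$, with base point $\xi$, to the loop that goes once around $1$ counterclockwise, then around $-1$ counterclockwise, then around $1$ clockwise, then around $-1$ clockwise (along the circles about $1$ and $-1$ through $\xi$). Let $w(t;\alpha,\beta)=(1-t)^\alpha(1+t)^\beta$ be continued continuously along $\Gamma$ from its value $\exp(\alpha\log(1-\xi)+\beta\log(1+\xi))$ (real logarithms) at the starting point $\xi$. Let $\Gamma^o$ be $\Gamma$ without its points of self-intersection. The $+$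 side of $\Gamma$ is on its left and the $-$ side is on its right. Let $n\ge 1$ be an integer and suppose that (with $\mathbb N=\{1,2,3,\dots\}$) $$-n-\alpha-\beta\notin\mathbb N,\qquad n+\alpha\notin\mathbb N,\qquad n+\beta\notin\mathbb N. \tag{3.1}$$ Consider the following Riemann–Hilbert problem for $Y:\mathbb C\setminus\Gamma\to\mathbb C^{2\times2}$: (a) $Y$ is analytic on $\mathbb C\setminus\Gamma$. (b) $Y$ has continuous boundary values $Y_+$ and $Y_-$ on $\Gamma^o$, from the $+$ side and the $-$ side, and $$Y_+(t)=Y_-(t)\begin{pmatrix}1&w(t;\alpha,\beta)\\0&1\end{pmatrix},\qquad t\in\Gamma^o.$$ (c) $Y(z)=\left(I+O(1/z)\right)\begin{pmatrix}z^n&0\\0&z^{-n}\end{pmatrix}$ as $z\to\infty$. (d) $Y(z)$ remains bounded as $z\to t$, for every $t\in\Gamma\setminus\Gamma^o$. Then $P_n^{(\alpha,\beta)}$ has degree exactly $n$, so that there is a constant $c_n$ for which $c_nP_n^{(\alpha,\beta)}$ is monic; and $I_{n-1}=\int_\Gamma t^{n-1}P_{n-1}^{(\alpha,\beta)}(t)\,w(t;\alpha,\beta)\,dt\ne0$,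 so that $d_{n-1}=-2\pi i/I_{n-1}$ is well defined. The Riemann–Hilbert problem has a unique solution, and it is given by $$Y(z)=\begin{pmatrix}c_nP_n^{(\alpha,\beta)}(z)&\dfrac{c_n}{2\pi i}\displaystyle\int_\Gamma\frac{P_n^{(\alpha,\beta)}(t)\,w(t;\alpha,\beta)}{t-z}\,dt\\[10pt] d_{n-1}P_{n-1}^{(\alpha,\beta)}(z)&\dfrac{d_{n-1}}{2\pi i}\displaystyle\int_\Gamma\frac{P_{n-1}^{(\alpha,\beta)}(t)\,w(t;\alpha,\beta)}{t-z}\,dt\end{pmatrix},\qquad z\in\mathbb C\setminus\Gamma.$$ -/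

import Mathlib

open Complex Set Filter Topology

noncomputable section

namespace JacobiRH

/-! ### The contour -/

/-- The plane with the two points `1` and `-1` removed. -/
abbrev PuncturedPlane : Type := {z : ℂ // z ≠ 1 ∧ z ≠ -1}

/-- A point `ξ` of the open interval `(-1, 1)`, viewed in the twice punctured plane. -/
def basePoint (ξ : Ioo (-1 : ℝ) 1) : PuncturedPlane :=
  ⟨((ξ : ℝ) : ℂ), by
    have h := ξ.2
    constructor
    · intro he
      have : (ξ : ℝ) = 1 := by exact_mod_cast he
      linarith [h.2]
    · intro he
      have : (ξ : ℝ) = -1 := by exact_mod_cast he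
      linarith [h.1]⟩

theorem norm_exp_turn (s : ℝ) : ‖exp (2 * Real.pi * s * I)‖ = 1 := by
  have := norm_exp_ofReal_mul_I (2 * Real.pi * s)
  push_cast at this
  exact this

/-- The circle around `1` through `ξ`, described once counterclockwise from `ξ`. -/
def loopOne (ξ : Ioo (-1 : ℝ) 1) : Path (basePoint ξ) (basePoint ξ) where
  toFun s := ⟨1 - ((1 - (ξ : ℝ) : ℝ) : ℂ) * exp (2 * Real.pi * (s : ℝ) * I), by
    have h := ξ.2
    have hpos : 0 < 1 - (ξ : ℝ) := by linarith [h.2]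
    constructor
    · intro he
      have h0 : ((1 - (ξ : ℝ) : ℝ) : ℂ) * exp (2 * Real.pi * (s : ℝ) * I) = 0 := by
        linear_combination -he
      have h1 := congrArg norm h0
      rw [norm_mul, norm_exp_turn, norm_real, Real.norm_of_nonneg hpos.le, norm_zero] at h1
      linarith
    · intro he
      have h0 : ((1 - (ξ : ℝ) : ℝ) : ℂ) * exp (2 * Real.pi * (s : ℝ) * I) = 2 := by
        linear_combination -he
      have h1 := congrArg norm h0
      rw [norm_mul, norm_exp_turn, norm_real, Real.norm_of_nonneg hpos.le] at h1
      norm_num at h1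
      linarith [h.1]⟩
  continuous_toFun := by
    apply Continuous.subtype_mk
    fun_prop
  source' := by
    apply Subtype.ext
    simp [basePoint]
  target' := by
    apply Subtype.ext
    simp [basePoint, exp_two_pi_mul_I]

/-- The circle around `-1` through `ξ`, described once counterclockwise from `ξ`. -/
def loopNegOne (ξ : Ioo (-1 : ℝ) 1) : Path (basePoint ξ) (basePoint ξ) where
  toFun s := ⟨-1 + ((1 + (ξ : ℝ) : ℝ) : ℂ) * exp (2 * Real.pi * (s : ℝ) * I), by
    have h := ξ.2
    have hpos : 0 < 1 + (ξ : ℝ) := by linarith [h.1]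
    constructor
    · intro he
      have h0 : ((1 + (ξ : ℝ) : ℝ) : ℂ) * exp (2 * Real.pi * (s : ℝ) * I) = 2 := by
        linear_combination he
      have h1 := congrArg norm h0
      rw [norm_mul, norm_exp_turn, norm_real, Real.norm_of_nonneg hpos.le] at h1
      norm_num at h1
      linarith [h.2]
    · intro he
      have h0 : ((1 + (ξ : ℝ) : ℝ) : ℂ) * exp (2 * Real.pi * (s : ℝ) * I) = 0 := by
        linear_combination he
      have h1 := congrArg norm h0
      rw [norm_mul, norm_exp_turn, norm_real, Real.norm_of_nonneg hpos.le, norm_zero] at h1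
      linarith⟩
  continuous_toFun := by
    apply Continuous.subtype_mk
    fun_prop
  source' := by
    apply Subtype.ext
    simp [basePoint]
  target' := by
    apply Subtype.ext
    simp [basePoint, exp_two_pi_mul_I]

/-- The reference loop: around `1` and then `-1` in the positive sense, and after that around
`1` and then `-1` in the negative sense. -/
def pochhammerLoop (ξ : Ioo (-1 : ℝ) 1) : Path (basePoint ξ) (basePoint ξ) :=
  ((loopOne ξ).trans (loopNegOne ξ)).trans ((loopOne ξ).symm.trans (loopNegOne ξ).symm)

/-- The points of self-intersection of the closed curve `γ` of period `1`. -/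
def selfIntersections (γ : ℝ → ℂ) : Set ℂ :=
  {z | ∃ s ∈ Ico (0 : ℝ) 1, ∃ t ∈ Ico (0 : ℝ) 1, s ≠ t ∧ γ s = z ∧ γ t = z}

/-- The curve without its points of self-intersection. -/
def openContour (γ : ℝ → ℂ) : Set ℂ := range γ \ selfIntersections γ

/-- `γ` is a regular `C¹` parametrization, of period `1`, of a closed contour in
`ℂ ∖ {1, -1}` which begins and ends at `ξ ∈ (-1, 1)`, has three points of self-intersection, and
encircles `1` and `-1` first in the positive and then in the negative sense, that is, it can be
deformed in `ℂ ∖ {1, -1}` to `pochhammerLoop ξ`. -/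
structure IsPochhammerContour (ξ : Ioo (-1 : ℝ) 1) (γ : ℝ → ℂ) : Prop where
  contDiff : ContDiff ℝ 1 γ
  periodic : Function.Periodic γ 1
  regular : ∀ s, deriv γ s ≠ 0
  avoids : ∀ s, γ s ≠ 1 ∧ γ s ≠ -1
  homotopic : ∃ p : Path (basePoint ξ) (basePoint ξ),
    (∀ s : unitInterval, (p s : ℂ) = γ s) ∧ p.Homotopic (pochhammerLoop ξ)
  three_selfIntersections : (selfIntersections γ).ncard = 3

/-! ### The weight, continued along the contour -/

/-- The continuous logarithm, along the real parameter `s`, of the nowhere vanishing `C¹` function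
`f`, with the value `l₀` at `s = 0` (see `exp_logAlong` and `continuous_logAlong`). -/
def logAlong (f : ℝ → ℂ) (l₀ : ℂ) (s : ℝ) : ℂ := l₀ + ∫ u in (0 : ℝ)..s, deriv f u / f u

theorem hasDerivAt_logAlong {f : ℝ → ℂ} (hf : ContDiff ℝ 1 f) (h0 : ∀ s, f s ≠ 0) (l₀ : ℂ)
    (s : ℝ) : HasDerivAt (logAlong f l₀) (deriv f s / f s) s := by
  have hc : Continuous fun u => deriv f u / f u :=
    (hf.continuous_deriv le_rfl).div hf.continuous h0
  exact (hc.integral_hasStrictDerivAt 0 s).hasDerivAt.const_add l₀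

theorem continuous_logAlong {f : ℝ → ℂ} (hf : ContDiff ℝ 1 f) (h0 : ∀ s, f s ≠ 0) (l₀ : ℂ) :
    Continuous (logAlong f l₀) :=
  continuous_iff_continuousAt.2 fun s => (hasDerivAt_logAlong hf h0 l₀ s).continuousAt

theorem exp_logAlong {f : ℝ → ℂ} (hf : ContDiff ℝ 1 f) (h0 : ∀ s, f s ≠ 0) {l₀ : ℂ}
    (hl : exp l₀ = f 0) (s : ℝ) : exp (logAlong f l₀ s) = f s := by
  have hd : ∀ t, HasDerivAt (fun t => f t * exp (-logAlong f l₀ t)) 0 t := by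
    intro t
    have h1 := ((hf.differentiable one_ne_zero) t).hasDerivAt
    have h2 := (hasDerivAt_logAlong hf h0 l₀ t).neg.cexp
    refine (h1.mul h2).congr_deriv ?_
    have h3 : f t * (deriv f t / f t) = deriv f t := mul_div_cancel₀ _ (h0 t)
    linear_combination -exp (-logAlong f l₀ t) * h3
  have hconst := is_const_of_deriv_eq_zero (fun t => (hd t).differentiableAt)
    (fun t => (hd t).deriv) s 0
  have h1 : f s * exp (-logAlong f l₀ s) = 1 := by
    rw [hconst]
    simp [logAlong, ← hl, ← Complex.exp_add]
  rw [Complex.exp_neg] at h1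
  have h2 := Complex.exp_ne_zero (logAlong f l₀ s)
  field_simp at h1
  exact h1.symm

/-- The value at `γ s` of the weight `(1 - z) ^ α * (1 + z) ^ β`, continued continuously along `γ`
from the branch at the starting point `ξ ∈ (-1, 1)` that is given by the real logarithms of `1 - ξ`
and `1 + ξ`. -/
def weight (ξ : Ioo (-1 : ℝ) 1) (γ : ℝ → ℂ) (α β : ℂ) (s : ℝ) : ℂ :=
  exp (α * logAlong (fun u => 1 - γ u) (Real.log (1 - ξ)) s +
    β * logAlong (fun u => 1 + γ u) (Real.log (1 + ξ)) s)

/-- The integral `∫_Γ f(t) w(t; α, β) dt`. -/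
def weightedIntegral (ξ : Ioo (-1 : ℝ) 1) (γ : ℝ → ℂ) (α β : ℂ) (f : ℂ → ℂ) : ℂ :=
  ∫ s in (0 : ℝ)..1, f (γ s) * weight ξ γ α β s * deriv γ s

/-! ### Jacobi polynomials -/

/-- The Jacobi polynomial
`P_n^{(α,β)}(z) = 2⁻ⁿ ∑_{k ≤ n} C(n+α, n-k) C(n+β, k) (z-1)^k (z+1)^(n-k)` with arbitrary complex
parameters. -/
def jacobi (n : ℕ) (α β : ℂ) : Polynomial ℂ :=
  Polynomial.C ((2 : ℂ) ^ n)⁻¹ * ∑ k ∈ Finset.range (n + 1),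
    Polynomial.C (Ring.choose ((n : ℂ) + α) (n - k) * Ring.choose ((n : ℂ) + β) k) *
      (Polynomial.X - 1) ^ k * (Polynomial.X + 1) ^ (n - k)

/-- The constant `c_n` that makes `c_n P_n^{(α,β)}` monic of degree `n`. -/
def monicConst (n : ℕ) (α β : ℂ) : ℂ := ((jacobi n α β).coeff n)⁻¹

/-- `I_m = ∫_Γ t^m P_m^{(α,β)}(t) w(t; α, β) dt`. -/
def jacobiNorm (ξ : Ioo (-1 : ℝ) 1) (γ : ℝ → ℂ) (m : ℕ) (α β : ℂ) : ℂ :=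
  weightedIntegral ξ γ α β fun t => t ^ m * (jacobi m α β).eval t

/-- The constant `d_m = -2πi / I_m`. -/
def secondConst (ξ : Ioo (-1 : ℝ) 1) (γ : ℝ → ℂ) (m : ℕ) (α β : ℂ) : ℂ :=
  -(2 * Real.pi * I) / jacobiNorm ξ γ m α β

/-! ### The Riemann-Hilbert problem -/

/-- The filter of points that tend to `γ s` on the left of the oriented curve: the points
`γ t + r i γ'(t)` with `t → s` and `r ↓ 0`. Near a point that a regular `C¹` curve passes only once,
these points fill the whole left side of the curve: a nearby point off the curve differs from its
nearest point on the curve by a normal vector. -/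
def leftSide (γ : ℝ → ℂ) (s : ℝ) : Filter ℂ :=
  map (fun p : ℝ × ℝ => γ p.1 + p.2 * I * deriv γ p.1) (𝓝 s ×ˢ 𝓝[>] (0 : ℝ))

/-- The filter of points that tend to `γ s` on the right of the oriented curve: the points
`γ t + r i γ'(t)` with `t → s` and `r ↑ 0`. -/
def rightSide (γ : ℝ → ℂ) (s : ℝ) : Filter ℂ :=
  map (fun p : ℝ × ℝ => γ p.1 + p.2 * I * deriv γ p.1) (𝓝 s ×ˢ 𝓝[<] (0 : ℝ))

/-- `Y : ℂ ∖ Γ → ℂ^{2×2}` solves the Riemann-Hilbert problem (the values of `Y` on `Γ` play no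
role). -/
structure IsRHSolution (ξ : Ioo (-1 : ℝ) 1) (γ : ℝ → ℂ) (n : ℕ) (α β : ℂ)
    (Y : ℂ → Matrix (Fin 2) (Fin 2) ℂ) : Prop where
  /-- `Y` is analytic off the contour. -/
  analytic : ∀ i j, AnalyticOnNhd ℂ (fun z => Y z i j) (range γ)ᶜ
  /-- `Y` has continuous boundary values `Y₊` (left) and `Y₋` (right), related by the jump. -/
  jump : ∃ Yp Ym : ℂ → Matrix (Fin 2) (Fin 2) ℂ,
    ContinuousOn Yp (openContour γ) ∧ ContinuousOn Ym (openContour γ) ∧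
    ∀ s ∈ Ico (0 : ℝ) 1, γ s ∈ openContour γ →
      Tendsto Y (leftSide γ s) (𝓝 (Yp (γ s))) ∧
      Tendsto Y (rightSide γ s) (𝓝 (Ym (γ s))) ∧
      Yp (γ s) = Ym (γ s) * !![1, weight ξ γ α β s; 0, 1]
  /-- `Y(z) = (I + O(1/z)) diag(z^n, z^{-n})` as `z → ∞`. -/
  normalized : ∃ E : ℂ → Matrix (Fin 2) (Fin 2) ℂ,
    (∀ i j, (fun z => E z i j) =O[Bornology.cobounded ℂ] fun z => 1 / z) ∧
    ∀ᶠ z in Bornology.cobounded ℂ, Y z = (1 + E z) * !![z ^ n, 0; 0, (z ^ n)⁻¹]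
  /-- `Y` is bounded near the points of self-intersection. -/
  bounded : ∀ t ∈ selfIntersections γ, ∃ M : ℝ, ∀ᶠ z in 𝓝[(range γ)ᶜ] t, ∀ i j, ‖Y z i j‖ ≤ M

/-- The explicit matrix built from the Jacobi polynomials and their Cauchy transforms. -/
def explicitSolution (ξ : Ioo (-1 : ℝ) 1) (γ : ℝ → ℂ) (n : ℕ) (α β : ℂ) (z : ℂ) :
    Matrix (Fin 2) (Fin 2) ℂ :=
  let c := monicConst n α β
  let d := secondConst ξ γ (n - 1) α β
  !![c * (jacobi n α β).eval z,
      c / (2 * Real.pi * I) *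
        weightedIntegral ξ γ α β (fun t => (jacobi n α β).eval t / (t - z));
    d * (jacobi (n - 1) α β).eval z,
      d / (2 * Real.pi * I) *
        weightedIntegral ξ γ α β (fun t => (jacobi (n - 1) α β).eval t / (t - z))]

end JacobiRH

end

noncomputable section

namespace JacobiRH

/-! ### Jacobi polynomials: leading coefficient and the Rodrigues step -/

/-! Along the contour the logarithms of 1 - t and 1 + t return to their initial values, so the
continued weight is periodic in the parameter. Integration by parts then has no boundary terms.
Iterating one Rodrigues step (`rodrigues_step`, `weightedIntegral_mul_jacobi`) makes P_n orthogonal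
to all lower powers for arbitrary complex parameters, and reduces I_{n-1} to a contour Beta integral
with parameters a = n+α, b = n+β.

The non-vanishing of that integral is the crux. Homotopy invariance
(`exists_isWeightPrimitive_of_homotopic`) moves it to the reference loop of four circles, where an
explicit primitive gives Pochhammer's formula (e^{2πia} - 1)(e^{2πib} - 1) 2^{a+b-1} B(a,b) for
positive real parts (`contourBeta_eq`). Recurrences in a and b reach the other parameters
(`contourBeta_ne_zero`). The conditions on n+α and n+β exclude those zeros of the exponential
factors that no pole of Gamma cancels. The condition on α+β keeps the recurrences nondegenerate, and
it also keeps the leading coefficient of P_n away from zero.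

Existence: the first column is polynomial, and the Cauchy transforms in the second column jump by
the Sokhotski-Plemelj formula (`exists_tendsto_cauchyArc`). They stay bounded at the
self-intersections because the curve and the density are C¹ and the contour is closed
(`exists_bound_cauchyArc`). Orthogonality supplies the decay at infinity
(`pow_mul_cauchyTransform`).

Uniqueness: for two solutions the product Y adj Z has no jump, since the jump matrix has determinant
1. It is continuous across the simple arcs, hence analytic there, because a Lipschitz graph is
removable for continuous functions (`differentiableOn_ball_of_graph`). The finitely many
self-intersections are removable by boundedness, and Liouville's theorem gives Y adj Z = 1
(`eq_of_no_jump`, `mul_adjugate_eq_one`). -/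

theorem succ_mul_choose (x : ℂ) (k : ℕ) :
    ((k : ℂ) + 1) * Ring.choose x (k + 1) = (x - k) * Ring.choose x k := by
  have h := Ring.choose_smul_choose x (Nat.le_succ k)
  simp only [Nat.succ_eq_add_one, Nat.add_sub_cancel_left, Ring.choose_one_right,
    Nat.choose_succ_self_right, nsmul_eq_mul] at h
  push_cast at h
  rw [h, mul_comm]

theorem choose_ne_zero {x : ℂ} {n : ℕ} (h : ∀ i < n, x ≠ i) : Ring.choose x n ≠ 0 := by
  induction n with
  | zero => simp
  | succ k ih =>
    intro h0
    have h1 := succ_mul_choose x k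
    rw [h0, mul_zero, eq_comm, mul_eq_zero, sub_eq_zero] at h1
    rcases h1 with h1 | h1
    · exact h k (Nat.lt_succ_self k) h1
    · exact ih (fun i hi => h i (hi.trans (Nat.lt_succ_self k))) h1

open Polynomial in
-- Every product of powers in the sum is monic of degree n, so the coefficients simply add up, by
-- the Chu-Vandermonde identity.
theorem coeff_jacobi (n : ℕ) (α β : ℂ) :
    (jacobi n α β).coeff n = ((2 : ℂ) ^ n)⁻¹ * Ring.choose (2 * n + α + β) n := by
  have hm : ∀ k ≤ n, ((X - 1 : ℂ[X]) ^ k * (X + 1) ^ (n - k)).coeff n = 1 := by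
    intro k hk
    have h1 : ((X - 1 : ℂ[X]) ^ k * (X + 1) ^ (n - k)).Monic := by
      simpa using ((monic_X_sub_C (1 : ℂ)).pow k).mul ((monic_X_add_C (1 : ℂ)).pow (n - k))
    have h2 : ((X - 1 : ℂ[X]) ^ k * (X + 1) ^ (n - k)).natDegree = n := by
      rw [Monic.natDegree_mul (by simpa using (monic_X_sub_C (1 : ℂ)).pow k)
        (by simpa using (monic_X_add_C (1 : ℂ)).pow (n - k)), natDegree_pow, natDegree_pow]
      have e1 : (X - 1 : ℂ[X]).natDegree = 1 := by simpa using natDegree_X_sub_C (1 : ℂ)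
      have e2 : (X + 1 : ℂ[X]).natDegree = 1 := by simpa using natDegree_X_add_C (1 : ℂ)
      rw [e1, e2]; omega
    have h3 := h1.coeff_natDegree
    rwa [h2] at h3
  have hs : (2 * n + α + β : ℂ) = ((n : ℂ) + α) + ((n : ℂ) + β) := by ring
  rw [jacobi, coeff_C_mul, finsetSum_coeff, hs, Ring.add_choose_eq n (Commute.all _ _),
    ← Finset.Nat.sum_antidiagonal_swap, Finset.Nat.sum_antidiagonal_eq_sum_range_succ_mk]
  congr 1
  refine Finset.sum_congr rfl fun k hk => ?_
  rw [mul_assoc, coeff_C_mul, hm k (by simpa [Nat.lt_succ_iff] using hk), mul_one]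
  rfl

theorem coeff_jacobi_ne_zero {n : ℕ} {α β : ℂ} (h : ∀ k : ℕ, 1 ≤ k → -(n : ℂ) - α - β ≠ k) :
    (jacobi n α β).coeff n ≠ 0 := by
  rw [coeff_jacobi]
  -- A vanishing binomial coefficient would force 2n+α+β = i with i < n, that is, -n-α-β = n - i ≥
  -- 1.
  refine mul_ne_zero (inv_ne_zero (pow_ne_zero _ two_ne_zero)) (choose_ne_zero fun i hi he => ?_)
  refine h (n - i) (by omega) ?_
  rw [Nat.cast_sub hi.le]
  linear_combination -he

open Polynomial in
theorem natDegree_jacobi_le (n : ℕ) (α β : ℂ) : (jacobi n α β).natDegree ≤ n := by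
  refine (natDegree_C_mul_le _ _).trans (natDegree_sum_le_of_forall_le _ _ fun k hk => ?_)
  have e1 : (X - 1 : ℂ[X]).natDegree = 1 := by simpa using natDegree_X_sub_C (1 : ℂ)
  have e2 : (X + 1 : ℂ[X]).natDegree = 1 := by simpa using natDegree_X_add_C (1 : ℂ)
  have hk' : k ≤ n := by simpa [Nat.lt_succ_iff] using hk
  refine natDegree_mul_le.trans ?_
  have h1 := natDegree_C_mul_le (Ring.choose ((n : ℂ) + α) (n - k) * Ring.choose ((n : ℂ) + β) k)
    ((X - 1 : ℂ[X]) ^ k)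
  rw [natDegree_pow, e1] at h1
  rw [natDegree_pow, e2]
  omega

theorem natDegree_jacobi {n : ℕ} {α β : ℂ} (h : ∀ k : ℕ, 1 ≤ k → -(n : ℂ) - α - β ≠ k) :
    (jacobi n α β).natDegree = n :=
  le_antisymm (natDegree_jacobi_le n α β)
    (Polynomial.le_natDegree_of_ne_zero (coeff_jacobi_ne_zero h))

theorem monic_monicConst_mul_jacobi {n : ℕ} {α β : ℂ}
    (h : ∀ k : ℕ, 1 ≤ k → -(n : ℂ) - α - β ≠ k) :
    (Polynomial.C (monicConst n α β) * jacobi n α β).Monic := by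
  have h0 := coeff_jacobi_ne_zero h
  rw [Polynomial.Monic, Polynomial.leadingCoeff, monicConst,
    Polynomial.natDegree_C_mul (inv_ne_zero h0), natDegree_jacobi h, Polynomial.coeff_C_mul,
    inv_mul_cancel₀ h0]

open Polynomial in
/-- One step of the Rodrigues formula. -/
theorem rodrigues_step (n : ℕ) (α β : ℂ) :
    (1 - X ^ 2) * derivative (jacobi n (α + 1) (β + 1)) +
      (C (β + 1) * (1 - X) - C (α + 1) * (1 + X)) * jacobi n (α + 1) (β + 1) =
    C (-2 * ((n : ℂ) + 1)) * jacobi (n + 1) α β := by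
  set a : ℕ → ℂ := fun i => Ring.choose ((n + 1 : ℕ) + α) i with ha
  set b : ℕ → ℂ := fun i => Ring.choose ((n + 1 : ℕ) + β) i with hb
  have hQ : jacobi n (α + 1) (β + 1) = C ((2 : ℂ) ^ n)⁻¹ * ∑ k ∈ Finset.range (n + 1),
      C (a (n - k) * b k) * ((X - 1) ^ k * (X + 1) ^ (n - k)) := by
    rw [jacobi]
    congr 1
    refine Finset.sum_congr rfl fun k _ => ?_
    rw [mul_assoc]
    simp only [ha, hb]
    have e1 : ((n + 1 : ℕ) : ℂ) + α = n + (α + 1) := by push_cast; ring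
    have e2 : ((n + 1 : ℕ) : ℂ) + β = n + (β + 1) := by push_cast; ring
    rw [e1, e2]
  have hP : jacobi (n + 1) α β = C ((2 : ℂ) ^ (n + 1))⁻¹ * ∑ k ∈ Finset.range (n + 1 + 1),
      C (a (n + 1 - k) * b k) * ((X - 1) ^ k * (X + 1) ^ (n + 1 - k)) := by
    rw [jacobi]
    congr 1
    refine Finset.sum_congr rfl fun k _ => ?_
    rw [mul_assoc]
  -- The recursion of the binomial coefficients splits each term over two neighbouring products. The
  -- product with index `k` then occurs with the weights `n + 1 - k` and `k`, whose sum is always `n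
  -- + 1`.
  have hT : ∀ k ∈ Finset.range (n + 1), (1 - X ^ 2) * derivative
        (C (a (n - k) * b k) * ((X - 1) ^ k * (X + 1) ^ (n - k))) +
      (C (β + 1) * (1 - X) - C (α + 1) * (1 + X)) *
        (C (a (n - k) * b k) * ((X - 1) ^ k * (X + 1) ^ (n - k))) =
      -(C ((n + 1 - k : ℂ) * (a (n + 1 - k) * b k)) * ((X - 1) ^ k * (X + 1) ^ (n + 1 - k)) +
        C ((k + 1 : ℂ) * (a (n - k) * b (k + 1))) * ((X - 1) ^ (k + 1) * (X + 1) ^ (n - k))) := by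
    intro k hk
    obtain ⟨m, rfl⟩ : ∃ m, n = k + m :=
      Nat.exists_eq_add_of_le (by simpa [Nat.lt_succ_iff] using hk)
    have e1 : k + m - k = m := by omega
    have e2 : k + m + 1 - k = m + 1 := by omega
    rw [e1, e2]
    have h1 : ((m : ℂ) + 1) * a (m + 1) = (k + 1 + α) * a m := by
      have := succ_mul_choose ((k + m + 1 : ℕ) + α) m
      simp only [ha]
      rw [this]; push_cast; ring
    have h2 : ((k : ℂ) + 1) * b (k + 1) = (m + 1 + β) * b k := by
      have := succ_mul_choose ((k + m + 1 : ℕ) + β) k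
      simp only [hb]
      rw [this]; push_cast; ring
    have h3 : (((k + m : ℕ) : ℂ) + 1 - k) * (a (m + 1) * b k) = (k + 1 + α) * (a m * b k) := by
      rw [← mul_assoc, ← mul_assoc, ← h1]; push_cast; ring
    have h4 : ((k : ℂ) + 1) * (a m * b (k + 1)) = (m + 1 + β) * (a m * b k) := by
      linear_combination a m * h2
    rw [h3, h4]
    have hd : (1 - X ^ 2) * derivative ((X - 1 : ℂ[X]) ^ k * (X + 1) ^ m) =
        -(C (k : ℂ) * ((X - 1) ^ k * (X + 1) ^ (m + 1)) +
          C (m : ℂ) * ((X - 1) ^ (k + 1) * (X + 1) ^ m)) := by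
      rw [derivative_mul, derivative_pow, derivative_pow]
      have p1 : (X - 1 : ℂ[X]) * (C (k : ℂ) * (X - 1) ^ (k - 1)) = C (k : ℂ) * (X - 1) ^ k := by
        cases k with
        | zero => simp
        | succ k => simp only [Nat.add_sub_cancel]; ring
      have p2 : (X + 1 : ℂ[X]) * (C (m : ℂ) * (X + 1) ^ (m - 1)) = C (m : ℂ) * (X + 1) ^ m := by
        cases m with
        | zero => simp
        | succ k => simp only [Nat.add_sub_cancel]; ring
      simp only [derivative_sub, derivative_add, derivative_X, derivative_one, sub_zero, add_zero,
        mul_one]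
      linear_combination (-(X + 1) ^ (m + 1)) * p1 - (X - 1) ^ (k + 1) * p2
    rw [derivative_C_mul]
    simp only [C_mul, C_add, C_1] at hd ⊢
    linear_combination (C (a m) * C (b k)) * hd
  have hS : (1 - X ^ 2) * derivative (∑ k ∈ Finset.range (n + 1),
        C (a (n - k) * b k) * ((X - 1) ^ k * (X + 1) ^ (n - k))) +
      (C (β + 1) * (1 - X) - C (α + 1) * (1 + X)) * (∑ k ∈ Finset.range (n + 1),
        C (a (n - k) * b k) * ((X - 1) ^ k * (X + 1) ^ (n - k))) =
      -(C (n + 1 : ℂ) * ∑ k ∈ Finset.range (n + 1 + 1),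
      C (a (n + 1 - k) * b k) * ((X - 1) ^ k * (X + 1) ^ (n + 1 - k))) := by
    rw [derivative_sum, Finset.mul_sum, Finset.mul_sum, ← Finset.sum_add_distrib,
      Finset.sum_congr rfl hT, Finset.sum_neg_distrib, Finset.sum_add_distrib]
    congr 1
    -- Extending the two sums to a common range adds only terms of weight zero, at `k = n + 1` here
    -- and at `k = 0` in `s2`.
    have s1 : ∑ k ∈ Finset.range (n + 1), C ((n + 1 - k : ℂ) * (a (n + 1 - k) * b k)) *
        ((X - 1 : ℂ[X]) ^ k * (X + 1) ^ (n + 1 - k)) =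
        ∑ k ∈ Finset.range (n + 1 + 1), C ((n + 1 - k : ℂ) * (a (n + 1 - k) * b k)) *
        ((X - 1 : ℂ[X]) ^ k * (X + 1) ^ (n + 1 - k)) := by
      rw [Finset.sum_range_succ _ (n + 1)]
      simp
    have s2 : ∑ k ∈ Finset.range (n + 1), C ((k + 1 : ℂ) * (a (n - k) * b (k + 1))) *
        ((X - 1 : ℂ[X]) ^ (k + 1) * (X + 1) ^ (n - k)) =
        ∑ k ∈ Finset.range (n + 1 + 1), C ((k : ℂ) * (a (n + 1 - k) * b k)) *
        ((X - 1 : ℂ[X]) ^ k * (X + 1) ^ (n + 1 - k)) := by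
      rw [Finset.sum_range_succ' _ (n + 1)]
      simp
    rw [s1, s2, ← Finset.sum_add_distrib, Finset.mul_sum]
    refine Finset.sum_congr rfl fun k _ => ?_
    simp only [C_mul, C_add, C_sub, C_1]
    ring
  rw [hQ, hP, derivative_C_mul]
  have h2 : (C ((2 : ℂ) ^ n)⁻¹ : ℂ[X]) = C 2 * C ((2 : ℂ) ^ (n + 1))⁻¹ := by
    rw [← C_mul]; congr 1; field_simp; ring
  have h5 : (C (-2 * ((n : ℂ) + 1)) : ℂ[X]) = -(C 2 * C ((n : ℂ) + 1)) := by
    rw [← C_mul, ← C_neg]; congr 1; ring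
  rw [h5]
  linear_combination (C ((2 : ℂ) ^ n)⁻¹) * hS - (C (n + 1 : ℂ) * ∑ k ∈ Finset.range (n + 1 + 1),
      C (a (n + 1 - k) * b k) * ((X - 1) ^ k * (X + 1) ^ (n + 1 - k))) * h2

end JacobiRH

end

noncomputable section

namespace JacobiRH

/-! ### Primitives along homotopies -/

theorem eq_of_eventually_eq_nhds {g : ℝ → ℂ}
    (h : ∀ s ∈ Icc (0 : ℝ) 1, ∀ᶠ u in 𝓝 s, g u = g s) : g 1 = g 0 := by
  have hd : ∀ s ∈ Icc (0 : ℝ) 1, HasDerivAt g 0 s := fun s hs =>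
    (hasDerivAt_const s (g s)).congr_of_eventuallyEq (h s hs)
  exact constant_of_has_deriv_right_zero (fun s hs => (hd s hs).continuousAt.continuousWithinAt)
    (fun s hs => (hd s (Ico_subset_Icc_self hs)).hasDerivWithinAt) 1 (by simp)

/-- A local additive cocycle is, on bounded sets, the coboundary of a function. -/
theorem exists_of_local_cocycle {E : Type*} [NormedAddCommGroup E] [NormedSpace ℝ E]
    {e : E → E → ℂ} {δ : ℝ} (hδ : 0 < δ)
    {R : ℝ} (h : ∀ x y z, ‖x‖ ≤ R → ‖y‖ ≤ R → ‖z‖ ≤ R → dist x y < δ → dist y z < δ →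
      dist x z < δ → e x y + e y z = e x z) :
    ∃ Φ : E → ℂ, ∀ x y, ‖x‖ ≤ R → ‖y‖ ≤ R → dist x y < δ / 2 → Φ y - Φ x = e x y := by
  obtain ⟨N, hN⟩ := exists_nat_gt (max 1 (R / (δ / 2)))
  have hN1 : (1 : ℝ) < N := (le_max_left _ _).trans_lt hN
  have hN0 : (0 : ℝ) < N := by linarith
  have hNR : R / N < δ / 2 := by
    have := (le_max_right _ _).trans_lt hN
    rw [div_lt_iff₀ (by positivity)] at this
    rw [div_lt_iff₀ hN0]; linarith
  -- The segment from 0 to `x` is cut into `N` steps shorter than `δ / 2`, and the value at `x` is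
  -- the sum of `e` over these steps. Halving `δ` leaves room for the diagonals between the
  -- subdivided segments to `x` and to `y`.
  set p : E → ℕ → E := fun x i => ((i : ℝ) / N) • x with hp
  have hpN : ∀ x, p x N = x := fun x => by simp [hp, div_self hN0.ne']
  have hp0 : ∀ x, p x 0 = 0 := fun x => by simp [hp]
  have hstep : ∀ x i, ‖x‖ ≤ R → dist (p x i) (p x (i + 1)) < δ / 2 := by
    intro x i hx
    have : p x (i + 1) - p x i = (1 / (N : ℝ)) • x := by
      simp only [hp, ← sub_smul]; congr 1; push_cast; ring
    rw [dist_comm, dist_eq_norm, this, norm_smul, Real.norm_of_nonneg (by positivity)]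
    refine lt_of_le_of_lt ?_ hNR
    rw [one_div, inv_mul_eq_div]
    gcongr
  have hcross : ∀ x y i, i ≤ N → dist (p x i) (p y i) ≤ dist x y := by
    intro x y i hi
    have : p x i - p y i = ((i : ℝ) / N) • (x - y) := by simp only [hp, smul_sub]
    rw [dist_eq_norm, dist_eq_norm, this, norm_smul, Real.norm_of_nonneg (by positivity)]
    have : (i : ℝ) / N ≤ 1 := by rw [div_le_one hN0]; exact_mod_cast hi
    exact mul_le_of_le_one_left (norm_nonneg _) this
  have hle : ∀ x i, i ≤ N → ‖x‖ ≤ R → ‖p x i‖ ≤ R := by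
    intro x i hi hx
    have := hcross x 0 i hi
    simp only [hp, smul_zero, dist_zero_right] at this
    exact this.trans hx
  refine ⟨fun x => ∑ i ∈ Finset.range N, e (p x i) (p x (i + 1)), fun x y hx hy hxy => ?_⟩
  have h00 : e 0 0 = 0 := by
    have hR : ‖(0 : E)‖ ≤ R := norm_zero.trans_le ((norm_nonneg x).trans hx)
    have := h 0 0 0 hR hR hR (by simpa) (by simpa) (by simpa)
    simpa using this
  rw [← Finset.sum_sub_distrib]
  -- Both ways around a small quadrilateral equal its diagonal, so the difference of the two sums
  -- telescopes.
  have : ∀ i ∈ Finset.range N, e (p y i) (p y (i + 1)) - e (p x i) (p x (i + 1)) =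
      e (p x (i + 1)) (p y (i + 1)) - e (p x i) (p y i) := by
    intro i hi
    have hi' : i + 1 ≤ N := Finset.mem_range.1 hi
    have d1 := hcross x y i (by omega)
    have d2 := hcross x y (i + 1) hi'
    have d3 : dist (p x i) (p y (i + 1)) < δ :=
      (dist_triangle _ (p y i) _).trans_lt (by linarith [hstep y i hy])
    have n1 := hle x i (by omega) hx
    have n2 := hle y i (by omega) hy
    have n3 := hle x (i + 1) hi' hx
    have n4 := hle y (i + 1) hi' hy
    have a1 := h (p x i) (p x (i + 1)) (p y (i + 1)) n1 n3 n4 (by linarith [hstep x i hx])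
      (by linarith) d3
    have a2 := h (p x i) (p y i) (p y (i + 1)) n1 n2 n4 (by linarith) (by linarith [hstep y i hy]) d3
    linear_combination a2 - a1
  rw [Finset.sum_congr rfl this, Finset.sum_range_sub (fun i => e (p x i) (p y i)), hpN, hpN,
    hp0, hp0, h00, sub_zero]

theorem log_mul_of_re_pos {z w : ℂ} (hz : 0 < z.re) (hw : 0 < w.re) :
    log (z * w) = log z + log w := by
  have hz0 : z ≠ 0 := fun h => by simp [h] at hz
  have hw0 : w ≠ 0 := fun h => by simp [h] at hw
  have h1 := abs_lt.1 (abs_arg_lt_pi_div_two_iff.2 (Or.inl hz))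
  have h2 := abs_lt.1 (abs_arg_lt_pi_div_two_iff.2 (Or.inl hw))
  exact Complex.log_mul hz0 hw0 ⟨by linarith [h1.1, h2.1], by linarith [h1.2, h2.2]⟩

theorem div_re_pos_of_norm_sub_lt {u v : ℂ} (h : ‖v - u‖ < ‖u‖) : 0 < (v / u).re := by
  have hu : u ≠ 0 := fun h0 => by
    rw [h0, norm_zero] at h; exact absurd h (not_lt.2 (norm_nonneg _))
  have h1 : ‖v / u - 1‖ < 1 := by
    rw [div_sub_one hu, norm_div, div_lt_one (norm_pos_iff.2 hu)]; exact h
  have h2 := (abs_re_le_norm (v / u - 1)).trans_lt h1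
  rw [sub_re, one_re] at h2
  linarith [(abs_lt.1 h2).1]

/-- Both quotients lie in the right half-plane, so their arguments add without leaving the principal
range. This is the cocycle identity for `exists_of_local_cocycle`. -/
theorem log_div_add_log_div {u v w : ℂ} (h1 : ‖v - u‖ < ‖u‖) (h2 : ‖w - v‖ < ‖v‖) (hv : v ≠ 0) :
    log (v / u) + log (w / v) = log (w / u) := by
  rw [← log_mul_of_re_pos (div_re_pos_of_norm_sub_lt h1) (div_re_pos_of_norm_sub_lt h2)]
  congr 1
  rw [mul_comm, div_mul_div_cancel₀ hv]

/-- A continuous logarithm of a function bounded away from zero. -/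
theorem exists_log_lift {E : Type*} [NormedAddCommGroup E] [NormedSpace ℝ E] {g : E → ℂ}
    (hg : UniformContinuous g) {r : ℝ} (hr : 0 < r) (hgr : ∀ x, r ≤ ‖g x‖) {l₀ : ℂ}
    (hl₀ : exp l₀ = g 0) (R : ℝ) :
    ∃ L : E → ℂ, L 0 = l₀ ∧ (∀ x, ‖x‖ < R → exp (L x) = g x) ∧ (∀ x, ‖x‖ < R → ContinuousAt L x) ∧
      ∃ δ > 0, ∀ x y, ‖x‖ ≤ R → ‖y‖ ≤ R → dist x y < δ → L y = L x + log (g y / g x) := by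
  obtain ⟨δ, hδ, hd⟩ := Metric.uniformContinuous_iff.1 hg r hr
  have hg0 : ∀ x, g x ≠ 0 := fun x h => by
    have := hgr x; rw [h, norm_zero] at this; linarith
  have hcl : ∀ x y, dist x y < δ → ‖g y - g x‖ < ‖g x‖ := fun x y hxy => by
    rw [← dist_eq_norm, dist_comm]; exact (hd hxy).trans_le (hgr x)
  obtain ⟨Φ, hΦ⟩ := exists_of_local_cocycle (e := fun x y => log (g y / g x)) hδ
    (R := R)
    (fun x y z _ _ _ hxy hyz _ => log_div_add_log_div (hcl x y hxy) (hcl y z hyz) (hg0 y))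
  refine ⟨fun x => Φ x - Φ 0 + l₀, by simp, fun x hx => ?_, fun x hx => ?_, δ / 2, by positivity,
    fun x y hx hy hxy => by linear_combination hΦ x y hx hy hxy⟩
  rotate_left
  · have h1 : ContinuousAt (fun y => Φ x + log (g y / g x)) x := by
      refine continuousAt_const.add ((hg.continuous.continuousAt.div_const _).clog ?_)
      rw [div_self (hg0 x)]
      exact one_mem_slitPlane
    have h2 : Φ =ᶠ[𝓝 x] fun y => Φ x + log (g y / g x) := by
      have e1 : ∀ᶠ y in 𝓝 x, ‖y‖ < R := (continuous_norm.tendsto x).eventually_lt_const hx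
      filter_upwards [e1, Metric.ball_mem_nhds x (half_pos hδ)] with y h1 h2
      linear_combination hΦ x y hx.le h1.le (by rwa [dist_comm])
    exact ((h1.congr h2.symm).sub continuousAt_const).add continuousAt_const
  -- The exponential of the lift divided by `g` does not change under small moves, so along the
  -- segment from 0 to `x` it keeps its initial value 1.
  have key : ∀ y z : E, ‖y‖ ≤ R → ‖z‖ ≤ R → dist y z < δ / 2 →
      exp (Φ z - Φ 0 + l₀) / g z = exp (Φ y - Φ 0 + l₀) / g y := by
    intro y z hy hz hyz
    have : Φ z - Φ 0 + l₀ = (Φ y - Φ 0 + l₀) + log (g z / g y) := by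
      linear_combination hΦ y z hy hz hyz
    rw [this, exp_add, exp_log (div_ne_zero (hg0 z) (hg0 y))]
    have := hg0 z; have := hg0 y
    field_simp
  have hc : Continuous fun s : ℝ => s • x := by fun_prop
  have := eq_of_eventually_eq_nhds (g := fun s => exp (Φ (s • x) - Φ 0 + l₀) / g (s • x)) (by
    intro s hs
    have hsx : ‖s • x‖ < R := by
      rw [norm_smul, Real.norm_of_nonneg hs.1]
      nlinarith [norm_nonneg x, hs.2]
    have e1 : ∀ᶠ u in 𝓝 s, ‖u • x‖ < R := (hc.norm.tendsto s).eventually_lt_const hsx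
    have e2 : ∀ᶠ u in 𝓝 s, dist (s • x) (u • x) < δ / 2 := by
      have : Tendsto (fun u => dist (s • x) (u • x)) (𝓝 s) (𝓝 (dist (s • x) (s • x))) :=
        (continuous_const.dist hc).tendsto s
      rw [dist_self] at this
      exact this.eventually_lt_const (by positivity)
    filter_upwards [e1, e2] with u h1 h2
    exact key _ _ hsx.le h1.le h2)
  simp only [one_smul, zero_smul, sub_self, zero_add, hl₀, div_self (hg0 0)] at this
  exact (div_eq_one_iff_eq (hg0 x)).1 this

/-- A primitive, along a uniformly continuous map `H` into the plane, of a compatible family of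
germs `f x` of analytic functions at the points `H x`. -/
theorem exists_primitive_along {E : Type*} [NormedAddCommGroup E] [NormedSpace ℝ E] {H : E → ℂ}
    (hH : UniformContinuous H) {r : ℝ} (hr : 0 < r) {f : E → ℂ → ℂ} {R : ℝ}
    (hf : ∀ x, DifferentiableOn ℂ (f x) (Metric.ball (H x) r)) {δ₀ : ℝ} (hδ₀ : 0 < δ₀)
    (hcompat : ∀ x y, ‖x‖ ≤ R → ‖y‖ ≤ R → dist x y < δ₀ →
      ∀ z ∈ Metric.ball (H x) r ∩ Metric.ball (H y) r, f x z = f y z) :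
    ∃ Φ : E → ℂ, ∀ x, ‖x‖ < R → ∃ W : ℂ → ℂ, HasDerivAt W (f x (H x)) (H x) ∧
      ∀ᶠ y in 𝓝 x, Φ y - Φ x = W (H y) - W (H x) := by
  obtain ⟨δ₁, hδ₁, hd⟩ := Metric.uniformContinuous_iff.1 hH r hr
  choose W hW using fun x => (hf x).isExactOn_ball
  -- Primitives of compatible germs differ by a constant on the convex intersection of their discs;
  -- this is exactly the cocycle identity needed below.
  have hconst : ∀ x y, ‖x‖ ≤ R → ‖y‖ ≤ R → dist x y < δ₀ →
      ∀ z ∈ Metric.ball (H x) r ∩ Metric.ball (H y) r,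
      ∀ z' ∈ Metric.ball (H x) r ∩ Metric.ball (H y) r, W x z - W y z = W x z' - W y z' := by
    intro x y hx hy hxy z hz z' hz'
    have hD : ∀ u ∈ Metric.ball (H x) r ∩ Metric.ball (H y) r,
        HasDerivAt (fun u => W x u - W y u) 0 u := fun u hu =>
      ((hW x u hu.1).sub (hW y u hu.2)).congr_deriv (by rw [hcompat x y hx hy hxy u hu, sub_self])
    exact (Metric.isOpen_ball.inter Metric.isOpen_ball).is_const_of_deriv_eq_zero
      ((convex_ball _ _).inter (convex_ball _ _)).isPreconnected
      (fun u hu => (hD u hu).differentiableAt.differentiableWithinAt)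
      (fun u hu => (hD u hu).deriv) hz hz'
  obtain ⟨Φ, hΦ⟩ := exists_of_local_cocycle (e := fun x y => W x (H y) - W x (H x))
    (lt_min hδ₀ hδ₁) (R := R) (fun x y z hx hy _ hxy hyz hxz => by
      have h1 : dist (H x) (H y) < r := hd (hxy.trans_le (min_le_right _ _))
      have h2 : dist (H y) (H z) < r := hd (hyz.trans_le (min_le_right _ _))
      have h3 : dist (H x) (H z) < r := hd (hxz.trans_le (min_le_right _ _))
      have := hconst x y hx hy (hxy.trans_le (min_le_left _ _)) (H y)
        ⟨by rwa [Metric.mem_ball, dist_comm], Metric.mem_ball_self hr⟩ (H z)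
        ⟨by rwa [Metric.mem_ball, dist_comm], by rwa [Metric.mem_ball, dist_comm]⟩
      linear_combination this)
  refine ⟨Φ, fun x hx => ⟨W x, hW x _ (Metric.mem_ball_self hr), ?_⟩⟩
  have e1 : ∀ᶠ y in 𝓝 x, ‖y‖ < R := (continuous_norm.tendsto x).eventually_lt_const hx
  filter_upwards [e1, Metric.ball_mem_nhds x (half_pos (lt_min hδ₀ hδ₁))] with y h1 h2
  exact hΦ x y hx.le h1.le (by rwa [dist_comm])

end JacobiRH

end

noncomputable section

namespace JacobiRH

/-! ### Homotopy invariance of the continued weight and of its integral -/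

/-- Along the path `z` on `S`, `l₁` and `l₂` are continuous logarithms of `1 - z` and `1 + z`, and
`φ` is a primitive of the corresponding branch of `(1 - z) ^ α * (1 + z) ^ β`. -/
structure IsWeightPrimitive (S : Set ℝ) (α β : ℂ) (z l₁ l₂ φ : ℝ → ℂ) : Prop where
  exp_left : ∀ s ∈ S, exp (l₁ s) = 1 - z s
  exp_right : ∀ s ∈ S, exp (l₂ s) = 1 + z s
  continuousOn_left : ContinuousOn l₁ S
  continuousOn_right : ContinuousOn l₂ S
  primitive : ∀ s ∈ S, ∃ W : ℂ → ℂ, HasDerivAt W (exp (α * l₁ s + β * l₂ s)) (z s) ∧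
    ∀ᶠ u in 𝓝[S] s, φ u - φ s = W (z u) - W (z s)

/-- The branch of `(1 - z) ^ α * (1 + z) ^ β` near `c` which belongs to the values `l₁` and `l₂` of
the logarithms of `1 - c` and `1 + c`. -/
def weightGerm (α β l₁ l₂ c z : ℂ) : ℂ :=
  exp (α * (l₁ + log ((1 - z) / (1 - c))) + β * (l₂ + log ((1 + z) / (1 + c))))

theorem differentiableAt_weightGerm {c z : ℂ} (h₁ : ‖z - c‖ < ‖1 - c‖) (h₂ : ‖z - c‖ < ‖1 + c‖)
    (α β l₁ l₂ : ℂ) : DifferentiableAt ℂ (weightGerm α β l₁ l₂ c) z := by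
  have k1 : 0 < ((1 - z) / (1 - c)).re := div_re_pos_of_norm_sub_lt (by
    rw [show 1 - z - (1 - c) = -(z - c) by ring, norm_neg]; exact h₁)
  have k2 : 0 < ((1 + z) / (1 + c)).re := div_re_pos_of_norm_sub_lt (by
    rw [show 1 + z - (1 + c) = z - c by ring]; exact h₂)
  have d1 : DifferentiableAt ℂ (fun z => log ((1 - z) / (1 - c))) z :=
    ((differentiableAt_id.const_sub 1).div_const _).clog (Or.inl k1)
  have d2 : DifferentiableAt ℂ (fun z => log ((1 + z) / (1 + c))) z :=
    ((differentiableAt_id.const_add 1).div_const _).clog (Or.inl k2)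
  exact (((d1.const_add l₁).const_mul α).add ((d2.const_add l₂).const_mul β)).cexp

/-- The unit square of a homotopy thus lies in the open ball of radius 2, on which the lifts are
taken. -/
theorem norm_prod_lt_two {x y : ℝ} (hx : x ∈ Icc (0 : ℝ) 1) (hy : y ∈ Icc (0 : ℝ) 1) :
    ‖(x, y)‖ < 2 := by
  rw [Prod.norm_def, max_lt_iff, Real.norm_of_nonneg hx.1, Real.norm_of_nonneg hy.1]
  exact ⟨by linarith [hx.2], by linarith [hy.2]⟩

/-- Both logarithms and the primitive are lifted along the whole homotopy. Two opposite sides of the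
square carry `p` and `q`; on the other two the homotopy rests at the base point and the lifts are
constant. Hence `p` and `q` share their initial and final data. -/
theorem exists_isWeightPrimitive_of_homotopic {ξ : Ioo (-1 : ℝ) 1}
    {p q : Path (basePoint ξ) (basePoint ξ)} (h : p.Homotopic q) (α β : ℂ) {zp zq : ℝ → ℂ}
    (hp : ∀ s : unitInterval, (p s : ℂ) = zp s) (hq : ∀ s : unitInterval, (q s : ℂ) = zq s) :
    ∃ l₁ l₂ φ l₁' l₂' φ' : ℝ → ℂ, IsWeightPrimitive (Icc 0 1) α β zp l₁ l₂ φ ∧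
      IsWeightPrimitive (Icc 0 1) α β zq l₁' l₂' φ' ∧
      l₁ 0 = Real.log (1 - ξ) ∧ l₂ 0 = Real.log (1 + ξ) ∧
      l₁' 0 = Real.log (1 - ξ) ∧ l₂' 0 = Real.log (1 + ξ) ∧
      l₁ 1 = l₁' 1 ∧ l₂ 1 = l₂' 1 ∧ φ 1 - φ 0 = φ' 1 - φ' 0 := by
  obtain ⟨F⟩ := h
  -- Clamping both coordinates extends the homotopy to a uniformly continuous map on the normed
  -- space ℝ × ℝ, where the lifting lemmas apply.
  set P : ℝ → unitInterval := projIcc (0 : ℝ) 1 zero_le_one with hP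
  have hPv : ∀ s (hs : s ∈ Icc (0 : ℝ) 1), P s = ⟨s, hs⟩ := fun s hs => projIcc_of_mem _ hs
  have hP0 : P 0 = 0 := hPv 0 (by simp)
  have hP1 : P 1 = 1 := hPv 1 (by simp)
  set G : ℝ × ℝ → ℂ := fun x => (F (P x.1, P x.2) : ℂ) with hG
  have hFc : Continuous fun x : unitInterval × unitInterval => (F x : ℂ) := by fun_prop
  have hPu : UniformContinuous P := (LipschitzWith.projIcc _).uniformContinuous
  have hGu : UniformContinuous G :=
    (CompactSpace.uniformContinuous_of_continuous hFc).comp (hPu.prodMap hPu)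
  obtain ⟨r, hr, hr1, hr2⟩ : ∃ r > 0, (∀ x, r ≤ ‖1 - G x‖) ∧ ∀ x, r ≤ ‖1 + G x‖ := by
    obtain ⟨x₀, -, hx₀⟩ := isCompact_univ.exists_isMinOn (univ_nonempty)
      (f := fun x : unitInterval × unitInterval => min ‖1 - (F x : ℂ)‖ ‖1 + (F x : ℂ)‖)
      (by fun_prop)
    refine ⟨min ‖1 - (F x₀ : ℂ)‖ ‖1 + (F x₀ : ℂ)‖, ?_, fun x => ?_, fun x => ?_⟩
    · have h1 := (F x₀).2.1
      have h2 := (F x₀).2.2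
      refine lt_min (norm_pos_iff.2 fun h => h1 ?_) (norm_pos_iff.2 fun h => h2 ?_)
      · linear_combination -h
      · linear_combination h
    · exact (hx₀ (mem_univ (P x.1, P x.2))).trans (min_le_left _ _)
    · exact (hx₀ (mem_univ (P x.1, P x.2))).trans (min_le_right _ _)
  have hξ := ξ.2
  have hG0 : G 0 = (ξ : ℝ) := by
    simp only [hG, Prod.fst_zero, Prod.snd_zero, hP0]
    rw [F.source]; rfl
  obtain ⟨L₁, hL₁0, hL₁e, hL₁c, δ₁, hδ₁, hL₁⟩ := exists_log_lift (g := fun x => 1 - G x)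
    (uniformContinuous_const.sub hGu) hr hr1 (l₀ := Real.log (1 - ξ)) (by
      rw [← ofReal_exp, Real.exp_log (by linarith [hξ.2]), hG0]; push_cast; rfl) 2
  obtain ⟨L₂, hL₂0, hL₂e, hL₂c, δ₂, hδ₂, hL₂⟩ := exists_log_lift (g := fun x => 1 + G x)
    (uniformContinuous_const.add hGu) hr hr2 (l₀ := Real.log (1 + ξ)) (by
      rw [← ofReal_exp, Real.exp_log (by linarith [hξ.1]), hG0]; push_cast; rfl) 2

  have hne1 : ∀ x, 1 - G x ≠ 0 := fun x h => by
    have := hr1 x; rw [h, norm_zero] at this; linarith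
  have hne2 : ∀ x, 1 + G x ≠ 0 := fun x h => by
    have := hr2 x; rw [h, norm_zero] at this; linarith
  have hfd : ∀ x, DifferentiableOn ℂ (weightGerm α β (L₁ x) (L₂ x) (G x))
      (Metric.ball (G x) r) := by
    intro x z hz
    rw [Metric.mem_ball, dist_eq_norm] at hz
    exact (differentiableAt_weightGerm (hz.trans_le (hr1 x)) (hz.trans_le (hr2 x))
      _ _ _ _).differentiableWithinAt
  obtain ⟨δ₃, hδ₃, hd⟩ := Metric.uniformContinuous_iff.1 hGu r hr
  obtain ⟨Φ, hΦ⟩ := exists_primitive_along hGu hr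
    (f := fun x => weightGerm α β (L₁ x) (L₂ x) (G x)) (R := 2) hfd
    (lt_min hδ₁ (lt_min hδ₂ hδ₃)) (by
      intro x y hx hy hxy z hz
      have hxy1 := hxy.trans_le (min_le_left _ _)
      have hxy2 := hxy.trans_le ((min_le_right _ _).trans (min_le_left _ _))
      have hxy3 := hd (hxy.trans_le ((min_le_right _ _).trans (min_le_right _ _)))
      have hzy := hz.2
      rw [dist_comm, dist_eq_norm] at hxy3
      rw [Metric.mem_ball, dist_eq_norm] at hzy
      -- Moving the centre of the germ from `G x` to `G y` changes its logarithms by exactly what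
      -- the lifts gain.
      have k1 := log_div_add_log_div (u := 1 - G x) (v := 1 - G y) (w := 1 - z)
        (by rw [show 1 - G y - (1 - G x) = -(G y - G x) by ring, norm_neg]
            exact hxy3.trans_le (hr1 x))
        (by rw [show 1 - z - (1 - G y) = -(z - G y) by ring, norm_neg]
            exact hzy.trans_le (hr1 y)) (hne1 y)
      have k2 := log_div_add_log_div (u := 1 + G x) (v := 1 + G y) (w := 1 + z)
        (by rw [show 1 + G y - (1 + G x) = (G y - G x) by ring]
            exact hxy3.trans_le (hr2 x))
        (by rw [show 1 + z - (1 + G y) = (z - G y) by ring]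
            exact hzy.trans_le (hr2 y)) (hne2 y)
      rw [weightGerm, weightGerm, hL₁ x y hx hy hxy1, hL₂ x y hx hy hxy2, ← k1, ← k2]
      congr 1; ring)
  have hfx : ∀ x, weightGerm α β (L₁ x) (L₂ x) (G x) (G x) = exp (α * L₁ x + β * L₂ x) :=
    fun x => by simp [weightGerm, div_self (hne1 x), div_self (hne2 x)]
  have main : ∀ (t : ℝ) (ht : t ∈ Icc (0 : ℝ) 1) (z : ℝ → ℂ)
      (_ : ∀ s ∈ Icc (0 : ℝ) 1, G (t, s) = z s), IsWeightPrimitive (Icc 0 1) α β z (fun s => L₁ (t, s))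
      (fun s => L₂ (t, s)) (fun s => Φ (t, s)) := by
    intro t ht z hz
    have hn : ∀ s ∈ Icc (0 : ℝ) 1, ‖(t, s)‖ < 2 := fun s hs => norm_prod_lt_two ht hs
    have hc : Continuous fun s : ℝ => (t, s) := by fun_prop
    refine ⟨fun s hs => ?_, fun s hs => ?_, fun s hs => ?_, fun s hs => ?_, fun s hs => ?_⟩
    · rw [hL₁e _ (hn s hs), hz s hs]
    · rw [hL₂e _ (hn s hs), hz s hs]
    · exact ((hL₁c _ (hn s hs)).comp hc.continuousAt).continuousWithinAt
    · exact ((hL₂c _ (hn s hs)).comp hc.continuousAt).continuousWithinAt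
    · obtain ⟨W, hW, hWe⟩ := hΦ _ (hn s hs)
      rw [hfx, hz s hs] at hW
      refine ⟨W, hW, ?_⟩
      filter_upwards [nhdsWithin_le_nhds (hc.continuousAt.eventually hWe),
        self_mem_nhdsWithin] with u hu hu'
      rw [hu, hz s hs, hz u hu']
  have side : ∀ (s : ℝ) (hs : s ∈ Icc (0 : ℝ) 1) (_ : ∀ t ∈ Icc (0 : ℝ) 1, ∀ᶠ u in 𝓝 t,
      G (u, s) = G (t, s)), L₁ (1, s) = L₁ (0, s) ∧ L₂ (1, s) = L₂ (0, s) ∧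
      Φ (1, s) = Φ (0, s) := by
    intro s hs hGs
    have hc : Continuous fun t : ℝ => (t, s) := by fun_prop
    have hev : ∀ (t : ℝ) (δ : ℝ), 0 < δ → t ∈ Icc (0 : ℝ) 1 →
        ∀ᶠ u in 𝓝 t, ‖(u, s)‖ ≤ 2 ∧ dist (t, s) (u, s) < δ := by
      intro t δ hδ ht
      have e1 : ∀ᶠ u in 𝓝 t, ‖(u, s)‖ < 2 :=
        (hc.norm.tendsto t).eventually_lt_const (norm_prod_lt_two ht hs)
      have e2 : Tendsto (fun u => dist (t, s) (u, s)) (𝓝 t) (𝓝 (dist (t, s) (t, s))) :=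
        (continuous_const.dist hc).tendsto t
      rw [dist_self] at e2
      filter_upwards [e1, e2.eventually_lt_const hδ] with u h1 h2 using ⟨h1.le, h2⟩
    refine ⟨eq_of_eventually_eq_nhds (g := fun t => L₁ (t, s)) fun t ht => ?_,
      eq_of_eventually_eq_nhds (g := fun t => L₂ (t, s)) fun t ht => ?_,
      eq_of_eventually_eq_nhds (g := fun t => Φ (t, s)) fun t ht => ?_⟩
    · filter_upwards [hev t δ₁ hδ₁ ht, hGs t ht] with u h1 h2
      rw [hL₁ (t, s) (u, s) (norm_prod_lt_two ht hs).le h1.1 h1.2, h2, div_self (hne1 _), log_one,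
        add_zero]
    · filter_upwards [hev t δ₂ hδ₂ ht, hGs t ht] with u h1 h2
      rw [hL₂ (t, s) (u, s) (norm_prod_lt_two ht hs).le h1.1 h1.2, h2, div_self (hne2 _), log_one,
        add_zero]
    · obtain ⟨W, -, hWe⟩ := hΦ _ (norm_prod_lt_two ht hs)
      filter_upwards [hc.continuousAt.eventually hWe, hGs t ht] with u h1 h2
      rw [h2, sub_self] at h1
      exact sub_eq_zero.1 h1
  have hleft : ∀ t, G (t, 0) = (ξ : ℝ) := fun t => by
    simp only [hG, hP0, F.source]; rfl
  have hright : ∀ t, G (t, 1) = (ξ : ℝ) := fun t => by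
    simp only [hG, hP1, F.target]; rfl
  obtain ⟨a1, a2, a3⟩ := side 0 (by simp) fun t _ => Eventually.of_forall fun u => by
    rw [hleft, hleft]
  obtain ⟨b1, b2, b3⟩ := side 1 (by simp) fun t _ => Eventually.of_forall fun u => by
    rw [hright, hright]
  have z00 : ((0 : ℝ), (0 : ℝ)) = 0 := rfl
  refine ⟨_, _, _, _, _, _, main 0 (by simp) zp fun s hs => ?_, main 1 (by simp) zq fun s hs => ?_,
    hL₁0, hL₂0, ?_, ?_, b1.symm, b2.symm, ?_⟩
  · rw [← hp ⟨s, hs⟩]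
    simp only [hG, hP0, hPv s hs, F.apply_zero]; rfl
  · rw [← hq ⟨s, hs⟩]
    simp only [hG, hP1, hPv s hs, F.apply_one]; rfl
  · exact a1.trans hL₁0
  · exact a2.trans hL₂0
  · rw [a3, b3]

end JacobiRH

end

noncomputable section

namespace JacobiRH

/-! ### Uniqueness of continuous logarithms, and derivatives of primitives -/

theorem eq_of_hasDerivWithinAt_zero {g : ℝ → ℂ} {c d : ℝ}
    (h : ∀ s ∈ Icc c d, HasDerivWithinAt g 0 (Icc c d) s) {s : ℝ} (hs : s ∈ Icc c d) :
    g s = g c :=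
  constant_of_has_deriv_right_zero (fun x hx => (h x hx).continuousWithinAt)
    (fun x hx => (h x (Ico_subset_Icc_self hx)).mono_of_mem_nhdsWithin
      (Icc_mem_nhdsGE_of_mem hx)) s hs

/-- The difference of the two logarithms moves only by multiples of 2πi, and near each point by less
than 1 in norm, so it is locally constant. -/
theorem eq_of_continuousOn_of_exp_eq {l m : ℝ → ℂ} {c d : ℝ} (hl : ContinuousOn l (Icc c d))
    (hm : ContinuousOn m (Icc c d)) (h : ∀ s ∈ Icc c d, exp (l s) = exp (m s)) (h0 : l c = m c)
    {s : ℝ} (hs : s ∈ Icc c d) : l s = m s := by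
  have hD : ∀ s ∈ Icc c d, HasDerivWithinAt (fun s => l s - m s) 0 (Icc c d) s := by
    intro s hs
    have hc : Tendsto (fun u => ‖(l u - m u) - (l s - m s)‖) (𝓝[Icc c d] s) (𝓝 0) := by
      have := (((hl s hs).sub (hm s hs)).sub
        (continuousWithinAt_const (b := l s - m s))).norm.tendsto
      simpa using this
    refine (hasDerivWithinAt_const s _ (l s - m s)).congr_of_eventuallyEq ?_ rfl
    filter_upwards [hc.eventually_lt_const one_pos, self_mem_nhdsWithin] with u hu hu'
    set D := (l u - m u) - (l s - m s) with hDdef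
    have e1 : exp D = 1 := by
      rw [hDdef, exp_sub, exp_sub, exp_sub, h u hu', h s hs, div_self (exp_ne_zero _),
        div_self (exp_ne_zero _), div_one]
    have him := (abs_le.1 ((abs_im_le_norm D).trans hu.le))
    have hpi := Real.pi_gt_three
    have e2 := log_exp (x := D) (by linarith) (by linarith)
    rw [e1, log_one] at e2
    exact sub_eq_zero.1 e2.symm
  have := eq_of_hasDerivWithinAt_zero hD hs
  rw [h0, sub_self] at this
  exact sub_eq_zero.1 this

namespace IsWeightPrimitive

variable {S : Set ℝ} {α β : ℂ} {z l₁ l₂ φ : ℝ → ℂ}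

theorem mono (h : IsWeightPrimitive S α β z l₁ l₂ φ) {T : Set ℝ} (hT : T ⊆ S) :
    IsWeightPrimitive T α β z l₁ l₂ φ where
  exp_left s hs := h.exp_left s (hT hs)
  exp_right s hs := h.exp_right s (hT hs)
  continuousOn_left := h.continuousOn_left.mono hT
  continuousOn_right := h.continuousOn_right.mono hT
  primitive s hs := by
    obtain ⟨W, hW, hWe⟩ := h.primitive s (hT hs)
    exact ⟨W, hW, nhdsWithin_mono s hT hWe⟩

/-- The reflection `z ↦ -z` exchanges the roles of `1` and `-1`. -/
theorem neg (h : IsWeightPrimitive S α β z l₁ l₂ φ) :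
    IsWeightPrimitive S β α (fun s => -z s) l₂ l₁ (fun s => -φ s) where
  exp_left s hs := by rw [h.exp_right s hs]; ring
  exp_right s hs := by rw [h.exp_left s hs]; ring
  continuousOn_left := h.continuousOn_right
  continuousOn_right := h.continuousOn_left
  primitive s hs := by
    obtain ⟨W, hW, hWe⟩ := h.primitive s hs
    refine ⟨fun v => -W (-v), ?_, ?_⟩
    · have h1 : HasDerivAt (fun v : ℂ => -v) (-1) (-z s) := (hasDerivAt_id _).neg
      have h2 : HasDerivAt W (exp (α * l₁ s + β * l₂ s)) (-(-z s)) := by rwa [neg_neg]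
      refine ((h2.comp _ h1).neg).congr_deriv ?_
      rw [add_comm (β * l₂ s)]; ring
    · filter_upwards [hWe] with u hu
      simp only [neg_neg]
      linear_combination -hu

/-- On a differentiable path the local primitives obey the chain rule; this is how a change of `φ`
becomes an integral of the weight. -/
theorem hasDerivWithinAt (h : IsWeightPrimitive S α β z l₁ l₂ φ) {s : ℝ} (hs : s ∈ S) {z' : ℂ}
    (hz : HasDerivWithinAt z z' S s) :
    HasDerivWithinAt φ (exp (α * l₁ s + β * l₂ s) * z') S s := by
  obtain ⟨W, hW, hWe⟩ := h.primitive s hs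
  have h1 : HasDerivWithinAt (fun u => W (z u) + (φ s - W (z s)))
      (exp (α * l₁ s + β * l₂ s) * z') S s := (hW.comp_hasDerivWithinAt s hz).add_const _
  refine h1.congr_of_eventuallyEq ?_ (by ring)
  filter_upwards [hWe] with u hu
  linear_combination hu

end IsWeightPrimitive

/-! ### An explicit primitive on the disc of radius `2` -/

/-- The solution, regular at `u = 0`, of `a h + u h' = -(2 - u) ^ β`. -/
def discPrimitive (a β u : ℂ) : ℂ := -∫ τ in (0 : ℝ)..1, (τ : ℂ) ^ (a - 1) * (2 - τ * u) ^ β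

theorem two_sub_mem_slitPlane {v : ℂ} (hv : ‖v‖ < 2) : 2 - v ∈ slitPlane := by
  refine Or.inl ?_
  have := (abs_le.1 (abs_re_le_norm v)).2
  simp only [sub_re, re_ofNat]
  linarith

theorem norm_ofReal_mul_lt {τ : ℝ} (hτ : τ ∈ Icc (0 : ℝ) 1) {u : ℂ} (hu : ‖u‖ < 2) :
    ‖(τ : ℂ) * u‖ < 2 := by
  rw [norm_mul, norm_real, Real.norm_of_nonneg hτ.1]
  nlinarith [norm_nonneg u, hτ.2]

theorem intervalIntegrable_cpow_mul {a : ℂ} (ha : 0 < a.re) {g : ℝ → ℂ}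
    (hg : ContinuousOn g (Icc 0 1)) :
    IntervalIntegrable (fun τ : ℝ => (τ : ℂ) ^ (a - 1) * g τ) MeasureTheory.volume 0 1 := by
  refine (intervalIntegral.intervalIntegrable_cpow' (by simpa using ha)).mul_continuousOn ?_
  rwa [uIcc_of_le zero_le_one]

theorem continuousOn_two_sub_cpow {u : ℂ} (hu : ‖u‖ < 2) (β : ℂ) :
    ContinuousOn (fun τ : ℝ => (2 - (τ : ℂ) * u) ^ β) (Icc 0 1) := by
  intro τ hτ
  refine ContinuousAt.continuousWithinAt ?_
  exact ContinuousAt.cpow (by fun_prop) continuousAt_const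
    (two_sub_mem_slitPlane (norm_ofReal_mul_lt hτ hu))

theorem hasDerivAt_discPrimitive {a : ℂ} (ha : 0 < a.re) (β : ℂ) {u : ℂ} (hu : ‖u‖ < 2) :
    HasDerivAt (discPrimitive a β)
      (-∫ τ in (0 : ℝ)..1, (τ : ℂ) ^ (a - 1) * (β * (2 - τ * u) ^ (β - 1) * (-τ))) u := by
  obtain ⟨R, hR1, hR2⟩ := exists_between hu
  -- A radius strictly below 2 keeps 2 - τv away from the branch point uniformly in `τ`, so
  -- integrability rests on τ^(a-1) alone.
  obtain ⟨C, hC⟩ : ∃ C, ∀ v ∈ Metric.closedBall (0 : ℂ) R, ‖(2 - v) ^ (β - 1)‖ ≤ C := by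
    refine (isCompact_closedBall (0 : ℂ) R).exists_bound_of_continuousOn fun v hv => ?_
    refine ContinuousAt.continuousWithinAt (ContinuousAt.cpow (by fun_prop) continuousAt_const
      (two_sub_mem_slitPlane ?_))
    exact (mem_closedBall_zero_iff.1 hv).trans_lt hR2
  have hR0 : 0 < R := (norm_nonneg u).trans_lt hR1
  have h01 : uIoc (0 : ℝ) 1 = Ioc 0 1 := uIoc_of_le zero_le_one
  refine ((intervalIntegral.hasDerivAt_integral_of_dominated_loc_of_deriv_le
    (F := fun u (τ : ℝ) => (τ : ℂ) ^ (a - 1) * (2 - τ * u) ^ β)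
    (F' := fun u (τ : ℝ) => (τ : ℂ) ^ (a - 1) * (β * (2 - τ * u) ^ (β - 1) * (-τ)))
    (bound := fun τ => ‖(τ : ℂ) ^ (a - 1)‖ * (‖β‖ * C))
    (s := Metric.ball 0 R) (x₀ := u) (μ := MeasureTheory.volume)
    (Metric.isOpen_ball.mem_nhds (by simpa using hR1)) ?_ ?_ ?_ ?_ ?_ ?_).2).neg
  · filter_upwards [Metric.isOpen_ball.mem_nhds (show u ∈ Metric.ball (0 : ℂ) 2 by simpa using hu)]
      with v hv
    have := (intervalIntegrable_cpow_mul ha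
      (continuousOn_two_sub_cpow (mem_ball_zero_iff.1 hv) β)).aestronglyMeasurable
    rwa [h01]
  · exact intervalIntegrable_cpow_mul ha (continuousOn_two_sub_cpow hu β)
  · rw [h01]
    exact (intervalIntegrable_cpow_mul ha (((continuousOn_const.mul
      (continuousOn_two_sub_cpow hu (β - 1))).mul (by fun_prop)))).aestronglyMeasurable
  · refine Eventually.of_forall fun τ hτ v hv => ?_
    rw [h01] at hτ
    have hv' := mem_ball_zero_iff.1 hv
    rw [norm_mul, norm_mul, norm_mul]
    have h1 : ‖(2 - (τ : ℂ) * v) ^ (β - 1)‖ ≤ C := hC _ (by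
      rw [mem_closedBall_zero_iff, norm_mul, norm_real, Real.norm_of_nonneg hτ.1.le]
      nlinarith [norm_nonneg v, hτ.2])
    have h2 : ‖-(τ : ℂ)‖ ≤ 1 := by
      rw [norm_neg, norm_real, Real.norm_of_nonneg hτ.1.le]; exact hτ.2
    have hC0 : 0 ≤ C := (norm_nonneg _).trans h1
    refine mul_le_mul_of_nonneg_left ?_ (norm_nonneg _)
    calc ‖β‖ * ‖(2 - (τ : ℂ) * v) ^ (β - 1)‖ * ‖-(τ : ℂ)‖ ≤ ‖β‖ * C * 1 := by gcongr
      _ = ‖β‖ * C := mul_one _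
  · exact ((intervalIntegral.intervalIntegrable_cpow' (by simpa using ha)).norm).mul_const _
  · refine Eventually.of_forall fun τ hτ v hv => ?_
    rw [h01] at hτ
    have hs := two_sub_mem_slitPlane (norm_ofReal_mul_lt (Ioc_subset_Icc_self hτ)
      ((mem_ball_zero_iff.1 hv).trans hR2))
    have h1 : HasDerivAt (fun v : ℂ => 2 - (τ : ℂ) * v) (-τ) v := by
      simpa using ((hasDerivAt_id v).const_mul (τ : ℂ)).const_sub 2
    exact (h1.cpow_const hs).const_mul _

/-- The combined integrand is the τ-derivative of τ^a (2 - τu)^β, which vanishes at τ = 0 because Re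
a > 0. With u = 1 - z and h the disc primitive, the equation says that u^a h is a primitive in z of
(1 - z)^(a-1) (1 + z)^β. -/
theorem discPrimitive_ode {a : ℂ} (ha : 0 < a.re) (β : ℂ) {u : ℂ} (hu : ‖u‖ < 2) :
    a * discPrimitive a β u +
      u * (-∫ τ in (0 : ℝ)..1, (τ : ℂ) ^ (a - 1) * (β * (2 - τ * u) ^ (β - 1) * (-τ))) =
    -(2 - u) ^ β := by
  have ha0 : a ≠ 0 := fun h => by simp [h] at ha
  have i1 := intervalIntegrable_cpow_mul ha (continuousOn_two_sub_cpow hu β)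
  have i2 := intervalIntegrable_cpow_mul ha
    (g := fun τ : ℝ => β * (2 - (τ : ℂ) * u) ^ (β - 1) * (-τ)) ((continuousOn_const.mul
    (continuousOn_two_sub_cpow hu (β - 1))).mul (by fun_prop))
  have key := intervalIntegral.integral_eq_sub_of_hasDerivAt_of_le zero_le_one
    (f := fun τ : ℝ => (τ : ℂ) ^ a * (2 - τ * u) ^ β)
    (f' := fun τ : ℝ => a * ((τ : ℂ) ^ (a - 1) * (2 - τ * u) ^ β) +
      u * ((τ : ℂ) ^ (a - 1) * (β * (2 - τ * u) ^ (β - 1) * (-τ)))) ?_ ?_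
    ((i1.const_mul a).add (i2.const_mul u))
  · rw [intervalIntegral.integral_add (i1.const_mul a) (i2.const_mul u),
      intervalIntegral.integral_const_mul, intervalIntegral.integral_const_mul] at key
    simp only [ofReal_one, one_cpow, ofReal_zero, zero_cpow ha0, zero_mul, sub_zero, one_mul]
      at key
    rw [discPrimitive]
    linear_combination -key
  · refine ContinuousOn.mul (fun τ hτ => ?_) (continuousOn_two_sub_cpow hu β)
    exact (continuousAt_ofReal_cpow_const τ a (Or.inl ha)).continuousWithinAt
  · intro τ hτ
    have h1 : HasDerivAt (fun v : ℂ => 2 - v * u) (-u) (τ : ℂ) := by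
      simpa using ((hasDerivAt_id (τ : ℂ)).mul_const u).const_sub 2
    have h2 := h1.cpow_const (c := β)
      (two_sub_mem_slitPlane (norm_ofReal_mul_lt (Ioo_subset_Icc_self hτ) hu))
    have h3 : HasDerivAt (fun v : ℂ => v ^ a) (a * (τ : ℂ) ^ (a - 1) * 1) (τ : ℂ) :=
      (hasDerivAt_id (τ : ℂ)).cpow_const (Or.inl (by simpa using hτ.1))
    refine ((h3.mul h2).comp_ofReal).congr_deriv ?_
    have h4 : (τ : ℂ) ^ a = τ ^ (a - 1) * τ := by
      have : (τ : ℂ) ≠ 0 := by exact_mod_cast hτ.1.ne'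
      rw [cpow_sub _ _ this, cpow_one, div_mul_cancel₀ _ this]
    rw [h4]; ring

end JacobiRH

end

noncomputable section

namespace JacobiRH

/-! ### The integral over the reference loop -/

/-- The change of a primitive along an arc of a circle around `1` of radius less than `2`. -/
theorem IsWeightPrimitive.circle_arc {α β : ℂ} (hα : 0 < (α + 1).re) {c d : ℝ} (hcd : c ≤ d)
    {z l₁ l₂ φ m : ℝ → ℂ} (h : IsWeightPrimitive (Icc c d) α β z l₁ l₂ φ) {κ k : ℂ}
    (hm : ∀ s, HasDerivAt m κ s) (hz : ∀ s ∈ Icc c d, z s = 1 - exp (m s))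
    (hlt : ∀ s, ‖exp (m s)‖ < 2) (hk : exp k = 1) {A B : ℂ} (hA : m c = A) (hB : m d = B)
    (h₁ : l₁ c = A) (h₂ : l₂ c = log (2 - exp A) + k) :
    l₁ d = B ∧ l₂ d = log (2 - exp B) + k ∧
      φ d - φ c = exp (β * k) * (exp ((α + 1) * B) * discPrimitive (α + 1) β (exp B) -
          exp ((α + 1) * A) * discPrimitive (α + 1) β (exp A)) := by
  subst hA hB
  have hmc : Continuous m := continuous_iff_continuousAt.2 fun s => (hm s).continuousAt
  -- Both logarithms are known in closed form: `m` is a logarithm of 1 - z, and since 2 - exp m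
  -- stays in the right half-plane, the other one is the principal logarithm plus the period `k`.
  have e1 : ∀ s ∈ Icc c d, l₁ s = m s := fun s hs =>
    eq_of_continuousOn_of_exp_eq h.continuousOn_left hmc.continuousOn
      (fun s hs => by rw [h.exp_left s hs, hz s hs]; ring) h₁ hs
  have hsl : ∀ s, 2 - exp (m s) ∈ slitPlane := fun s => two_sub_mem_slitPlane (hlt s)
  have hlc : Continuous fun s => log (2 - exp (m s)) + k :=
    (Continuous.clog (by fun_prop) hsl).add continuous_const
  have e2 : ∀ s ∈ Icc c d, l₂ s = log (2 - exp (m s)) + k := fun s hs =>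
    eq_of_continuousOn_of_exp_eq h.continuousOn_right hlc.continuousOn
      (fun s hs => by
        rw [h.exp_right s hs, hz s hs, exp_add, hk, exp_log (slitPlane_ne_zero (hsl s))]
        ring) h₂ hs
  have hc : c ∈ Icc c d := left_mem_Icc.2 hcd
  have hd : d ∈ Icc c d := right_mem_Icc.2 hcd
  refine ⟨e1 d hd, e2 d hd, ?_⟩
  -- By `discPrimitive_ode` the subtracted expression is a primitive of the same branch of the
  -- weight along the arc.
  have hD : ∀ s ∈ Icc c d, HasDerivWithinAt (fun s => φ s - exp (β * k) *
      (exp ((α + 1) * m s) * discPrimitive (α + 1) β (exp (m s)))) 0 (Icc c d) s := by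
    intro s hs
    have d0 : HasDerivAt (fun s => exp (m s)) (exp (m s) * κ) s := (hm s).cexp
    have d1 : HasDerivWithinAt z (-(exp (m s) * κ)) (Icc c d) s :=
      (d0.const_sub 1).hasDerivWithinAt.congr hz (hz s hs)
    have d2 := h.hasDerivWithinAt hs d1
    have d3 := ((((hm s).const_mul (α + 1)).cexp.mul
      ((hasDerivAt_discPrimitive hα β (hlt s)).comp s d0)).const_mul
        (exp (β * k))).hasDerivWithinAt (s := Icc c d)
    refine (d2.sub d3).congr_deriv ?_
    rw [e1 s hs, e2 s hs]
    have ode := discPrimitive_ode hα β (hlt s)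
    have x1 : exp (α * m s + β * (log (2 - exp (m s)) + k)) * exp (m s) =
        exp ((α + 1) * m s) * (2 - exp (m s)) ^ β * exp (β * k) := by
      rw [cpow_def_of_ne_zero (slitPlane_ne_zero (hsl s)), ← exp_add, ← exp_add, ← exp_add]
      congr 1; ring
    set J := -∫ τ in (0 : ℝ)..1,
      (τ : ℂ) ^ (α + 1 - 1) * (β * (2 - τ * exp (m s)) ^ (β - 1) * (-τ))
    simp only [Function.comp_apply]
    linear_combination (-κ) * x1 - exp (β * k) * exp ((α + 1) * m s) * κ * ode
  have := eq_of_hasDerivWithinAt_zero hD hd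
  linear_combination this

theorem trans_apply_of_le {X : Type*} [TopologicalSpace X] {x y w : X} (p : Path x y)
    (q : Path y w) {s t : ℝ} (h : s ∈ Icc (0 : ℝ) 1) (ht : t ∈ Icc (0 : ℝ) 1) (hst : t = 2 * s) :
    (p.trans q) ⟨s, h⟩ = p ⟨t, ht⟩ := by
  subst hst
  rw [Path.trans_apply, dif_pos (show s ≤ 1 / 2 by linarith [ht.2])]

theorem trans_apply_of_ge {X : Type*} [TopologicalSpace X] {x y w : X} (p : Path x y)
    (q : Path y w) {s t : ℝ} (h : s ∈ Icc (0 : ℝ) 1) (ht : t ∈ Icc (0 : ℝ) 1)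
    (hst : t = 2 * s - 1) : (p.trans q) ⟨s, h⟩ = q ⟨t, ht⟩ := by
  subst hst
  rcases (show 1 / 2 ≤ s by linarith [ht.1]).eq_or_lt with h' | h'
  · subst h'
    rw [Path.trans_apply, dif_pos le_rfl]
    have e1 : (⟨2 * (1 / 2 : ℝ), by norm_num⟩ : unitInterval) = 1 :=
      Subtype.ext (by norm_num)
    have e2 : (⟨2 * (1 / 2 : ℝ) - 1, ht⟩ : unitInterval) = 0 :=
      Subtype.ext (by norm_num)
    have e3 : p ⟨2 * (1 / 2 : ℝ), by norm_num⟩ = y := by rw [e1, p.target]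
    rw [e2, q.source]
    exact e3
  · rw [Path.trans_apply, dif_neg (not_le.2 h')]

theorem symm_apply_of_eq {X : Type*} [TopologicalSpace X] {x y : X} (p : Path x y) {s t : ℝ}
    (h : s ∈ Icc (0 : ℝ) 1) (ht : t ∈ Icc (0 : ℝ) 1) (hst : t = 1 - s) :
    p.symm ⟨s, h⟩ = p ⟨t, ht⟩ := by
  subst hst; rfl

theorem coe_loopOne (ξ : Ioo (-1 : ℝ) 1) (s : unitInterval) : (loopOne ξ s : ℂ) =
    1 - ((1 - (ξ : ℝ) : ℝ) : ℂ) * exp (2 * Real.pi * (s : ℝ) * I) := rfl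

theorem coe_loopNegOne (ξ : Ioo (-1 : ℝ) 1) (s : unitInterval) : (loopNegOne ξ s : ℂ) =
    -1 + ((1 + (ξ : ℝ) : ℝ) : ℂ) * exp (2 * Real.pi * (s : ℝ) * I) := rfl

theorem ofReal_cpow_eq_exp {x : ℝ} (hx : 0 < x) (c : ℂ) :
    (x : ℂ) ^ c = exp (c * (Real.log x : ℝ)) := by
  rw [cpow_def_of_ne_zero (by exact_mod_cast hx.ne'), ← ofReal_log hx.le, mul_comm]

/-- The substitution t = ρτ/2 turns the disc primitive at a real point into an incomplete Beta
integral. -/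
theorem exp_mul_discPrimitive {a b : ℂ} {ρ : ℝ} (hρ : 0 < ρ) (hρ2 : ρ < 2) :
    exp (a * Real.log ρ) * discPrimitive a (b - 1) ρ =
      -((2 : ℂ) ^ (a + b - 1) *
        ∫ t in (0 : ℝ)..(ρ / 2), (t : ℂ) ^ (a - 1) * (1 - t) ^ (b - 1)) := by
  have hs := intervalIntegral.integral_comp_mul_left (a := 0) (b := 1)
    (fun t : ℝ => (t : ℂ) ^ (a - 1) * (1 - (t : ℂ)) ^ (b - 1)) (c := ρ / 2) (by positivity)
  rw [mul_zero, mul_one] at hs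
  have hs' : ∫ t in (0 : ℝ)..(ρ / 2), (t : ℂ) ^ (a - 1) * (1 - (t : ℂ)) ^ (b - 1) =
      ((ρ / 2 : ℝ) : ℂ) * ∫ t in (0 : ℝ)..1,
        (((ρ / 2 * t : ℝ) : ℂ) ^ (a - 1) * (1 - ((ρ / 2 * t : ℝ) : ℂ)) ^ (b - 1)) := by
    rw [hs, real_smul, ← mul_assoc, ← ofReal_mul, mul_inv_cancel₀ (by positivity), ofReal_one,
      one_mul]
  rw [hs', discPrimitive, mul_neg, ← mul_assoc, ← intervalIntegral.integral_const_mul,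
    ← intervalIntegral.integral_const_mul]
  congr 1
  refine intervalIntegral.integral_congr_ae (Eventually.of_forall fun τ hτ => ?_)
  rw [uIoc_of_le zero_le_one] at hτ
  have h1 : 0 < 2 - τ * ρ := by nlinarith [hτ.1, hτ.2]
  have e1 : (2 : ℂ) - τ * ρ = ((2 - τ * ρ : ℝ) : ℂ) := by push_cast; ring
  have e2 : (1 : ℂ) - ((ρ / 2 * τ : ℝ) : ℂ) = (((2 - τ * ρ) / 2 : ℝ) : ℂ) := by push_cast; ring
  have e3 : (2 : ℂ) = ((2 : ℝ) : ℂ) := by norm_num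
  have e4 : ((ρ / 2 : ℝ) : ℂ) = exp ((Real.log (ρ / 2) : ℝ)) := by
    rw [← ofReal_exp, Real.exp_log (by positivity)]
  rw [e1, e2, e3, ofReal_cpow_eq_exp hτ.1, ofReal_cpow_eq_exp h1, ofReal_cpow_eq_exp two_pos,
    ofReal_cpow_eq_exp (mul_pos (half_pos hρ) hτ.1), ofReal_cpow_eq_exp (half_pos h1), e4,
    Real.log_mul (half_pos hρ).ne' hτ.1.ne', Real.log_div h1.ne' two_ne_zero,
    Real.log_div hρ.ne' two_ne_zero]
  simp only [← exp_add]
  congr 1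
  push_cast
  ring

/-- `exp (2πi a) - 1` -/
def turnFactor (a : ℂ) : ℂ := exp (2 * Real.pi * I * a) - 1

/-- After t ↦ 1 - t in the second term, the two incomplete Beta integrals cover [0, (1-ξ)/2] and
[(1-ξ)/2, 1]. Together they give the full Beta integral, and the base point drops out. -/
theorem basePoint_sum {a b : ℂ} (ha : 0 < a.re) (hb : 0 < b.re) (ξ : Ioo (-1 : ℝ) 1) :
    exp (a * Real.log (1 - ξ)) * discPrimitive a (b - 1) ((1 - ξ : ℝ) : ℂ) +
    exp (b * Real.log (1 + ξ)) * discPrimitive b (a - 1) ((1 + ξ : ℝ) : ℂ) =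
    -((2 : ℂ) ^ (a + b - 1) * betaIntegral a b) := by
  have hξ := ξ.2
  rw [exp_mul_discPrimitive (by linarith [hξ.2]) (by linarith [hξ.1]),
    exp_mul_discPrimitive (by linarith [hξ.1]) (by linarith [hξ.2])]
  set f : ℝ → ℂ := fun t => (t : ℂ) ^ (a - 1) * (1 - (t : ℂ)) ^ (b - 1) with hf
  have h1 : ∫ t in (0 : ℝ)..((1 + ξ) / 2), (t : ℂ) ^ (b - 1) * (1 - (t : ℂ)) ^ (a - 1) =
      ∫ t in ((1 - ξ : ℝ) / 2)..1, f t := by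
    have := intervalIntegral.integral_comp_sub_left (a := 0) (b := (1 + (ξ : ℝ)) / 2) f 1
    rw [sub_zero, show (1 : ℝ) - (1 + ξ) / 2 = (1 - ξ) / 2 by ring] at this
    rw [← this]
    refine intervalIntegral.integral_congr fun t _ => ?_
    simp only [hf]
    push_cast
    rw [mul_comm, sub_sub_cancel]
  have hI : IntervalIntegrable f MeasureTheory.volume 0 1 := betaIntegral_convergent ha hb
  have hm : (1 - (ξ : ℝ)) / 2 ∈ Icc (0 : ℝ) 1 := ⟨by linarith [hξ.2], by linarith [hξ.1]⟩
  have hm' : (1 - (ξ : ℝ)) / 2 ∈ uIcc (0 : ℝ) 1 := by rwa [uIcc_of_le zero_le_one]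
  have h2 := intervalIntegral.integral_add_adjacent_intervals
    (hI.mono_set (uIcc_subset_uIcc_left hm')) (hI.mono_set (uIcc_subset_uIcc_right hm'))
  have h3 : betaIntegral a b = ∫ t in (0 : ℝ)..1, f t := rfl
  rw [h1, h3, ← h2, show b + a - 1 = a + b - 1 by ring]
  ring

/-- The continuation of the weight and of its primitive along the reference loop. -/
theorem IsWeightPrimitive.pochhammer {α β : ℂ} (hα : 0 < (α + 1).re) (hβ : 0 < (β + 1).re)
    {ξ : Ioo (-1 : ℝ) 1} {z l₁ l₂ φ : ℝ → ℂ}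
    (hz : ∀ s : unitInterval, (pochhammerLoop ξ s : ℂ) = z s)
    (h : IsWeightPrimitive (Icc 0 1) α β z l₁ l₂ φ)
    (h₁ : l₁ 0 = Real.log (1 - ξ)) (h₂ : l₂ 0 = Real.log (1 + ξ)) :
    l₁ 1 = Real.log (1 - ξ) ∧ l₂ 1 = Real.log (1 + ξ) ∧
      φ 1 - φ 0 = turnFactor (α + 1) * turnFactor (β + 1) *
        ((2 : ℂ) ^ (α + β + 1) * betaIntegral (α + 1) (β + 1)) := by
  have hξ := ξ.2
  have hρ : 0 < 1 - (ξ : ℝ) := by linarith [hξ.2]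
  have hσ : 0 < 1 + (ξ : ℝ) := by linarith [hξ.1]
  set lρ : ℂ := ((Real.log (1 - ξ) : ℝ) : ℂ) with hlρ
  set lσ : ℂ := ((Real.log (1 + ξ) : ℝ) : ℂ) with hlσ
  have eρ : exp lρ = ((1 - ξ : ℝ) : ℂ) := by rw [hlρ, ← ofReal_exp, Real.exp_log hρ]
  have eσ : exp lσ = ((1 + ξ : ℝ) : ℂ) := by rw [hlσ, ← ofReal_exp, Real.exp_log hσ]
  have logρ : log (2 - exp lρ) = lσ := by
    rw [eρ, show (2 : ℂ) - ((1 - ξ : ℝ) : ℂ) = ((1 + ξ : ℝ) : ℂ) by push_cast; ring,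
      ← ofReal_log hσ.le]
  have logσ : log (2 - exp lσ) = lρ := by
    rw [eσ, show (2 : ℂ) - ((1 + ξ : ℝ) : ℂ) = ((1 - ξ : ℝ) : ℂ) by push_cast; ring,
      ← ofReal_log hρ.le]
  have hd : ∀ (l : ℂ) (p q s : ℝ), HasDerivAt (fun s : ℝ => l + 2 * Real.pi * (p * s + q) * I)
      (2 * Real.pi * p * I) s := by
    intro l p q s
    have h1 : HasDerivAt (fun s : ℝ => ((s : ℝ) : ℂ)) 1 s := ofRealCLM.hasDerivAt
    refine ((((h1.const_mul (p : ℂ)).add_const (q : ℂ)).const_mul (2 * Real.pi : ℂ)).mul_const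
      I |>.const_add l).congr_deriv ?_
    ring
  have hexp : ∀ (l : ℂ) (x : ℂ), exp (l + 2 * Real.pi * x * I) = exp l * exp (2 * Real.pi * x * I) :=
    fun l x => exp_add _ _
  have hnorm : ∀ (l : ℂ) (x : ℝ), exp l = ((1 - ξ : ℝ) : ℂ) ∨ exp l = ((1 + ξ : ℝ) : ℂ) →
      ‖exp (l + 2 * Real.pi * x * I)‖ < 2 := by
    rintro l x (hl | hl) <;> rw [hexp, norm_mul, norm_exp_turn, mul_one, hl, norm_real]
    · rw [Real.norm_of_nonneg hρ.le]; linarith [hξ.1]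
    · rw [Real.norm_of_nonneg hσ.le]; linarith [hξ.2]
  have z1 : ∀ s ∈ Icc (0 : ℝ) (1 / 4),
      z s = 1 - exp (lρ + 2 * Real.pi * ((4 : ℝ) * s + (0 : ℝ)) * I) := by
    intro s hs
    have h0 : s ∈ Icc (0 : ℝ) 1 := ⟨by linarith [hs.1], by linarith [hs.2]⟩
    have h1 : 2 * s ∈ Icc (0 : ℝ) 1 := ⟨by linarith [hs.1], by linarith [hs.2]⟩
    have h2 : 4 * s ∈ Icc (0 : ℝ) 1 := ⟨by linarith [hs.1], by linarith [hs.2]⟩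
    rw [← hz ⟨s, h0⟩, pochhammerLoop, trans_apply_of_le _ _ h0 h1 rfl,
      trans_apply_of_le _ _ h1 h2 (by ring), coe_loopOne, hexp, eρ]
    push_cast; ring_nf
  -- Around -1 the reflected path `-z` is used: it circles 1, and `IsWeightPrimitive.neg` exchanges
  -- the two logarithms.
  have z2 : ∀ s ∈ Icc (1 / 4 : ℝ) (1 / 2),
      -z s = 1 - exp (lσ + 2 * Real.pi * ((4 : ℝ) * s + (-1 : ℝ)) * I) := by
    intro s hs
    have h0 : s ∈ Icc (0 : ℝ) 1 := ⟨by linarith [hs.1], by linarith [hs.2]⟩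
    have h1 : 2 * s ∈ Icc (0 : ℝ) 1 := ⟨by linarith [hs.1], by linarith [hs.2]⟩
    have h2 : 4 * s - 1 ∈ Icc (0 : ℝ) 1 := ⟨by linarith [hs.1], by linarith [hs.2]⟩
    rw [← hz ⟨s, h0⟩, pochhammerLoop, trans_apply_of_le _ _ h0 h1 rfl,
      trans_apply_of_ge _ _ h1 h2 (by ring), coe_loopNegOne, hexp, eσ]
    push_cast; ring_nf
  have z3 : ∀ s ∈ Icc (1 / 2 : ℝ) (3 / 4),
      z s = 1 - exp (lρ + 2 * Real.pi * ((-4 : ℝ) * s + (3 : ℝ)) * I) := by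
    intro s hs
    have h0 : s ∈ Icc (0 : ℝ) 1 := ⟨by linarith [hs.1], by linarith [hs.2]⟩
    have h1 : 2 * s - 1 ∈ Icc (0 : ℝ) 1 := ⟨by linarith [hs.1], by linarith [hs.2]⟩
    have h2 : 4 * s - 2 ∈ Icc (0 : ℝ) 1 := ⟨by linarith [hs.1], by linarith [hs.2]⟩
    have h3 : 1 - (4 * s - 2) ∈ Icc (0 : ℝ) 1 := ⟨sub_nonneg.2 h2.2, sub_le_self _ h2.1⟩
    rw [← hz ⟨s, h0⟩, pochhammerLoop, trans_apply_of_ge _ _ h0 h1 rfl,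
      trans_apply_of_le _ _ h1 h2 (by ring), symm_apply_of_eq _ h2 h3 rfl, coe_loopOne, hexp, eρ]
    push_cast; ring_nf
  have z4 : ∀ s ∈ Icc (3 / 4 : ℝ) 1,
      -z s = 1 - exp (lσ + 2 * Real.pi * ((-4 : ℝ) * s + (4 : ℝ)) * I) := by
    intro s hs
    have h0 : s ∈ Icc (0 : ℝ) 1 := ⟨by linarith [hs.1], by linarith [hs.2]⟩
    have h1 : 2 * s - 1 ∈ Icc (0 : ℝ) 1 := ⟨by linarith [hs.1], by linarith [hs.2]⟩
    have h2 : 4 * s - 3 ∈ Icc (0 : ℝ) 1 := ⟨by linarith [hs.1], by linarith [hs.2]⟩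
    have h3 : 1 - (4 * s - 3) ∈ Icc (0 : ℝ) 1 := ⟨sub_nonneg.2 h2.2, sub_le_self _ h2.1⟩
    rw [← hz ⟨s, h0⟩, pochhammerLoop, trans_apply_of_ge _ _ h0 h1 rfl,
      trans_apply_of_ge _ _ h1 h2 (by ring), symm_apply_of_eq _ h2 h3 rfl, coe_loopNegOne, hexp, eσ]
    push_cast; ring_nf
  have hT : exp (2 * Real.pi * I) = 1 := exp_two_pi_mul_I
  have eqρ : exp (lρ + 2 * Real.pi * I) = exp lρ := by rw [exp_add, hT, mul_one]
  have eqσ : exp (lσ + 2 * Real.pi * I) = exp lσ := by rw [exp_add, hT, mul_one]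
  -- On the four circles the logarithm that is not being turned carries the period 0, 2πi, 2πi, 0:
  -- each logarithm gains a turn in the first half of the loop and loses it in the second.
  obtain ⟨a1, b1, c1⟩ := (h.mono (Icc_subset_Icc le_rfl (by norm_num))).circle_arc hα
    (by norm_num) (hd lρ 4 0) z1 (fun s => by exact_mod_cast hnorm lρ (4 * s + 0) (Or.inl eρ))
    exp_zero (A := lρ) (B := lρ + 2 * Real.pi * I) (by simp) (by push_cast; ring) h₁
    (by rw [logρ, h₂, add_zero])
  rw [eqρ, logρ, add_zero] at b1
  obtain ⟨b2, a2, c2⟩ := (h.neg.mono (Icc_subset_Icc (by norm_num) (by norm_num))).circle_arc hβ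
    (by norm_num) (hd lσ 4 (-1)) z2
    (fun s => by exact_mod_cast hnorm lσ (4 * s + (-1)) (Or.inr eσ))
    hT (A := lσ) (B := lσ + 2 * Real.pi * I) (by push_cast; ring) (by push_cast; ring) b1
    (by rw [logσ, a1])
  rw [eqσ, logσ] at a2
  obtain ⟨a3, b3, c3⟩ := (h.mono (Icc_subset_Icc (by norm_num) (by norm_num))).circle_arc hα
    (by norm_num) (hd lρ (-4) 3) z3
    (fun s => by exact_mod_cast hnorm lρ (-4 * s + 3) (Or.inl eρ))
    hT (A := lρ + 2 * Real.pi * I) (B := lρ) (by push_cast; ring) (by push_cast; ring) a2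
    (by rw [eqρ, logρ, b2])
  rw [logρ] at b3
  obtain ⟨b4, a4, c4⟩ := (h.neg.mono (Icc_subset_Icc (by norm_num) le_rfl)).circle_arc hβ
    (by norm_num) (hd lσ (-4) 4) z4
    (fun s => by exact_mod_cast hnorm lσ (-4 * s + 4) (Or.inr eσ))
    exp_zero (A := lσ + 2 * Real.pi * I) (B := lσ) (by push_cast; ring) (by push_cast; ring) b3
    (by rw [eqσ, logσ, a3, add_zero])
  rw [logσ, add_zero] at a4
  refine ⟨a4, b4, ?_⟩
  have S := basePoint_sum hα hβ ξ
  rw [← eρ, ← eσ, add_sub_cancel_right, add_sub_cancel_right,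
    show α + 1 + (β + 1) - 1 = α + β + 1 by ring] at S
  rw [eqρ] at c1 c3
  rw [eqσ] at c2 c4
  have t1 : exp ((α + 1) * (lρ + 2 * Real.pi * I)) =
      exp ((α + 1) * lρ) * (turnFactor (α + 1) + 1) := by
    rw [turnFactor, sub_add_cancel, ← exp_add]; ring_nf
  have t2 : exp ((β + 1) * (lσ + 2 * Real.pi * I)) =
      exp ((β + 1) * lσ) * (turnFactor (β + 1) + 1) := by
    rw [turnFactor, sub_add_cancel, ← exp_add]; ring_nf
  have t3 : exp (α * (2 * Real.pi * I)) = turnFactor (α + 1) + 1 := by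
    rw [turnFactor, sub_add_cancel, show 2 * Real.pi * I * (α + 1) = α * (2 * Real.pi * I) +
      2 * Real.pi * I by ring, exp_add, hT, mul_one]
  have t4 : exp (β * (2 * Real.pi * I)) = turnFactor (β + 1) + 1 := by
    rw [turnFactor, sub_add_cancel, show 2 * Real.pi * I * (β + 1) = β * (2 * Real.pi * I) +
      2 * Real.pi * I by ring, exp_add, hT, mul_one]
  rw [mul_zero, exp_zero, one_mul, t1] at c1
  rw [t2, t3] at c2
  rw [t1, t4] at c3
  rw [mul_zero, exp_zero, one_mul, t2] at c4
  -- Let U and V be the two terms of `basePoint_sum` and A, B the turn factors. The arcs contribute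
  -- UA, -(A+1)VB, -(B+1)UA and VB, with sum -AB(U+V).
  linear_combination c1 - c2 + c3 - c4 - turnFactor (α + 1) * turnFactor (β + 1) * S

end JacobiRH

end

noncomputable section

namespace JacobiRH

/-! ### The weight along a Pochhammer contour -/

theorem logAlong_add_one {f : ℝ → ℂ} (hf : ContDiff ℝ 1 f) (h0 : ∀ s, f s ≠ 0)
    (hp : Function.Periodic f 1) {l₀ : ℂ} (h1 : logAlong f l₀ 1 = l₀) (s : ℝ) :
    logAlong f l₀ (s + 1) = logAlong f l₀ s := by
  have hc : Continuous fun u => deriv f u / f u :=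
    (hf.continuous_deriv le_rfl).div hf.continuous h0
  have hd : ∀ u, deriv f (u + 1) = deriv f u := fun u => by
    rw [← deriv_comp_add_const]
    congr 1
    exact funext hp
  have e1 := intervalIntegral.integral_add_adjacent_intervals (hc.intervalIntegrable 0 1)
    (hc.intervalIntegrable 1 (s + 1)) (μ := MeasureTheory.volume)
  have e2 := intervalIntegral.integral_comp_add_right (a := 0) (b := s)
    (fun u => deriv f u / f u) 1
  simp only [hd, hp _, zero_add] at e2
  simp only [logAlong] at h1 ⊢
  rw [← e1, ← e2]
  linear_combination h1

namespace IsPochhammerContour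

variable {ξ : Ioo (-1 : ℝ) 1} {γ : ℝ → ℂ} (hγ : IsPochhammerContour ξ γ)

include hγ

theorem hasDerivAt (s : ℝ) : HasDerivAt γ (deriv γ s) s :=
  ((hγ.contDiff.differentiable one_ne_zero) s).hasDerivAt

theorem continuous_deriv : Continuous (deriv γ) := hγ.contDiff.continuous_deriv le_rfl

theorem contDiff_one_sub : ContDiff ℝ 1 fun u => 1 - γ u := contDiff_const.sub hγ.contDiff

theorem contDiff_one_add : ContDiff ℝ 1 fun u => 1 + γ u := contDiff_const.add hγ.contDiff

theorem one_sub_ne_zero (s : ℝ) : 1 - γ s ≠ 0 := fun h =>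
  (hγ.avoids s).1 (by linear_combination -h)

theorem one_add_ne_zero (s : ℝ) : 1 + γ s ≠ 0 := fun h =>
  (hγ.avoids s).2 (by linear_combination h)

theorem apply_zero : γ 0 = (ξ : ℝ) := by
  obtain ⟨p, hp, -⟩ := hγ.homotopic
  have h := hp 0
  rw [p.source] at h
  exact h.symm

theorem exp_log_one_sub : exp ((Real.log (1 - ξ) : ℝ) : ℂ) = 1 - γ 0 := by
  rw [hγ.apply_zero, ← ofReal_exp, Real.exp_log (by linarith [ξ.2.2])]; push_cast; rfl

theorem exp_log_one_add : exp ((Real.log (1 + ξ) : ℝ) : ℂ) = 1 + γ 0 := by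
  rw [hγ.apply_zero, ← ofReal_exp, Real.exp_log (by linarith [ξ.2.1])]; push_cast; rfl

theorem continuous_weight (α β : ℂ) : Continuous (weight ξ γ α β) :=
  ((continuous_const.mul (continuous_logAlong hγ.contDiff_one_sub hγ.one_sub_ne_zero _)).add
    (continuous_const.mul (continuous_logAlong hγ.contDiff_one_add hγ.one_add_ne_zero _))).cexp

theorem hasDerivAt_weight (α β : ℂ) (s : ℝ) : HasDerivAt (weight ξ γ α β)
    (weight ξ γ α β s * ((β / (1 + γ s) - α / (1 - γ s)) * deriv γ s)) s := by
  have h1 := hasDerivAt_logAlong hγ.contDiff_one_sub hγ.one_sub_ne_zero (Real.log (1 - ξ)) s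
  have h2 := hasDerivAt_logAlong hγ.contDiff_one_add hγ.one_add_ne_zero (Real.log (1 + ξ)) s
  rw [((hγ.hasDerivAt s).const_sub 1).deriv] at h1
  rw [((hγ.hasDerivAt s).const_add 1).deriv] at h2
  refine ((h1.const_mul α).add (h2.const_mul β)).cexp.congr_deriv ?_
  simp only [weight, Pi.add_apply]
  ring

theorem weight_add_one_left (α β : ℂ) (s : ℝ) :
    weight ξ γ (α + 1) β s = (1 - γ s) * weight ξ γ α β s := by
  rw [← exp_logAlong hγ.contDiff_one_sub hγ.one_sub_ne_zero hγ.exp_log_one_sub s, weight, weight,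
    ← exp_add]
  congr 1; ring

theorem weight_add_one_right (α β : ℂ) (s : ℝ) :
    weight ξ γ α (β + 1) s = (1 + γ s) * weight ξ γ α β s := by
  rw [← exp_logAlong hγ.contDiff_one_add hγ.one_add_ne_zero hγ.exp_log_one_add s, weight, weight,
    ← exp_add]
  congr 1; ring

/-- The logarithms return to their initial values, and the integral of the weight over the contour
is the change of a primitive along the reference loop. -/
theorem exists_reference_primitive (α β : ℂ) : ∃ z l₁ l₂ φ : ℝ → ℂ,
    (∀ s : unitInterval, (pochhammerLoop ξ s : ℂ) = z s) ∧
    IsWeightPrimitive (Icc 0 1) α β z l₁ l₂ φ ∧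
    l₁ 0 = Real.log (1 - ξ) ∧ l₂ 0 = Real.log (1 + ξ) ∧
    l₁ 1 = logAlong (fun u => 1 - γ u) (Real.log (1 - ξ)) 1 ∧
    l₂ 1 = logAlong (fun u => 1 + γ u) (Real.log (1 + ξ)) 1 ∧
    φ 1 - φ 0 = weightedIntegral ξ γ α β fun _ => 1 := by
  obtain ⟨p, hp, hpl⟩ := hγ.homotopic
  set z : ℝ → ℂ := fun s => (pochhammerLoop ξ (projIcc 0 1 zero_le_one s) : ℂ) with hz
  have hz' : ∀ s : unitInterval, (pochhammerLoop ξ s : ℂ) = z s := fun s => by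
    simp only [hz, projIcc_val]
  obtain ⟨l₁, l₂, φ, m₁, m₂, ψ, h1, h2, h3, h4, h5, h6, h7, h8, h9⟩ :=
    exists_isWeightPrimitive_of_homotopic hpl α β hp hz'
  have k1 : ∀ s ∈ Icc (0 : ℝ) 1, l₁ s = logAlong (fun u => 1 - γ u) (Real.log (1 - ξ)) s :=
    fun s hs => eq_of_continuousOn_of_exp_eq h1.continuousOn_left
      (continuous_logAlong hγ.contDiff_one_sub hγ.one_sub_ne_zero _).continuousOn
      (fun u hu => by rw [h1.exp_left u hu, exp_logAlong hγ.contDiff_one_sub hγ.one_sub_ne_zero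
        hγ.exp_log_one_sub]) (by simp [logAlong, h3]) hs
  have k2 : ∀ s ∈ Icc (0 : ℝ) 1, l₂ s = logAlong (fun u => 1 + γ u) (Real.log (1 + ξ)) s :=
    fun s hs => eq_of_continuousOn_of_exp_eq h1.continuousOn_right
      (continuous_logAlong hγ.contDiff_one_add hγ.one_add_ne_zero _).continuousOn
      (fun u hu => by rw [h1.exp_right u hu, exp_logAlong hγ.contDiff_one_add hγ.one_add_ne_zero
        hγ.exp_log_one_add]) (by simp [logAlong, h4]) hs
  refine ⟨z, m₁, m₂, ψ, hz', h2, h5, h6, ?_, ?_, ?_⟩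
  · rw [← h7, k1 1 (by simp)]
  · rw [← h8, k2 1 (by simp)]
  · rw [← h9, weightedIntegral]
    have hD : ∀ s ∈ Icc (0 : ℝ) 1,
        HasDerivWithinAt φ (1 * weight ξ γ α β s * deriv γ s) (Icc 0 1) s := by
      intro s hs
      have := h1.hasDerivWithinAt hs (hγ.hasDerivAt s).hasDerivWithinAt
      rwa [k1 s hs, k2 s hs, ← weight, ← one_mul (weight ξ γ α β s)] at this
    symm
    refine intervalIntegral.integral_eq_sub_of_hasDerivAt_of_le zero_le_one
      (fun s hs => (hD s hs).continuousWithinAt)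
      (fun s hs => (hD s (Ioo_subset_Icc_self hs)).hasDerivAt (Icc_mem_nhds hs.1 hs.2)) ?_
    exact ((continuous_const.mul (hγ.continuous_weight α β)).mul
      hγ.continuous_deriv).intervalIntegrable 0 1

/-- Only the logarithms matter here, so the exponents 0, 0 suffice. The reference loop undoes each
of its turns, and homotopy transfers this to γ. -/
theorem logAlong_one : logAlong (fun u => 1 - γ u) (Real.log (1 - ξ)) 1 = Real.log (1 - ξ) ∧
    logAlong (fun u => 1 + γ u) (Real.log (1 + ξ)) 1 = Real.log (1 + ξ) := by
  obtain ⟨z, l₁, l₂, φ, hz, h, h1, h2, h3, h4, -⟩ := hγ.exists_reference_primitive 0 0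
  obtain ⟨k1, k2, -⟩ := h.pochhammer (by simp) (by simp) hz h1 h2
  exact ⟨h3 ▸ k1, h4 ▸ k2⟩

theorem periodic_weight (α β : ℂ) : Function.Periodic (weight ξ γ α β) 1 := by
  intro s
  rw [weight, weight, logAlong_add_one hγ.contDiff_one_sub hγ.one_sub_ne_zero
    (fun u => by rw [hγ.periodic u]) hγ.logAlong_one.1, logAlong_add_one hγ.contDiff_one_add
    hγ.one_add_ne_zero (fun u => by rw [hγ.periodic u]) hγ.logAlong_one.2]

theorem periodic_deriv : Function.Periodic (deriv γ) 1 := fun s => by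
  rw [← deriv_comp_add_const]
  congr 1
  exact funext hγ.periodic

end IsPochhammerContour

/-- The contour integral of `(1 - t) ^ (a - 1) * (1 + t) ^ (b - 1)`. -/
def contourBeta (ξ : Ioo (-1 : ℝ) 1) (γ : ℝ → ℂ) (a b : ℂ) : ℂ :=
  weightedIntegral ξ γ (a - 1) (b - 1) fun _ => 1

namespace IsPochhammerContour

variable {ξ : Ioo (-1 : ℝ) 1} {γ : ℝ → ℂ} (hγ : IsPochhammerContour ξ γ)

include hγ

/-- This is Pochhammer's form of Euler's integral. The disc primitive needs the positive real parts;
other parameters are reached through the recurrences. -/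
theorem contourBeta_eq {a b : ℂ} (ha : 0 < a.re) (hb : 0 < b.re) : contourBeta ξ γ a b =
    turnFactor a * turnFactor b * ((2 : ℂ) ^ (a + b - 1) * betaIntegral a b) := by
  obtain ⟨z, l₁, l₂, φ, hz, h, h1, h2, -, -, h5⟩ := hγ.exists_reference_primitive (a - 1) (b - 1)
  obtain ⟨-, -, k3⟩ := h.pochhammer (by simpa using ha) (by simpa using hb) hz h1 h2
  rw [contourBeta, ← h5, k3]
  simp only [sub_add_cancel]
  congr 3
  ring

/-! ### Integration by parts, orthogonality -/

theorem intervalIntegrable_integrand (α β : ℂ) {f : ℂ → ℂ} (hf : Continuous f) (c d : ℝ) :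
    IntervalIntegrable (fun s => f (γ s) * weight ξ γ α β s * deriv γ s)
      MeasureTheory.volume c d :=
  (((hf.comp hγ.contDiff.continuous).mul (hγ.continuous_weight α β)).mul
    hγ.continuous_deriv).intervalIntegrable c d

theorem weightedIntegral_add (α β : ℂ) {f g : ℂ → ℂ} (hf : Continuous f) (hg : Continuous g) :
    weightedIntegral ξ γ α β (fun t => f t + g t) =
      weightedIntegral ξ γ α β f + weightedIntegral ξ γ α β g := by
  simp only [weightedIntegral]
  rw [← intervalIntegral.integral_add (hγ.intervalIntegrable_integrand α β hf 0 1)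
    (hγ.intervalIntegrable_integrand α β hg 0 1)]
  congr 1; ext s; ring

omit hγ in
theorem weightedIntegral_const_mul (α β c : ℂ) (f : ℂ → ℂ) :
    weightedIntegral ξ γ α β (fun t => c * f t) = c * weightedIntegral ξ γ α β f := by
  simp only [weightedIntegral]
  rw [← intervalIntegral.integral_const_mul]
  congr 1; ext s; ring

open Polynomial in
-- The derivative of q p times the raised weight integrates to zero over the closed contour, since
-- curve and weight are periodic. Raising both exponents multiplies the weight by 1 - t², which
-- clears the denominators of its logarithmic derivative.
theorem weightedIntegral_by_parts (α β : ℂ) (p q : ℂ[X]) :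
    weightedIntegral ξ γ α β (fun t => (q * ((1 - X ^ 2) * derivative p +
      (C (β + 1) * (1 - X) - C (α + 1) * (1 + X)) * p)).eval t) =
    -weightedIntegral ξ γ (α + 1) (β + 1) (fun t => (derivative q * p).eval t) := by
  set A : ℂ[X] := q * ((1 - X ^ 2) * derivative p +
      (C (β + 1) * (1 - X) - C (α + 1) * (1 + X)) * p) with hA
  have hD : ∀ s, HasDerivAt (fun s => (q * p).eval (γ s) * weight ξ γ (α + 1) (β + 1) s)
      (A.eval (γ s) * weight ξ γ α β s * deriv γ s +
        (derivative q * p).eval (γ s) * weight ξ γ (α + 1) (β + 1) s * deriv γ s) s := by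
    intro s
    have h1 := ((q * p).hasDerivAt (γ s)).comp s (hγ.hasDerivAt s)
    refine (h1.mul (hγ.hasDerivAt_weight (α + 1) (β + 1) s)).congr_deriv ?_
    rw [hγ.weight_add_one_left, hγ.weight_add_one_right]
    have n1 := hγ.one_sub_ne_zero s
    have n2 := hγ.one_add_ne_zero s
    simp only [hA, derivative_mul, eval_add, eval_mul, eval_sub, eval_C, eval_X, eval_one,
      eval_pow, Function.comp_apply]
    field_simp
    ring
  have i1 := hγ.intervalIntegrable_integrand α β A.continuous 0 1
  have i2 := hγ.intervalIntegrable_integrand (α + 1) (β + 1) (derivative q * p).continuous 0 1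
  have key := intervalIntegral.integral_eq_sub_of_hasDerivAt (a := 0) (b := 1)
    (fun s _ => hD s) (i1.add i2)
  have e1 : γ 1 = γ 0 := by simpa using hγ.periodic 0
  have e2 : weight ξ γ (α + 1) (β + 1) 1 = weight ξ γ (α + 1) (β + 1) 0 := by
    simpa using hγ.periodic_weight (α + 1) (β + 1) 0
  rw [intervalIntegral.integral_add i1 i2, e1, e2, sub_self] at key
  exact eq_neg_of_add_eq_zero_left key

open Polynomial in
/-- The iterated Rodrigues formula. -/
theorem weightedIntegral_mul_jacobi (n : ℕ) (α β : ℂ) (q : ℂ[X]) :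
    weightedIntegral ξ γ α β (fun t => (q * jacobi n α β).eval t) =
      ((2 : ℂ) ^ n * n.factorial)⁻¹ *
        weightedIntegral ξ γ (α + n) (β + n) (fun t => (derivative^[n] q).eval t) := by
  induction n generalizing α β q with
  | zero => simp [jacobi]
  | succ n ih =>
    have h1 := hγ.weightedIntegral_by_parts α β (jacobi n (α + 1) (β + 1)) q
    rw [rodrigues_step, ih (α + 1) (β + 1) (derivative q)] at h1
    have h2 : (fun t => (q * (C (-2 * ((n : ℂ) + 1)) * jacobi (n + 1) α β)).eval t) =
        fun t => (-2 * ((n : ℂ) + 1)) * (q * jacobi (n + 1) α β).eval t := by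
      ext t; simp only [eval_mul, eval_C]; ring
    rw [h2, weightedIntegral_const_mul] at h1
    rw [show α + (n + 1 : ℕ) = α + 1 + n by push_cast; ring,
      show β + (n + 1 : ℕ) = β + 1 + n by push_cast; ring, Function.iterate_succ_apply,
      Nat.factorial_succ]
    have n0 : (n : ℂ) + 1 ≠ 0 := by exact_mod_cast n.succ_ne_zero
    have n1 : (n.factorial : ℂ) ≠ 0 := by exact_mod_cast n.factorial_ne_zero
    set w := weightedIntegral ξ γ (α + 1 + n) (β + 1 + n)
      (fun t => (derivative^[n] (derivative q)).eval t)
    push_cast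
    field_simp at h1 ⊢
    linear_combination -h1

theorem weightedIntegral_pow_mul_jacobi_of_lt {n k : ℕ} (hk : k < n) (α β : ℂ) :
    weightedIntegral ξ γ α β (fun t => t ^ k * (jacobi n α β).eval t) = 0 := by
  have h := hγ.weightedIntegral_mul_jacobi n α β (Polynomial.X ^ k)
  rw [Polynomial.iterate_derivative_eq_zero (by simpa using hk)] at h
  simpa [weightedIntegral] using h

theorem jacobiNorm_eq (n : ℕ) (α β : ℂ) :
    jacobiNorm ξ γ n α β = ((2 : ℂ) ^ n)⁻¹ * contourBeta ξ γ (α + n + 1) (β + n + 1) := by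
  have h := hγ.weightedIntegral_mul_jacobi n α β (Polynomial.X ^ n)
  rw [Polynomial.iterate_derivative_X_pow_eq_natCast_mul, Nat.descFactorial_self, Nat.sub_self]
    at h
  simp only [Polynomial.eval_mul, Polynomial.eval_pow, Polynomial.eval_X, pow_zero, mul_one,
    Polynomial.eval_natCast] at h
  have n1 : (n.factorial : ℂ) ≠ 0 := by exact_mod_cast n.factorial_ne_zero
  rw [jacobiNorm, h, contourBeta, add_sub_cancel_right, add_sub_cancel_right]
  have := weightedIntegral_const_mul (ξ := ξ) (γ := γ) (α + n) (β + n) (n.factorial : ℂ) fun _ => 1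
  simp only [mul_one] at this
  rw [this, mul_inv]
  field_simp

end IsPochhammerContour

end JacobiRH

end

noncomputable section

namespace JacobiRH

/-! ### The contour integral of the Beta function does not vanish -/

theorem hasDerivAt_turnFactor (a : ℂ) :
    HasDerivAt turnFactor (exp (2 * Real.pi * I * a) * (2 * Real.pi * I)) a := by
  have h := ((hasDerivAt_id a).const_mul (2 * Real.pi * I)).cexp.sub_const 1
  exact h.congr_deriv (by simp)

theorem turnFactor_zero : turnFactor 0 = 0 := by simp [turnFactor]

theorem turnFactor_add_one (a : ℂ) : turnFactor (a + 1) = turnFactor a := by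
  rw [turnFactor, turnFactor, mul_add, exp_add, mul_one, exp_two_pi_mul_I, mul_one]

theorem turnFactor_eq_zero_iff {a : ℂ} : turnFactor a = 0 ↔ ∃ k : ℤ, a = k := by
  rw [turnFactor, sub_eq_zero, exp_eq_one_iff]
  have h : (2 * Real.pi * I : ℂ) ≠ 0 := two_pi_I_ne_zero
  refine exists_congr fun k => ⟨fun hk => mul_left_cancel₀ h (by rw [hk]; ring), fun hk => ?_⟩
  rw [hk]; ring

/-- The slope is (e^{2πia} - 1)/a, with the value 2πi at a = 0. Dividing out this zero of the turn
factor accounts for the pole of Gamma at 0. -/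
theorem continuous_dslope_turnFactor : Continuous (dslope turnFactor 0) := by
  refine continuous_iff_continuousAt.2 fun a => ?_
  rcases eq_or_ne a 0 with rfl | ha
  · exact continuousAt_dslope_same.2 (hasDerivAt_turnFactor 0).differentiableAt
  · exact (continuousAt_dslope_of_ne ha).2 (hasDerivAt_turnFactor a).continuousAt

theorem mul_dslope_turnFactor (a : ℂ) : a * dslope turnFactor 0 a = turnFactor a := by
  simpa [turnFactor_zero] using sub_smul_dslope turnFactor 0 a

theorem dslope_turnFactor_ne_zero {a : ℂ} (h : ∀ k : ℤ, a = k → k = 0) :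
    dslope turnFactor 0 a ≠ 0 := by
  intro h0
  have h1 := mul_dslope_turnFactor a
  rw [h0, mul_zero] at h1
  obtain ⟨k, hk⟩ := turnFactor_eq_zero_iff.1 h1.symm
  rw [h k hk, Int.cast_zero] at hk
  rw [hk, dslope_same, (hasDerivAt_turnFactor 0).deriv, mul_zero, exp_zero, one_mul] at h0
  exact two_pi_I_ne_zero h0

/-- The regular factor of the contour Beta integral. -/
def betaFactor (a b : ℂ) : ℂ :=
  (2 : ℂ) ^ (a + b + 1) * Gamma (a + 1) * Gamma (b + 1) * ((a + b) * (a + b + 1)) *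
    (Gamma (a + b + 2))⁻¹

theorem betaFactor_comm (a b : ℂ) : betaFactor a b = betaFactor b a := by
  rw [betaFactor, betaFactor, add_comm b a]; ring

theorem continuousAt_betaFactor {a : ℂ} (ha : -1 < a.re) (b : ℂ) :
    ContinuousAt (fun a => betaFactor a b) a := by
  have h1 : ContinuousAt (fun a : ℂ => Gamma (a + 1)) a := by
    refine ContinuousAt.comp (g := Gamma) (differentiableAt_Gamma _ fun m hm => ?_).continuousAt
      (by fun_prop)
    have := congrArg re hm
    simp only [add_re, one_re, neg_re, natCast_re] at this
    linarith [m.cast_nonneg (α := ℝ)]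
  have h2 : Continuous fun a : ℂ => (Gamma (a + b + 2))⁻¹ :=
    differentiable_one_div_Gamma.continuous.comp (by fun_prop)
  have h3 : Continuous fun a : ℂ => (2 : ℂ) ^ (a + b + 1) :=
    Continuous.const_cpow (by fun_prop) (Or.inl two_ne_zero)
  unfold betaFactor
  exact (((h3.continuousAt.mul h1).mul continuousAt_const).mul (by fun_prop)).mul h2.continuousAt

theorem betaFactor_ne_zero {a b : ℂ} (ha : -1 < a.re) (hb : -1 < b.re)
    (hab : ∀ m : ℕ, a + b ≠ -m) : betaFactor a b ≠ 0 := by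
  have h0 : a + b ≠ 0 := by simpa using hab 0
  have h1 : a + b + 1 ≠ 0 := fun h => hab 1 (by push_cast; linear_combination h)
  refine mul_ne_zero (mul_ne_zero (mul_ne_zero (mul_ne_zero ?_ ?_) ?_) (mul_ne_zero h0 h1))
    (inv_ne_zero ?_)
  · exact (cpow_ne_zero_iff_of_exponent_ne_zero h1).2 two_ne_zero
  · exact Gamma_ne_zero_of_re_pos (by simp; linarith)
  · exact Gamma_ne_zero_of_re_pos (by simp; linarith)
  · exact Gamma_ne_zero_of_re_pos (by simp; linarith)

namespace IsPochhammerContour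

variable {ξ : Ioo (-1 : ℝ) 1} {γ : ℝ → ℂ} (hγ : IsPochhammerContour ξ γ)

include hγ

theorem contourBeta_add_one_left (a b : ℂ) : contourBeta ξ γ (a + 1) b =
    weightedIntegral ξ γ (a - 1) (b - 1) fun t => 1 - t := by
  rw [contourBeta, show a + 1 - 1 = a - 1 + 1 by ring]
  simp only [weightedIntegral, hγ.weight_add_one_left, one_mul]

theorem contourBeta_add_one_right (a b : ℂ) : contourBeta ξ γ a (b + 1) =
    weightedIntegral ξ γ (a - 1) (b - 1) fun t => 1 + t := by
  rw [contourBeta, show b + 1 - 1 = b - 1 + 1 by ring]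
  simp only [weightedIntegral, hγ.weight_add_one_right, one_mul]

theorem contourBeta_sum (a b : ℂ) :
    contourBeta ξ γ (a + 1) b + contourBeta ξ γ a (b + 1) = 2 * contourBeta ξ γ a b := by
  rw [hγ.contourBeta_add_one_left, hγ.contourBeta_add_one_right,
    ← hγ.weightedIntegral_add _ _ (by fun_prop) (by fun_prop), contourBeta,
    ← weightedIntegral_const_mul]
  congr 1; ext t; ring

theorem contourBeta_balance (a b : ℂ) :
    b * contourBeta ξ γ (a + 1) b = a * contourBeta ξ γ a (b + 1) := by
  have h := hγ.weightedIntegral_by_parts (a - 1) (b - 1) 1 1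
  have e : (fun t : ℂ => ((1 : Polynomial ℂ) * ((1 - Polynomial.X ^ 2) *
      Polynomial.derivative 1 + (Polynomial.C (b - 1 + 1) * (1 - Polynomial.X) -
        Polynomial.C (a - 1 + 1) * (1 + Polynomial.X)) * 1)).eval t) =
      fun t => b * (1 - t) + (-a) * (1 + t) := by
    ext t; simp; ring
  rw [e, hγ.weightedIntegral_add _ _ (by fun_prop) (by fun_prop), weightedIntegral_const_mul,
    weightedIntegral_const_mul, ← hγ.contourBeta_add_one_left, ← hγ.contourBeta_add_one_right] at h
  have z : weightedIntegral ξ γ (a - 1 + 1) (b - 1 + 1)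
      (fun t => (Polynomial.derivative (1 : Polynomial ℂ) * 1).eval t) = 0 := by
    simp [weightedIntegral]
  rw [z] at h
  linear_combination h

/-- Eliminating one of the shifted integrals between `contourBeta_sum` and `contourBeta_balance`
gives a recurrence free of any restriction on real parts. -/
theorem contourBeta_recurrence_left (a b : ℂ) :
    2 * a * contourBeta ξ γ a b = (a + b) * contourBeta ξ γ (a + 1) b := by
  linear_combination -a * hγ.contourBeta_sum a b - hγ.contourBeta_balance a b

theorem contourBeta_recurrence_right (a b : ℂ) :
    2 * b * contourBeta ξ γ a b = (a + b) * contourBeta ξ γ a (b + 1) := by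
  linear_combination -b * hγ.contourBeta_sum a b + hγ.contourBeta_balance a b

theorem continuous_contourBeta_left (b : ℂ) : Continuous fun a => contourBeta ξ γ a b := by
  refine intervalIntegral.continuous_parametric_intervalIntegral_of_continuous' ?_ 0 1
  have h1 := continuous_logAlong hγ.contDiff_one_sub hγ.one_sub_ne_zero (Real.log (1 - ξ))
  have h2 := continuous_logAlong hγ.contDiff_one_add hγ.one_add_ne_zero (Real.log (1 + ξ))
  have h3 := hγ.continuous_deriv
  unfold weight Function.uncurry
  fun_prop

theorem continuous_contourBeta_right (a : ℂ) : Continuous fun b => contourBeta ξ γ a b := by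
  refine intervalIntegral.continuous_parametric_intervalIntegral_of_continuous' ?_ 0 1
  have h1 := continuous_logAlong hγ.contDiff_one_sub hγ.one_sub_ne_zero (Real.log (1 - ξ))
  have h2 := continuous_logAlong hγ.contDiff_one_add hγ.one_add_ne_zero (Real.log (1 + ξ))
  have h3 := hγ.continuous_deriv
  unfold weight Function.uncurry
  fun_prop

/-- One recurrence step in each parameter multiplies the integral by 4ab/((a+b)(a+b+1)), formally,
and leads to positive real parts, where the Beta formula holds. The turn factors have period 1, and
their factors a and b cancel the product ab. The excluded lines a = 0 and b = 0 follow by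
continuity. -/
theorem four_mul_contourBeta {a b : ℂ} (ha : -1 < a.re) (hb : -1 < b.re) :
    4 * contourBeta ξ γ a b =
      dslope turnFactor 0 a * dslope turnFactor 0 b * betaFactor a b := by
  have generic : ∀ a b : ℂ, -1 < a.re → -1 < b.re → a ≠ 0 → b ≠ 0 → 4 * contourBeta ξ γ a b -
      dslope turnFactor 0 a * dslope turnFactor 0 b * betaFactor a b = 0 := by
    intro a b ha hb ha0 hb0
    have h1 := hγ.contourBeta_recurrence_left a b
    have h2 := hγ.contourBeta_recurrence_right (a + 1) b
    have ha' : 0 < (a + 1).re := by simp; linarith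
    have hb' : 0 < (b + 1).re := by simp; linarith
    have h3 := hγ.contourBeta_eq ha' hb'
    have h4 := Gamma_mul_Gamma_eq_betaIntegral ha' hb'
    have h5 : Gamma (a + b + 2) ≠ 0 := Gamma_ne_zero_of_re_pos (by simp; linarith)
    rw [show a + 1 + (b + 1) = a + b + 2 by ring] at h3 h4
    rw [show a + b + 2 - 1 = a + b + 1 by ring, turnFactor_add_one, turnFactor_add_one,
      ← mul_dslope_turnFactor a, ← mul_dslope_turnFactor b] at h3
    have h6 : betaFactor a b = (2 : ℂ) ^ (a + b + 1) * ((a + b) * (a + b + 1)) *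
        betaIntegral (a + 1) (b + 1) := by
      rw [betaFactor, mul_assoc ((2 : ℂ) ^ (a + b + 1)), h4]
      field_simp
    refine mul_left_cancel₀ (mul_ne_zero ha0 hb0) ?_
    rw [h6]
    linear_combination (2 * b) * h1 + (a + b) * h2 + (a + b) * (a + b + 1) * h3
  -- This is used first to allow b = 0, then to allow a = 0.
  have extend : ∀ (D : ℂ → ℂ) (c : ℂ), -1 < c.re → ContinuousAt D c →
      (∀ x, -1 < x.re → x ≠ 0 → D x = 0) → D c = 0 := by
    intro D c hc hD h
    have hev : ∀ᶠ x in 𝓝[≠] c, D x = 0 := by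
      have e1 : ∀ᶠ x : ℂ in 𝓝[≠] c, -1 < x.re :=
        nhdsWithin_le_nhds ((continuous_re.tendsto c).eventually_const_lt hc)
      have e2 : ∀ᶠ x : ℂ in 𝓝[≠] c, x ≠ 0 := by
        rcases eq_or_ne c 0 with rfl | hc0
        · exact self_mem_nhdsWithin
        · exact nhdsWithin_le_nhds (isOpen_ne.mem_nhds hc0)
      filter_upwards [e1, e2] with x h1 h2 using h x h1 h2
    exact tendsto_nhds_unique (hD.tendsto.mono_left nhdsWithin_le_nhds)
      ((tendsto_const_nhds (x := (0 : ℂ))).congr' (hev.mono fun x hx => hx.symm))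
  rw [← sub_eq_zero]
  refine extend (fun b => 4 * contourBeta ξ γ a b -
    dslope turnFactor 0 a * dslope turnFactor 0 b * betaFactor a b) b hb ?_ fun b hb hb0 => ?_
  · have c1 := (hγ.continuous_contourBeta_right a).continuousAt (x := b)
    have c2 := continuous_dslope_turnFactor.continuousAt (x := b)
    have c3 := continuousAt_betaFactor hb a
    simp only [betaFactor_comm _ a] at c3
    exact (continuousAt_const.mul c1).sub ((continuousAt_const.mul c2).mul c3)
  · refine extend (fun a => 4 * contourBeta ξ γ a b -
      dslope turnFactor 0 a * dslope turnFactor 0 b * betaFactor a b) a ha ?_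
      fun a ha ha0 => generic a b ha hb ha0 hb0
    have c1 := (hγ.continuous_contourBeta_left b).continuousAt (x := a)
    have c2 := continuous_dslope_turnFactor.continuousAt (x := a)
    have c3 := continuousAt_betaFactor ha b
    exact (continuousAt_const.mul c1).sub ((c2.mul continuousAt_const).mul c3)

omit hγ in
-- Integers that remain are nonpositive and are raised exactly to 0, where the divided turn factor
-- is 2πi. A non-integer is raised until its real part exceeds -1, and meets no zero of the turn
-- factor.
theorem exists_shift {a : ℂ} (h : ∀ k : ℕ, 1 ≤ k → a ≠ k) :
    ∃ i : ℕ, -1 < (a + i).re ∧ ∀ k : ℤ, a + i = k → k = 0 := by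
  by_cases hz : ∃ k : ℤ, a = k
  · obtain ⟨k, rfl⟩ := hz
    have hk : k ≤ 0 := by
      by_contra hk
      exact h k.toNat (by omega) (by
        rw [← Int.cast_natCast, Int.toNat_of_nonneg (by omega)])
    have e : ((k : ℂ) + ((-k).toNat : ℕ)) = 0 := by
      rw [← Int.cast_natCast (R := ℂ), Int.toNat_of_nonneg (by omega)]; push_cast; ring
    refine ⟨(-k).toNat, by rw [e]; simp, fun j hj => ?_⟩
    rw [e] at hj
    exact_mod_cast hj.symm
  · obtain ⟨i, hi⟩ := exists_nat_gt (-1 - a.re)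
    refine ⟨i, by simp; linarith, fun k hk => (hz ⟨k - i, ?_⟩).elim⟩
    push_cast
    linear_combination hk

/-- A zero would propagate upwards through the recurrences, whose coefficient a+b plus a natural
number never vanishes. It would reach parameters at which every factor in `four_mul_contourBeta` is
nonzero. -/
theorem contourBeta_ne_zero {a b : ℂ} (ha : ∀ k : ℕ, 1 ≤ k → a ≠ k) (hb : ∀ k : ℕ, 1 ≤ k → b ≠ k)
    (hab : ∀ m : ℕ, a + b ≠ -m) : contourBeta ξ γ a b ≠ 0 := by
  intro h0
  obtain ⟨i, hi, hi'⟩ := exists_shift ha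
  obtain ⟨j, hj, hj'⟩ := exists_shift hb
  have hne : ∀ i j : ℕ, ∀ m : ℕ, a + i + (b + j) ≠ -m := fun i j m h =>
    hab (m + i + j) (by push_cast; linear_combination h)
  have s1 : ∀ i : ℕ, contourBeta ξ γ (a + i) b = 0 := by
    intro i
    induction i with
    | zero => simpa using h0
    | succ i ih =>
      have h1 := hγ.contourBeta_recurrence_left (a + i) b
      rw [ih, mul_zero, eq_comm, mul_eq_zero] at h1
      rw [show a + (i + 1 : ℕ) = a + i + 1 by push_cast; ring]
      exact h1.resolve_left (by simpa using hne i 0 0)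
  have s2 : ∀ j : ℕ, contourBeta ξ γ (a + i) (b + j) = 0 := by
    intro j
    induction j with
    | zero => simpa using s1 i
    | succ j ih =>
      have h1 := hγ.contourBeta_recurrence_right (a + i) (b + j)
      rw [ih, mul_zero, eq_comm, mul_eq_zero] at h1
      rw [show b + (j + 1 : ℕ) = b + j + 1 by push_cast; ring]
      exact h1.resolve_left (by simpa using hne i j 0)
  have h1 := hγ.four_mul_contourBeta hi hj
  rw [s2 j, mul_zero, eq_comm] at h1
  exact mul_ne_zero (mul_ne_zero (dslope_turnFactor_ne_zero hi') (dslope_turnFactor_ne_zero hj'))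
    (betaFactor_ne_zero hi hj (hne i j)) h1

/-- The Beta parameters are n+α and n+β; if their sum 2n+α+β were -m, then -n-α-β would be the
positive integer n+m. -/
theorem jacobiNorm_ne_zero {n : ℕ} (hn : 1 ≤ n) {α β : ℂ}
    (hαβ : ∀ k : ℕ, 1 ≤ k → -(n : ℂ) - α - β ≠ k)
    (hα : ∀ k : ℕ, 1 ≤ k → (n : ℂ) + α ≠ k) (hβ : ∀ k : ℕ, 1 ≤ k → (n : ℂ) + β ≠ k) :
    jacobiNorm ξ γ (n - 1) α β ≠ 0 := by
  rw [hγ.jacobiNorm_eq]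
  have e : ((n - 1 : ℕ) : ℂ) = n - 1 := by push_cast [hn]; ring
  rw [e, show α + ((n : ℂ) - 1) + 1 = n + α by ring, show β + ((n : ℂ) - 1) + 1 = n + β by ring]
  refine mul_ne_zero (inv_ne_zero (pow_ne_zero _ two_ne_zero))
    (hγ.contourBeta_ne_zero hα hβ fun m hm => hαβ (n + m) (by omega) ?_)
  push_cast
  linear_combination -hm

end IsPochhammerContour

end JacobiRH

end

noncomputable section

namespace JacobiRH

/-! ### Flat arcs of a regular curve -/

/-- The derivative of `γ` varies little within distance `δ` of the parameter `s`. -/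
structure IsFlatArc (γ : ℝ → ℂ) (s δ : ℝ) : Prop where
  contDiff : ContDiff ℝ 1 γ
  deriv_ne_zero : deriv γ s ≠ 0
  pos : 0 < δ
  norm_deriv_sub_le : ∀ u, |u - s| ≤ δ → ‖deriv γ u - deriv γ s‖ ≤ ‖deriv γ s‖ / 4

/-- The point at signed normal distance proportional to `r` from `γ t`, on the left for `r > 0`. -/
def sidePoint (γ : ℝ → ℂ) (p : ℝ × ℝ) : ℂ := γ p.1 + p.2 * I * deriv γ p.1

theorem continuous_sidePoint {γ : ℝ → ℂ} (hγ : ContDiff ℝ 1 γ) : Continuous (sidePoint γ) := by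
  have h1 := hγ.continuous
  have h2 := hγ.continuous_deriv le_rfl
  unfold sidePoint
  fun_prop

theorem leftSide_eq (γ : ℝ → ℂ) (s : ℝ) :
    leftSide γ s = map (sidePoint γ) (𝓝 s ×ˢ 𝓝[>] (0 : ℝ)) := rfl

theorem rightSide_eq (γ : ℝ → ℂ) (s : ℝ) :
    rightSide γ s = map (sidePoint γ) (𝓝 s ×ˢ 𝓝[<] (0 : ℝ)) := rfl

/-- Multiplying by `i` turns the points of the complement of the upward vertical ray into the slit
plane. -/
theorem I_mul_mem_slitPlane {w : ℂ} {x r : ℝ} (hr : 0 < r)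
    (h : ‖w - (x - r * I)‖ ≤ (|x| + |r|) / 4) : I * w ∈ slitPlane := by
  have h1 := (abs_re_le_norm _).trans h
  have h2 := (abs_im_le_norm _).trans h
  simp only [sub_re, sub_im, mul_re, mul_im, ofReal_re, ofReal_im, I_re, I_im] at h1 h2
  ring_nf at h1 h2
  rw [mem_slitPlane_iff]
  simp only [mul_re, mul_im, I_re, I_im]
  by_contra hcon
  push Not at hcon
  obtain ⟨h3, h4⟩ := hcon
  have h5 : w.re = 0 := by linarith
  rw [abs_of_pos hr] at h1 h2
  rw [h5, zero_sub, abs_neg] at h1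
  have := (abs_le.1 h2).2
  linarith

theorem neg_I_mul_mem_slitPlane {w : ℂ} {x r : ℝ} (hr : r < 0)
    (h : ‖w - (x - r * I)‖ ≤ (|x| + |r|) / 4) : -I * w ∈ slitPlane := by
  have := I_mul_mem_slitPlane (w := -w) (x := -x) (neg_pos.2 hr) (by
    rw [abs_neg, abs_neg]
    refine le_of_eq_of_le ?_ h
    rw [← norm_neg]; congr 1; push_cast; ring)
  rwa [mul_neg, ← neg_mul] at this

/-- The two branches, with cuts along the upward and downward vertical rays, differ by πi on the
right half-plane and by -πi on the left. Compared at the two ends of an arc, they produce the 2πi of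
the Plemelj jump. -/
theorem log_I_mul_sub_log_neg_I_mul {w : ℂ} (hw : 0 < w.re) :
    log (I * w) - log (-I * w) = Real.pi * I := by
  have him : 0 < (I * w).im := by simpa using hw
  rw [neg_mul, log, log, norm_neg, arg_neg_eq_arg_sub_pi_of_im_pos him]
  push_cast; ring

theorem log_I_mul_sub_log_neg_I_mul_of_neg {w : ℂ} (hw : w.re < 0) :
    log (I * w) - log (-I * w) = -(Real.pi * I) := by
  have him : (I * w).im < 0 := by simpa using hw
  rw [neg_mul, log, log, norm_neg, arg_neg_eq_arg_add_pi_of_im_neg him]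
  push_cast; ring

namespace IsFlatArc

variable {γ : ℝ → ℂ} {s δ : ℝ} (hγ : IsFlatArc γ s δ)

include hγ

theorem hasDerivAt (u : ℝ) : HasDerivAt γ (deriv γ u) u :=
  ((hγ.contDiff.differentiable one_ne_zero) u).hasDerivAt

theorem norm_deriv_pos : 0 < ‖deriv γ s‖ := norm_pos_iff.2 hγ.deriv_ne_zero

theorem norm_chord_sub_le {u t : ℝ} (hu : |u - s| ≤ δ) (ht : |t - s| ≤ δ) :
    ‖γ u - γ t - (u - t) * deriv γ s‖ ≤ ‖deriv γ s‖ / 4 * |u - t| := by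
  have hD : ∀ v ∈ Metric.closedBall s δ, HasDerivWithinAt (fun v : ℝ => γ v - v * deriv γ s)
      (deriv γ v - deriv γ s) (Metric.closedBall s δ) v := fun v _ => by
    have h1 : HasDerivAt (fun v : ℝ => (v : ℂ)) 1 v := ofRealCLM.hasDerivAt
    have := (hγ.hasDerivAt v).sub (h1.mul_const (deriv γ s))
    rw [one_mul] at this
    exact this.hasDerivWithinAt
  have := (convex_closedBall s δ).norm_image_sub_le_of_norm_hasDerivWithin_le hD
    (fun v hv => hγ.norm_deriv_sub_le v (by simpa [Real.dist_eq] using hv))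
    (show t ∈ Metric.closedBall s δ by simpa [Real.dist_eq] using ht)
    (show u ∈ Metric.closedBall s δ by simpa [Real.dist_eq] using hu)
  rw [Real.norm_eq_abs] at this
  refine le_of_eq_of_le ?_ this
  congr 1; ring

/-- Measured in units of the tangent at `s`, the arc seen from a side point is nearly a horizontal
line at signed height -r. The chord and the normal each contribute a relative error of one quarter.
-/
theorem norm_div_sub_le {u : ℝ} (hu : |u - s| ≤ δ) {p : ℝ × ℝ} (hp : |p.1 - s| ≤ δ) :
    ‖(γ u - sidePoint γ p) / deriv γ s - (((u - p.1 : ℝ) : ℂ) - p.2 * I)‖ ≤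
      (|u - p.1| + |p.2|) / 4 := by
  have h0 := hγ.norm_deriv_pos
  have h1 := hγ.norm_chord_sub_le hu hp
  have h2 : ‖p.2 * I * (deriv γ p.1 - deriv γ s)‖ ≤ |p.2| * (‖deriv γ s‖ / 4) := by
    rw [norm_mul, norm_mul, norm_I, mul_one, norm_real, Real.norm_eq_abs]
    exact mul_le_mul_of_nonneg_left (hγ.norm_deriv_sub_le _ hp) (abs_nonneg _)
  have e : (γ u - sidePoint γ p) / deriv γ s - (((u - p.1 : ℝ) : ℂ) - p.2 * I) =
      ((γ u - γ p.1 - (u - p.1) * deriv γ s) - p.2 * I * (deriv γ p.1 - deriv γ s)) /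
        deriv γ s := by
    have := hγ.deriv_ne_zero
    rw [sidePoint]
    field_simp
    push_cast
    ring
  rw [e, norm_div, div_le_iff₀ h0]
  refine (norm_sub_le _ _).trans ?_
  linarith

theorem le_norm_sub_sidePoint {u : ℝ} (hu : |u - s| ≤ δ) {p : ℝ × ℝ} (hp : |p.1 - s| ≤ δ) :
    ‖deriv γ s‖ / 2 * |u - p.1| ≤ ‖γ u - sidePoint γ p‖ := by
  have h := hγ.norm_div_sub_le hu hp
  set w := (γ u - sidePoint γ p) / deriv γ s with hw
  have e : ‖γ u - sidePoint γ p‖ = ‖deriv γ s‖ * ‖w‖ := by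
    rw [hw, norm_div, mul_div_cancel₀ _ hγ.norm_deriv_pos.ne']
  have h1 := (abs_re_le_norm _).trans h
  have h2 := (abs_im_le_norm _).trans h
  simp only [sub_re, sub_im, mul_re, mul_im, ofReal_re, ofReal_im, I_re, I_im] at h1 h2
  ring_nf at h1 h2
  have h3 : |u - p.1| / 2 ≤ ‖w‖ := by
    have k1 := abs_re_le_norm w
    have k2 := abs_im_le_norm w
    have k3 := abs_sub_abs_le_abs_sub (u - p.1) w.re
    rw [abs_sub_comm (u - p.1)] at k3
    have k4 : |p.2| - |w.im| ≤ |w.im + p.2| := by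
      have := abs_sub_abs_le_abs_sub p.2 (-w.im)
      rwa [abs_neg, sub_neg_eq_add, add_comm] at this
    ring_nf at k3 k4 h1 h2 ⊢
    -- If the tangential offset is the larger one, the real part has at least half its size;
    -- otherwise the imaginary part has at least half of the normal offset.
    rcases le_total |p.2| |u - p.1| with hle | hle
    · linarith
    · linarith
  rw [e]
  nlinarith [hγ.norm_deriv_pos]

theorem re_div_pos {u t : ℝ} (hu : |u - s| ≤ δ) (ht : |t - s| ≤ δ) (h : t < u) :
    0 < ((γ u - γ t) / deriv γ s).re := by
  have h1 := hγ.norm_div_sub_le hu (p := (t, 0)) ht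
  simp only [sidePoint, ofReal_zero, zero_mul, add_zero, sub_zero, abs_zero] at h1
  have h2 := (abs_le.1 ((abs_re_le_norm _).trans h1)).1
  rw [abs_of_pos (sub_pos.2 h), sub_re, ofReal_re] at h2
  linarith [sub_pos.2 h]

theorem mono {δ' : ℝ} (h : 0 < δ') (hle : δ' ≤ δ) : IsFlatArc γ s δ' :=
  ⟨hγ.contDiff, hγ.deriv_ne_zero, h, fun u hu => hγ.norm_deriv_sub_le u (hu.trans hle)⟩

theorem injOn {u t : ℝ} (hu : |u - s| ≤ δ) (ht : |t - s| ≤ δ) (h : γ u = γ t) : u = t := by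
  rcases lt_trichotomy u t with hlt | rfl | hlt
  · have := hγ.re_div_pos ht hu hlt
    rw [h, sub_self, zero_div, zero_re] at this
    exact absurd this (lt_irrefl 0)
  · rfl
  · have := hγ.re_div_pos hu ht hlt
    rw [h, sub_self, zero_div, zero_re] at this
    exact absurd this (lt_irrefl 0)

end IsFlatArc

theorem exists_isFlatArc {γ : ℝ → ℂ} (hγ : ContDiff ℝ 1 γ) {s : ℝ} (hs : deriv γ s ≠ 0) :
    ∃ δ, IsFlatArc γ s δ := by
  have hc := (hγ.continuous_deriv le_rfl).continuousAt (x := s)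
  obtain ⟨ε, hε, h⟩ := Metric.continuousAt_iff.1 hc (‖deriv γ s‖ / 4)
    (by have := norm_pos_iff.2 hs; positivity)
  refine ⟨ε / 2, hγ, hs, by positivity, fun u hu => ?_⟩
  rw [← dist_eq_norm]
  exact (h (by rw [Real.dist_eq]; linarith)).le

/-- For a periodic curve the size of the flat arcs can be chosen uniformly. -/
theorem exists_isFlatArc_uniform {γ : ℝ → ℂ} (hγ : ContDiff ℝ 1 γ)
    (hp : Function.Periodic γ 1) (hr : ∀ s, deriv γ s ≠ 0) : ∃ δ, ∀ s, IsFlatArc γ s δ := by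
  have hc := hγ.continuous_deriv le_rfl
  have hpd : Function.Periodic (deriv γ) 1 := fun s => by
    rw [← deriv_comp_add_const]
    congr 1
    exact funext hp
  obtain ⟨s₀, -, hs₀⟩ := (isCompact_Icc (a := (0 : ℝ)) (b := 1)).exists_isMinOn
    (nonempty_Icc.2 zero_le_one) hc.norm.continuousOn
  have hm : ∀ s, ‖deriv γ s₀‖ ≤ ‖deriv γ s‖ := fun s => by
    obtain ⟨t, ht, hts⟩ := hpd.exists_mem_Ico₀ one_pos s
    rw [hts]
    exact hs₀ (Ico_subset_Icc_self ht)
  -- The interval [-1, 2] contains every point within 1 of the fractional part of `s`, to which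
  -- periodicity reduces the claim.
  obtain ⟨ε, hε, h⟩ := Metric.uniformContinuousOn_iff.1
    ((isCompact_Icc (a := (-1 : ℝ)) (b := 2)).uniformContinuousOn_of_continuous hc.continuousOn)
    (‖deriv γ s₀‖ / 4) (by have := norm_pos_iff.2 (hr s₀); positivity)
  refine ⟨min (ε / 2) 1, fun s => ⟨hγ, hr s, by positivity, fun u hu => ?_⟩⟩
  have hshift : ∀ x, deriv γ x = deriv γ (x - ⌊s⌋) := fun x => by
    have := hpd.sub_zsmul_eq (x := x) ⌊s⌋
    rwa [zsmul_eq_mul, mul_one, eq_comm] at this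
  have hus := abs_le.1 (hu.trans (min_le_right _ _))
  have h1 := Int.floor_le s
  have h2 := (Int.lt_floor_add_one s).le
  refine le_trans ?_ (show ‖deriv γ s₀‖ / 4 ≤ ‖deriv γ s‖ / 4 by linarith [hm s])
  rw [← dist_eq_norm, hshift u, hshift s]
  refine (h _ ⟨by linarith, by linarith⟩ _ ⟨by linarith, by linarith⟩ ?_).le
  rw [Real.dist_eq, sub_sub_sub_cancel_right]
  linarith [hu.trans (min_le_left _ _)]

/-- The nearest point argument: near `γ s`, every point off the curve lies on a normal. -/
theorem nhdsWithin_compl_range_le {γ : ℝ → ℂ} (hγ : ContDiff ℝ 1 γ) (s : ℝ)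
    (hs : deriv γ s ≠ 0) : 𝓝[(range γ)ᶜ] (γ s) ≤ leftSide γ s ⊔ rightSide γ s := by
  obtain ⟨δ, hδ⟩ := exists_isFlatArc hγ hs
  intro V hV
  obtain ⟨hL, hR⟩ := mem_sup.1 hV
  rw [leftSide_eq, mem_map, mem_prod_iff] at hL
  rw [rightSide_eq, mem_map, mem_prod_iff] at hR
  obtain ⟨A, hA, B, hB, hAB⟩ := hL
  obtain ⟨A', hA', B', hB', hAB'⟩ := hR
  obtain ⟨ε₁, hε₁, hεA⟩ := Metric.mem_nhds_iff.1 (inter_mem hA hA')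
  obtain ⟨ε₂, hε₂, hεB⟩ := Metric.mem_nhdsWithin_iff.1 hB
  obtain ⟨ε₃, hε₃, hεB'⟩ := Metric.mem_nhdsWithin_iff.1 hB'
  set κ := min (ε₁ / 2) δ with hκ
  have hκ0 : 0 < κ := lt_min (by positivity) hδ.pos
  have h0 := hδ.norm_deriv_pos
  set T := ‖deriv γ s‖ with hT
  -- The first bound makes the nearest parameter interior: the chord from γ s is at least T|t - s|/2
  -- and shorter than 2ρ. The other two bounds keep the normal coordinate, at most 2ρ/T, below ε₂
  -- and ε₃.
  set ρ := min (κ * T / 8) (min (ε₂ * T / 4) (ε₃ * T / 4)) with hρ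
  have hρ0 : 0 < ρ := by
    refine lt_min (by positivity) (lt_min (by positivity) (by positivity))
  refine Metric.mem_nhdsWithin_iff.2 ⟨ρ, hρ0, fun z hz => ?_⟩
  obtain ⟨hzρ, hzΓ⟩ := hz
  rw [Metric.mem_ball, dist_eq_norm] at hzρ
  obtain ⟨t, htK, htmin⟩ := (isCompact_closedBall s κ).exists_isMinOn
    (Metric.nonempty_closedBall.2 hκ0.le)
    (f := fun t => ‖γ t - z‖ ^ 2) (by have := hγ.continuous; fun_prop)
  have hts : |t - s| ≤ δ := by
    rw [Metric.mem_closedBall, Real.dist_eq] at htK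
    exact htK.trans (min_le_right _ _)
  have hle : ‖γ t - z‖ ≤ ‖γ s - z‖ :=
    le_of_sq_le_sq (htmin (Metric.mem_closedBall_self hκ0.le)) (norm_nonneg _)
  have hlt : ‖γ t - z‖ < ρ := by rw [norm_sub_rev (γ s)] at hle; exact hle.trans_lt hzρ
  have hchord : T / 2 * |t - s| ≤ ‖γ t - γ s‖ := by
    have := hδ.le_norm_sub_sidePoint hts (p := (s, 0)) (by simpa using hδ.pos.le)
    simpa [sidePoint] using this
  have h2ρ : ‖γ t - γ s‖ < 2 * ρ := by
    have := norm_add_le (γ t - z) (z - γ s)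
    rw [sub_add_sub_cancel] at this
    linarith
  have hint : |t - s| < κ := by
    have : ρ ≤ κ * T / 8 := min_le_left _ _
    by_contra hcon
    push Not at hcon
    have : T / 2 * κ ≤ T / 2 * |t - s| := by gcongr
    nlinarith
  have hloc : IsLocalMin (fun t => ‖γ t - z‖ ^ 2) t :=
    htmin.isLocalMin (Metric.closedBall_mem_nhds_of_mem (by rwa [Metric.mem_ball, Real.dist_eq]))
  have hd := hloc.hasDerivAt_eq_zero ((hδ.hasDerivAt t).sub_const z).norm_sq
  rw [Complex.inner] at hd
  have hγt : T / 2 ≤ ‖deriv γ t‖ := by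
    have h1 := hδ.norm_deriv_sub_le t hts
    have h2 := norm_sub_norm_le (deriv γ s) (deriv γ t)
    rw [norm_sub_rev] at h2
    rw [← hT] at h1 h2
    linarith
  have hγt0 : deriv γ t ≠ 0 := norm_pos_iff.1 (by linarith)
  set q := (z - γ t) / deriv γ t with hq
  -- The squared distance is stationary at `t`, so `z - γ t` is orthogonal to the tangent.
  have hqre : q.re = 0 := by
    have e : deriv γ t * (starRingEnd ℂ) (γ t - z) =
        -((starRingEnd ℂ) q * (normSq (deriv γ t) : ℂ)) := by
      rw [← mul_conj, hq, map_div₀]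
      have : (starRingEnd ℂ) (deriv γ t) ≠ 0 := by simpa using hγt0
      field_simp
      simp
    rw [e, neg_re, re_mul_ofReal, conj_re] at hd
    have : normSq (deriv γ t) ≠ 0 := by simpa using hγt0
    have h3 : normSq (deriv γ t) * q.re = 0 := by linear_combination (-1 / 2) * hd
    exact (mul_eq_zero.1 h3).resolve_left this
  have hqI : q = q.im * I := by
    apply Complex.ext <;> simp [hqre]
  have hz : z = sidePoint γ (t, q.im) := by
    rw [sidePoint]
    simp only
    rw [← hqI, hq, div_mul_cancel₀ _ hγt0]
    ring
  have hqn : |q.im| ≤ ρ / (T / 2) := by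
    have : |q.im| = ‖q‖ := by rw [hqI]; simp
    rw [this, hq, norm_div, norm_sub_rev]
    gcongr
  have hq0 : q.im ≠ 0 := fun h => hzΓ ⟨t, by rw [hz, h, sidePoint]; simp⟩
  have ht1 : t ∈ A ∩ A' := hεA (by
    rw [Metric.mem_ball, Real.dist_eq]
    have : κ ≤ ε₁ / 2 := min_le_left _ _
    linarith)
  have hb2 : |q.im| < ε₂ := by
    refine hqn.trans_lt ?_
    have : ρ ≤ ε₂ * T / 4 := (min_le_right _ _).trans (min_le_left _ _)
    rw [div_lt_iff₀ (by positivity)]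
    nlinarith [mul_pos hε₂ h0]
  have hb3 : |q.im| < ε₃ := by
    refine hqn.trans_lt ?_
    have : ρ ≤ ε₃ * T / 4 := (min_le_right _ _).trans (min_le_right _ _)
    rw [div_lt_iff₀ (by positivity)]
    nlinarith [mul_pos hε₃ h0]
  rw [hz]
  rcases lt_or_gt_of_ne hq0 with hneg | hpos
  · exact hAB' (show (t, q.im) ∈ A' ×ˢ B' from ⟨ht1.2, hεB' ⟨by simpa [Real.dist_eq] using hb3, hneg⟩⟩)
  · exact hAB (show (t, q.im) ∈ A ×ˢ B from ⟨ht1.1, hεB ⟨by simpa [Real.dist_eq] using hb2, hpos⟩⟩)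

end JacobiRH

end

noncomputable section

namespace JacobiRH

/-! ### Cauchy integrals over arcs and their boundary values -/

/-- The Cauchy integral of the density `h` over the arc of `γ` with parameters from `a` to `b`. -/
def cauchyArc (γ h : ℝ → ℂ) (a b : ℝ) (z : ℂ) : ℂ := ∫ u in a..b, h u * deriv γ u / (γ u - z)

theorem continuousOn_cauchy_integrand {γ h : ℝ → ℂ} (hγ : ContDiff ℝ 1 γ) (hh : Continuous h)
    {S : Set ℝ} {z : ℂ} (hz : ∀ u ∈ S, γ u ≠ z) :
    ContinuousOn (fun u => h u * deriv γ u / (γ u - z)) S :=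
  (hh.mul (hγ.continuous_deriv le_rfl)).continuousOn.div
    (hγ.continuous.sub continuous_const).continuousOn fun u hu => sub_ne_zero.2 (hz u hu)

theorem intervalIntegrable_cauchy_integrand {γ h : ℝ → ℂ} (hγ : ContDiff ℝ 1 γ)
    (hh : Continuous h) {a b : ℝ} {z : ℂ} (hz : ∀ u ∈ uIcc a b, γ u ≠ z) :
    IntervalIntegrable (fun u => h u * deriv γ u / (γ u - z)) MeasureTheory.volume a b :=
  (continuousOn_cauchy_integrand hγ hh hz).intervalIntegrable

theorem cauchyArc_add {γ h : ℝ → ℂ} (hγ : ContDiff ℝ 1 γ) (hh : Continuous h) {a b c : ℝ} {z : ℂ}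
    (hz : ∀ u, γ u ≠ z) : cauchyArc γ h a b z + cauchyArc γ h b c z = cauchyArc γ h a c z :=
  intervalIntegral.integral_add_adjacent_intervals
    (intervalIntegrable_cauchy_integrand hγ hh fun u _ => hz u)
    (intervalIntegrable_cauchy_integrand hγ hh fun u _ => hz u)

theorem differentiableAt_cauchyArc {γ h : ℝ → ℂ} (hγ : ContDiff ℝ 1 γ) (hh : Continuous h)
    {a b : ℝ} {z : ℂ} (hz : ∀ u ∈ uIcc a b, γ u ≠ z) :
    DifferentiableAt ℂ (cauchyArc γ h a b) z := by
  have hK : IsCompact (γ '' uIcc a b) := isCompact_uIcc.image hγ.continuous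
  have hzK : z ∉ γ '' uIcc a b := fun ⟨u, hu, h⟩ => hz u hu h
  obtain ⟨ε, hε, hεK⟩ := Metric.isOpen_iff.1 hK.isClosed.isOpen_compl z hzK
  have hfar : ∀ u ∈ uIcc a b, ∀ x ∈ Metric.ball z (ε / 2), ε / 2 ≤ ‖γ u - x‖ := by
    intro u hu x hx
    by_contra hcon
    push Not at hcon
    refine hεK (a := γ u) ?_ ⟨u, hu, rfl⟩
    rw [Metric.mem_ball, dist_eq_norm] at hx ⊢
    calc ‖γ u - z‖ = ‖(γ u - x) + (x - z)‖ := by rw [sub_add_sub_cancel]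
      _ ≤ _ := norm_add_le _ _
      _ < ε := by linarith
  have hne : ∀ u ∈ uIcc a b, ∀ x ∈ Metric.ball z (ε / 2), γ u ≠ x := fun u hu x hx h => by
    have := hfar u hu x hx
    rw [h, sub_self, norm_zero] at this
    linarith
  have hc := hγ.continuous_deriv le_rfl
  obtain ⟨M, hM⟩ := (isCompact_uIcc (a := a) (b := b)).exists_bound_of_continuousOn
    (f := fun u => h u * deriv γ u) (hh.mul hc).continuousOn
  refine (intervalIntegral.hasDerivAt_integral_of_dominated_loc_of_deriv_le
    (F := fun x u => h u * deriv γ u / (γ u - x))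
    (F' := fun x u => h u * deriv γ u / (γ u - x) ^ 2)
    (bound := fun _ => M / (ε / 2) ^ 2) (s := Metric.ball z (ε / 2))
    (Metric.ball_mem_nhds z (by positivity)) ?_ ?_ ?_ ?_ ?_ ?_).2.differentiableAt
  · filter_upwards [Metric.ball_mem_nhds z (half_pos hε)] with x hx
    exact (intervalIntegrable_cauchy_integrand hγ hh fun u hu =>
      hne u hu x hx).def'.aestronglyMeasurable
  · exact intervalIntegrable_cauchy_integrand hγ hh hz
  · refine (ContinuousOn.intervalIntegrable ?_).def'.aestronglyMeasurable
    exact (hh.mul hc).continuousOn.div ((hγ.continuous.sub continuous_const).pow 2).continuousOn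
      fun u hu => pow_ne_zero 2 (sub_ne_zero.2 (hz u hu))
  · refine Eventually.of_forall fun u hu x hx => ?_
    have h1 := hM u (uIoc_subset_uIcc hu)
    have h2 := hfar u (uIoc_subset_uIcc hu) x hx
    rw [norm_div, norm_pow]
    have : 0 ≤ M := (norm_nonneg _).trans h1
    gcongr
  · exact intervalIntegrable_const
  · refine Eventually.of_forall fun u hu x hx => ?_
    have h1 := sub_ne_zero.2 (hne u (uIoc_subset_uIcc hu) x hx)
    have h2 : HasDerivAt (fun x : ℂ => γ u - x) (-1) x := (hasDerivAt_id x).const_sub (γ u)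
    refine ((hasDerivAt_const x (h u * deriv γ u)).div h2 h1).congr_deriv ?_
    simp

namespace IsFlatArc

variable {γ : ℝ → ℂ} {s δ : ℝ} (hγ : IsFlatArc γ s δ)

include hγ

/-- The factor `c` rotates the cut of the logarithm off the arc as seen from `z`; it is `I` on the
left side and `-I` on the right. -/
theorem integral_eq_log_sub_log {a b : ℝ} {z c : ℂ} (hc : c ≠ 0)
    (h : ∀ u ∈ uIcc a b, c * ((γ u - z) / deriv γ s) ∈ slitPlane) :
    ∫ u in a..b, deriv γ u / (γ u - z) =
      log (c * ((γ b - z) / deriv γ s)) - log (c * ((γ a - z) / deriv γ s)) := by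
  have hz : ∀ u ∈ uIcc a b, γ u ≠ z := fun u hu he => by
    have := slitPlane_ne_zero (h u hu)
    rw [he, sub_self, zero_div, mul_zero] at this
    exact this rfl
  refine intervalIntegral.integral_eq_sub_of_hasDerivAt
    (f := fun u => log (c * ((γ u - z) / deriv γ s))) (fun u hu => ?_) ?_
  · have h1 := ((((hγ.hasDerivAt u).sub_const z).div_const (deriv γ s)).const_mul c).clog_real
      (h u hu)
    refine h1.congr_deriv ?_
    have := hγ.deriv_ne_zero
    have := sub_ne_zero.2 (hz u hu)
    field_simp
  · have := intervalIntegrable_cauchy_integrand hγ.contDiff (continuous_const (y := (1 : ℂ))) hz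
    simpa using this

/-- The density is replaced by its difference from the value at the foot `p.1` of the normal. The
quotient is then bounded uniformly up to the curve, so dominated convergence applies; the subtracted
constant integrates to explicit logarithms. -/
theorem tendsto_cauchyArc {l : Filter (ℝ × ℝ)} [l.IsCountablyGenerated] (hl : l ≤ 𝓝 (s, 0))
    {h : ℝ → ℂ} (hh : ContDiff ℝ 1 h) {a b : ℝ} (ha : |a - s| ≤ δ) (hb : |b - s| ≤ δ) {c : ℂ}
    (hc : c ≠ 0)
    (hlc : ∀ᶠ p in l, ∀ u, |u - s| ≤ δ → c * ((γ u - sidePoint γ p) / deriv γ s) ∈ slitPlane)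
    (hac : c * ((γ a - γ s) / deriv γ s) ∈ slitPlane)
    (hbc : c * ((γ b - γ s) / deriv γ s) ∈ slitPlane) :
    Tendsto (fun p => cauchyArc γ h a b (sidePoint γ p)) l
      (𝓝 ((∫ u in a..b, (h u - h s) * deriv γ u / (γ u - γ s)) +
        h s * (log (c * ((γ b - γ s) / deriv γ s)) - log (c * ((γ a - γ s) / deriv γ s))))) := by
  have hside : Tendsto (sidePoint γ) l (𝓝 (γ s)) := by
    have := (continuous_sidePoint hγ.contDiff).tendsto (s, 0)
    simp only [sidePoint, ofReal_zero, zero_mul, add_zero] at this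
    exact this.mono_left hl
  have hfst : Tendsto (fun p : ℝ × ℝ => p.1) l (𝓝 s) := (continuous_fst.tendsto (s, 0)).mono_left hl
  have huI : ∀ u ∈ uIcc a b, |u - s| ≤ δ := by
    intro u hu
    rw [← Real.dist_eq, ← Metric.mem_closedBall] at ha hb ⊢
    exact (convex_closedBall s δ).ordConnected.uIcc_subset ha hb hu
  have hfstδ : ∀ᶠ p : ℝ × ℝ in l, |p.1 - s| ≤ δ := by
    have := hfst.eventually (Metric.closedBall_mem_nhds s hγ.pos)
    filter_upwards [this] with p hp
    rw [← Real.dist_eq]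
    exact hp
  have hne : ∀ᶠ p in l, ∀ u ∈ uIcc a b, γ u ≠ sidePoint γ p := by
    filter_upwards [hlc] with p hp u hu he
    have := slitPlane_ne_zero (hp u (huI u hu))
    rw [he, sub_self, zero_div, mul_zero] at this
    exact this rfl
  obtain ⟨K, hK⟩ := (isCompact_closedBall s δ).exists_bound_of_continuousOn
    (hh.continuous_deriv le_rfl).continuousOn
  have hLip : ∀ u t, |u - s| ≤ δ → |t - s| ≤ δ → ‖h u - h t‖ ≤ K * |u - t| := by
    intro u t hu ht
    rw [← Real.dist_eq, ← Metric.mem_closedBall] at hu ht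
    exact (convex_closedBall s δ).norm_image_sub_le_of_norm_hasDerivWithin_le
      (fun v _ => ((hh.differentiable one_ne_zero) v).hasDerivAt.hasDerivWithinAt) hK ht hu
  have hK0 : 0 ≤ K := (norm_nonneg _).trans (hK s (Metric.mem_closedBall_self hγ.pos.le))
  have hsplit : ∀ᶠ p in l, (∫ u in a..b, (h u - h p.1) * deriv γ u / (γ u - sidePoint γ p)) +
      h p.1 * (log (c * ((γ b - sidePoint γ p) / deriv γ s)) -
        log (c * ((γ a - sidePoint γ p) / deriv γ s))) = cauchyArc γ h a b (sidePoint γ p) := by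
    filter_upwards [hne, hlc] with p hp hpc
    have i1 := intervalIntegrable_cauchy_integrand hγ.contDiff (h := fun u => h u - h p.1)
      (hh.continuous.sub continuous_const) hp
    have i2 := intervalIntegrable_cauchy_integrand hγ.contDiff (continuous_const (y := h p.1)) hp
    rw [← hγ.integral_eq_log_sub_log hc fun u hu => hpc u (huI u hu), cauchyArc,
      ← intervalIntegral.integral_const_mul]
    simp only [mul_div_assoc] at i1 i2 ⊢
    rw [← intervalIntegral.integral_add i1 i2]
    congr 1; ext u; ring
  refine Tendsto.congr' hsplit (Tendsto.add ?_ (Tendsto.mul ?_ (Tendsto.sub ?_ ?_)))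
  -- The numerator is at most K|u - t| · (5/4)‖γ'(s)‖ and the denominator at least (‖γ'(s)‖/2)|u -
  -- t|, where t is the foot of the normal.
  · refine intervalIntegral.tendsto_integral_filter_of_dominated_convergence
      (fun _ => 5 / 2 * K) ?_ ?_ intervalIntegrable_const ?_
    · filter_upwards [hne] with p hp
      exact (intervalIntegrable_cauchy_integrand hγ.contDiff
        (hh.continuous.sub (continuous_const (y := h p.1))) hp).def'.aestronglyMeasurable
    · filter_upwards [hne, hfstδ] with p hp hpδ
      refine Eventually.of_forall fun u hu => ?_
      have hu' := uIoc_subset_uIcc hu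
      have k1 := hLip u p.1 (huI u hu') hpδ
      have k2 := hγ.le_norm_sub_sidePoint (huI u hu') hpδ
      have k3 : ‖deriv γ u‖ ≤ 5 / 4 * ‖deriv γ s‖ := by
        have := hγ.norm_deriv_sub_le u (huI u hu')
        have := norm_sub_norm_le (deriv γ u) (deriv γ s)
        linarith
      have k4 : 0 < ‖γ u - sidePoint γ p‖ := norm_pos_iff.2 (sub_ne_zero.2 (hp u hu'))
      rw [norm_div, norm_mul, div_le_iff₀ k4]
      calc ‖h u - h p.1‖ * ‖deriv γ u‖ ≤ (K * |u - p.1|) * (5 / 4 * ‖deriv γ s‖) := by gcongr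
        _ = 5 / 2 * K * (‖deriv γ s‖ / 2 * |u - p.1|) := by ring
        _ ≤ _ := by gcongr
    · have hs0 : ∀ᵐ u : ℝ, u ≠ s := by simp [MeasureTheory.ae_iff]
      filter_upwards [hs0] with u hus hu
      have hne' : γ u - γ s ≠ 0 := fun he => hus (hγ.injOn (huI u (uIoc_subset_uIcc hu))
        (by simpa using hγ.pos.le) (sub_eq_zero.1 he))
      have t1 : Tendsto (fun p : ℝ × ℝ => h p.1) l (𝓝 (h s)) :=
        (hh.continuous.tendsto s).comp hfst
      exact ((tendsto_const_nhds.sub t1).mul tendsto_const_nhds).div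
        (tendsto_const_nhds.sub hside) hne'
  · exact (hh.continuous.tendsto s).comp hfst
  · exact (continuousAt_clog hbc).tendsto.comp
      (((tendsto_const_nhds.sub hside).div_const _).const_mul c)
  · exact (continuousAt_clog hac).tendsto.comp
      (((tendsto_const_nhds.sub hside).div_const _).const_mul c)

/-- The Sokhotski-Plemelj formula on a flat arc. -/
theorem exists_tendsto_cauchyArc {h : ℝ → ℂ} (hh : ContDiff ℝ 1 h) {a b : ℝ} (has : a < s)
    (hsb : s < b) (ha : s - δ ≤ a) (hb : b ≤ s + δ) :
    ∃ Lp Lm, Tendsto (cauchyArc γ h a b) (leftSide γ s) (𝓝 Lp) ∧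
      Tendsto (cauchyArc γ h a b) (rightSide γ s) (𝓝 Lm) ∧
      Lp - Lm = 2 * Real.pi * I * h s := by
  have ha' : |a - s| ≤ δ := abs_le.2 ⟨by linarith, by linarith [hγ.pos]⟩
  have hb' : |b - s| ≤ δ := abs_le.2 ⟨by linarith [hγ.pos], by linarith⟩
  have hs' : |s - s| ≤ δ := by simpa using hγ.pos.le
  have hre_b := hγ.re_div_pos hb' hs' hsb
  have hre_a : ((γ a - γ s) / deriv γ s).re < 0 := by
    have := hγ.re_div_pos hs' ha' has
    rw [← neg_sub, neg_div, neg_re] at this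
    linarith
  have hfst : ∀ l : Filter ℝ, ∀ᶠ p : ℝ × ℝ in 𝓝 s ×ˢ l, |p.1 - s| ≤ δ := fun l => by
    have := (tendsto_fst (f := 𝓝 s) (g := l)).eventually (Metric.closedBall_mem_nhds s hγ.pos)
    filter_upwards [this] with p hp
    rw [← Real.dist_eq]
    exact hp
  have hle : ∀ t : Set ℝ, 𝓝 s ×ˢ 𝓝[t] (0 : ℝ) ≤ 𝓝 (s, 0) := fun t => by
    rw [nhds_prod_eq]
    exact prod_mono le_rfl nhdsWithin_le_nhds
  refine ⟨_, _, (tendsto_map'_iff.2 (hγ.tendsto_cauchyArc (hle (Ioi 0)) hh ha' hb' I_ne_zero ?_ ?_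
    ?_)), (tendsto_map'_iff.2 (hγ.tendsto_cauchyArc (hle (Iio 0)) hh ha' hb'
      (neg_ne_zero.2 I_ne_zero) ?_ ?_ ?_)), ?_⟩
  · filter_upwards [hfst _, (tendsto_snd (f := 𝓝 s) (g := 𝓝[>] (0 : ℝ))).eventually
      self_mem_nhdsWithin] with p h1 h2 u hu
    exact I_mul_mem_slitPlane h2 (hγ.norm_div_sub_le hu h1)
  · exact Or.inr (by simpa using hre_a.ne)
  · exact Or.inr (by simpa using hre_b.ne')
  · filter_upwards [hfst _, (tendsto_snd (f := 𝓝 s) (g := 𝓝[<] (0 : ℝ))).eventually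
      self_mem_nhdsWithin] with p h1 h2 u hu
    exact neg_I_mul_mem_slitPlane h2 (hγ.norm_div_sub_le hu h1)
  · exact Or.inr (by simpa using hre_a.ne)
  · exact Or.inr (by simpa using hre_b.ne')
  -- The integral terms of the two limits coincide; the branches differ by πi at `b` and by -πi at
  -- `a`.
  · have e1 := log_I_mul_sub_log_neg_I_mul hre_b
    have e2 := log_I_mul_sub_log_neg_I_mul_of_neg hre_a
    linear_combination h s * (e1 - e2)

end IsFlatArc

end JacobiRH

end

noncomputable section

namespace JacobiRH

namespace IsPochhammerContour

variable {ξ : Ioo (-1 : ℝ) 1} {γ : ℝ → ℂ} (hγ : IsPochhammerContour ξ γ)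

include hγ

/-! ### Simple points of the contour -/

theorem apply_add_int (u : ℝ) (n : ℤ) : γ (u + n) = γ u := by
  have := hγ.periodic.zsmul n u
  rwa [zsmul_eq_mul, mul_one] at this

theorem deriv_add_int (u : ℝ) (n : ℤ) : deriv γ (u + n) = deriv γ u := by
  have := hγ.periodic_deriv.zsmul n u
  rwa [zsmul_eq_mul, mul_one] at this

/-- Otherwise the fractional parts of the two parameters would exhibit a self-intersection. -/
theorem exists_int_of_apply_eq {s u : ℝ} (hs : γ s ∈ openContour γ) (h : γ u = γ s) :
    ∃ n : ℤ, u + n = s := by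
  by_contra hcon
  push Not at hcon
  refine hs.2 ⟨Int.fract s, ⟨Int.fract_nonneg s, Int.fract_lt_one s⟩, Int.fract u,
    ⟨Int.fract_nonneg u, Int.fract_lt_one u⟩, fun hf => ?_, ?_, ?_⟩
  · refine hcon (⌊s⌋ - ⌊u⌋) ?_
    rw [Int.fract, Int.fract] at hf
    push_cast
    linarith
  · have := hγ.apply_add_int (Int.fract s) ⌊s⌋
    rwa [Int.fract_add_floor, eq_comm] at this
  · have := hγ.apply_add_int (Int.fract u) ⌊u⌋
    rw [Int.fract_add_floor] at this
    rw [← this, h]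

/-- The rest of a period has a compact image that misses the simple point, hence also a
neighbourhood of it. -/
theorem eventually_nhds_of_mem_openContour {s : ℝ} (hs : γ s ∈ openContour γ) {ε : ℝ}
    (hε : 0 < ε) : ∀ᶠ z in 𝓝 (γ s), ∀ u, γ u = z → ∃ n : ℤ, |u + n - s| < ε := by
  set K := Icc (s - 1 / 2) (s + 1 / 2) \ Metric.ball s (min ε (1 / 2)) with hK
  have hKc : IsCompact K := isCompact_Icc.diff Metric.isOpen_ball
  have hmem : γ s ∉ γ '' K := by
    rintro ⟨u, ⟨huI, hub⟩, hu⟩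
    obtain ⟨n, hn⟩ := hγ.exists_int_of_apply_eq hs hu
    have hn0 : n ≠ 0 := by
      rintro rfl
      refine hub ?_
      rw [← hn]
      simpa using hε
    have h1 : (1 : ℝ) ≤ |(n : ℝ)| := by exact_mod_cast Int.one_le_abs hn0
    have h2 : |(n : ℝ)| ≤ 1 / 2 := by
      rw [show (n : ℝ) = s - u by linarith, abs_le]
      exact ⟨by linarith [huI.2], by linarith [huI.1]⟩
    linarith
  filter_upwards [(hKc.image hγ.contDiff.continuous).isClosed.isOpen_compl.mem_nhds hmem]
    with z hz u hu
  obtain ⟨n, hn⟩ : ∃ n : ℤ, u + n ∈ Icc (s - 1 / 2) (s + 1 / 2) := by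
    refine ⟨round (s - u), ?_⟩
    have := abs_le.1 (abs_sub_round (s - u))
    constructor <;> linarith [this.1, this.2]
  refine ⟨n, ?_⟩
  by_contra hcon
  refine hz ⟨u + n, ⟨hn, fun hb => hcon ?_⟩, by rw [hγ.apply_add_int, hu]⟩
  rw [Metric.mem_ball, Real.dist_eq] at hb
  exact hb.trans_le (min_le_left _ _)

/-- A side point on the curve would have a parameter close to `s` modulo 1, and `norm_div_sub_le`
then would put 0 into the slit plane. -/
theorem map_sidePoint_le {s : ℝ} (hs : γ s ∈ openContour γ) {l : Filter ℝ}
    (hl : l ≤ 𝓝[≠] 0) : map (sidePoint γ) (𝓝 s ×ˢ l) ≤ 𝓝[(range γ)ᶜ] (γ s) := by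
  obtain ⟨δ, hδ⟩ := exists_isFlatArc hγ.contDiff (hγ.regular s)
  have htend : Tendsto (sidePoint γ) (𝓝 s ×ˢ l) (𝓝 (γ s)) := by
    have := (continuous_sidePoint hγ.contDiff).tendsto (s, 0)
    simp only [sidePoint, ofReal_zero, zero_mul, add_zero] at this
    refine this.mono_left ?_
    rw [nhds_prod_eq]
    exact prod_mono le_rfl (hl.trans nhdsWithin_le_nhds)
  refine tendsto_nhdsWithin_iff.2 ⟨htend, ?_⟩
  have h1 : ∀ᶠ p : ℝ × ℝ in 𝓝 s ×ˢ l, |p.1 - s| ≤ δ := by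
    have := (tendsto_fst (f := 𝓝 s) (g := l)).eventually (Metric.closedBall_mem_nhds s hδ.pos)
    filter_upwards [this] with p hp
    rw [← Real.dist_eq]
    exact hp
  have h2 : ∀ᶠ p : ℝ × ℝ in 𝓝 s ×ˢ l, p.2 ≠ 0 :=
    (tendsto_snd (f := 𝓝 s) (g := l)).eventually (hl self_mem_nhdsWithin)
  filter_upwards [htend.eventually (hγ.eventually_nhds_of_mem_openContour hs hδ.pos), h1, h2]
    with p hp hp1 hp2
  rintro ⟨u, hu⟩
  obtain ⟨n, hn⟩ := hp u hu
  have h3 := hδ.norm_div_sub_le hn.le hp1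
  have h4 : γ (u + n) - sidePoint γ p = 0 := by rw [hγ.apply_add_int, hu, sub_self]
  rw [h4, zero_div] at h3
  rcases lt_or_gt_of_ne hp2 with h | h
  · exact slitPlane_ne_zero (neg_I_mul_mem_slitPlane h h3) (mul_zero _)
  · exact slitPlane_ne_zero (I_mul_mem_slitPlane h h3) (mul_zero _)

theorem leftSide_le {s : ℝ} (hs : γ s ∈ openContour γ) : leftSide γ s ≤ 𝓝[(range γ)ᶜ] (γ s) :=
  hγ.map_sidePoint_le hs (nhdsWithin_mono _ fun _ h => ne_of_gt h)

theorem rightSide_le {s : ℝ} (hs : γ s ∈ openContour γ) : rightSide γ s ≤ 𝓝[(range γ)ᶜ] (γ s) :=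
  hγ.map_sidePoint_le hs (nhdsWithin_mono _ fun _ h => ne_of_lt h)

theorem map_sidePoint_add_int (s : ℝ) (n : ℤ) (l : Filter ℝ) :
    map (sidePoint γ) (𝓝 (s + n) ×ˢ l) = map (sidePoint γ) (𝓝 s ×ˢ l) := by
  have h1 : 𝓝 (s + n) = map (· + (n : ℝ)) (𝓝 s) :=
    ((Homeomorph.addRight (n : ℝ)).map_nhds_eq s).symm
  have h2 : 𝓝 (s + n) ×ˢ l = map (fun p : ℝ × ℝ => (p.1 + n, p.2)) (𝓝 s ×ˢ l) := by
    conv_lhs => rw [h1, ← map_id (f := l)]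
    rw [prod_map_map_eq]; rfl
  rw [h2, map_map]
  congr 1
  ext p
  simp only [Function.comp_apply, sidePoint, hγ.apply_add_int, hγ.deriv_add_int]

/-- One-sided limits at the simple points form a continuous boundary function. -/
theorem exists_boundary_function {E : Type*} [TopologicalSpace E] [T3Space E] [Nonempty E]
    {f : ℂ → E} {R : Set ℝ} (hR : (0 : ℝ) ∈ closure R)
    (h : ∀ s, γ s ∈ openContour γ → ∃ L, Tendsto f (map (sidePoint γ) (𝓝 s ×ˢ 𝓝[R] 0)) (𝓝 L)) :
    ∃ F : ℂ → E, ContinuousOn F (openContour γ) ∧ ∀ s, γ s ∈ openContour γ →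
      Tendsto f (map (sidePoint γ) (𝓝 s ×ˢ 𝓝[R] 0)) (𝓝 (F (γ s))) := by
  have : NeBot (𝓝[R] (0 : ℝ)) := mem_closure_iff_nhdsWithin_neBot.1 hR
  have hnhds : ∀ s : ℝ, 𝓝[univ ×ˢ R] (s, (0 : ℝ)) = 𝓝 s ×ˢ 𝓝[R] 0 := fun s => by
    rw [nhdsWithin_prod_eq, nhdsWithin_univ]
  -- `K (s, 0)` is the one-sided limit; extending by limits into a regular space makes it continuous
  -- in `s`.
  set K : ℝ × ℝ → E := extendFrom (univ ×ˢ R) (f ∘ sidePoint γ) with hK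
  have hKlim : ∀ s, γ s ∈ openContour γ →
      Tendsto f (map (sidePoint γ) (𝓝 s ×ˢ 𝓝[R] 0)) (𝓝 (K (s, 0))) := by
    intro s hs
    obtain ⟨L, hL⟩ := h s hs
    have := tendsto_extendFrom (A := univ ×ˢ R) (f := f ∘ sidePoint γ) (x := (s, (0 : ℝ)))
      ⟨L, by rw [hnhds]; exact hL⟩
    rw [hnhds] at this
    exact this
  have hKc : ContinuousOn K {p | p.2 = 0 ∧ γ p.1 ∈ openContour γ} := by
    refine continuousOn_extendFrom ?_ ?_
    · rintro ⟨s, r⟩ ⟨hr, -⟩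
      rw [closure_prod_eq, closure_univ]
      exact ⟨mem_univ _, by simp only at hr; rw [hr]; exact hR⟩
    · rintro ⟨s, r⟩ ⟨hr, hs⟩
      simp only at hr hs
      subst hr
      rw [hnhds]
      exact ⟨_, hKlim s hs⟩
  have hKint : ∀ s (n : ℤ), γ s ∈ openContour γ → K (s + n, 0) = K (s, 0) := by
    intro s n hs
    have hs' : γ (s + n) ∈ openContour γ := by rwa [hγ.apply_add_int]
    have h1 := hKlim _ hs'
    rw [hγ.map_sidePoint_add_int] at h1
    exact tendsto_nhds_unique h1 (hKlim s hs)
  classical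
  -- Any two parameters of a simple point differ by an integer, under which `K` is invariant, so the
  -- choice does not matter there.
  set F : ℂ → E := fun z => if hz : ∃ u, γ u = z then K (hz.choose, 0) else Classical.arbitrary E
    with hF
  have hFγ : ∀ s, γ s ∈ openContour γ → F (γ s) = K (s, 0) := by
    intro s hs
    have hex : ∃ u, γ u = γ s := ⟨s, rfl⟩
    simp only [hF, dif_pos hex]
    obtain ⟨n, hn⟩ := hγ.exists_int_of_apply_eq hs hex.choose_spec
    rw [← hKint _ n (by rw [hex.choose_spec]; exact hs), hn]
  refine ⟨F, fun z hz => ?_, fun s hs => by rw [hFγ s hs]; exact hKlim s hs⟩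
  obtain ⟨⟨s, rfl⟩, -⟩ := id hz
  intro V hV
  rw [hFγ s hz] at hV
  have h1 := hKc (s, 0) ⟨rfl, hz⟩ hV
  rw [mem_map, mem_nhdsWithin_iff_exists_mem_nhds_inter] at h1
  obtain ⟨U, hU, hUV⟩ := h1
  obtain ⟨ε, hε, hεU⟩ := Metric.mem_nhds_iff.1 hU
  rw [mem_map]
  filter_upwards [nhdsWithin_le_nhds (hγ.eventually_nhds_of_mem_openContour hz hε),
    self_mem_nhdsWithin] with z hz1 hz2
  obtain ⟨⟨u, rfl⟩, -⟩ := id hz2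
  obtain ⟨n, hn⟩ := hz1 u rfl
  have hu' : γ (u + n) ∈ openContour γ := by rwa [hγ.apply_add_int]
  rw [mem_preimage, hFγ u hz2, ← hKint u n hz2]
  refine hUV ⟨hεU ?_, rfl, hu'⟩
  rw [Metric.mem_ball, Prod.dist_eq, dist_self, max_lt_iff, Real.dist_eq]
  exact ⟨hn, hε⟩

/-! ### The Cauchy integral over the contour -/

theorem cauchyArc_shift {h : ℝ → ℂ} (hp : Function.Periodic h 1) (s : ℝ) (z : ℂ) :
    cauchyArc γ h 0 1 z = cauchyArc γ h s (s + 1) z := by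
  have hper : Function.Periodic (fun u => h u * deriv γ u / (γ u - z)) 1 := fun u => by
    simp only []
    rw [hp u, hγ.periodic_deriv u, hγ.periodic u]
  have := hper.intervalIntegral_add_eq 0 s
  rwa [zero_add] at this

/-- The Sokhotski-Plemelj formula at the simple points of the contour. -/
theorem exists_tendsto_cauchyArc {h : ℝ → ℂ} (hh : ContDiff ℝ 1 h) (hp : Function.Periodic h 1)
    {s : ℝ} (hs : γ s ∈ openContour γ) :
    ∃ Lp Lm, Tendsto (cauchyArc γ h 0 1) (leftSide γ s) (𝓝 Lp) ∧
      Tendsto (cauchyArc γ h 0 1) (rightSide γ s) (𝓝 Lm) ∧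
      Lp - Lm = 2 * Real.pi * I * h s := by
  obtain ⟨δ₀, hδ₀⟩ := exists_isFlatArc hγ.contDiff (hγ.regular s)
  have hpos : 0 < min δ₀ (1 / 2) := lt_min hδ₀.pos (by norm_num)
  have hδ := hδ₀.mono hpos (min_le_left _ _)
  set δ := min δ₀ (1 / 2)
  have hδ2 : δ ≤ 1 / 2 := min_le_right _ _
  obtain ⟨Lp, Lm, hLp, hLm, hL⟩ := hδ.exists_tendsto_cauchyArc hh (a := s - δ) (b := s + δ)
    (by linarith) (by linarith) le_rfl le_rfl
  -- A simple point is not met again within the period, so the rest of the contour adds a term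
  -- continuous at `γ s`, which cancels in the jump.
  have hfar : ∀ u, s + δ ≤ u → u ≤ s + 1 - δ → γ u ≠ γ s := by
    intro u h1 h2 he
    obtain ⟨n, hn⟩ := hγ.exists_int_of_apply_eq hs he
    have h3 : (n : ℝ) < 0 := by linarith
    have h4 : (-1 : ℝ) < n := by linarith
    have h5 : n < 0 := by exact_mod_cast h3
    have h6 : -1 < n := by exact_mod_cast h4
    omega
  have hcont : Tendsto (cauchyArc γ h (s + δ) (s - δ + 1)) (𝓝 (γ s))
      (𝓝 (cauchyArc γ h (s + δ) (s - δ + 1) (γ s))) := by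
    refine (differentiableAt_cauchyArc hγ.contDiff hh.continuous fun u hu => ?_).continuousAt
    rw [uIcc_of_le (by linarith)] at hu
    exact hfar u hu.1 (by linarith [hu.2])
  have hsplit : ∀ᶠ z in 𝓝[(range γ)ᶜ] (γ s), cauchyArc γ h (s - δ) (s + δ) z +
      cauchyArc γ h (s + δ) (s - δ + 1) z = cauchyArc γ h 0 1 z := by
    filter_upwards [self_mem_nhdsWithin] with z hz
    rw [cauchyArc_add hγ.contDiff hh.continuous fun u he => hz ⟨u, he⟩,
      hγ.cauchyArc_shift hp (s - δ)]
  refine ⟨_, _, (hLp.add (hcont.mono_left ((hγ.leftSide_le hs).trans nhdsWithin_le_nhds))).congr'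
    (hγ.leftSide_le hs hsplit), (hLm.add (hcont.mono_left
      ((hγ.rightSide_le hs).trans nhdsWithin_le_nhds))).congr' (hγ.rightSide_le hs hsplit), ?_⟩
  rw [add_sub_add_right_eq_sub, hL]

/-- The Cauchy integral is bounded near every point. -/
theorem exists_bound_cauchyArc {h : ℝ → ℂ} (hh : ContDiff ℝ 1 h) (hp : Function.Periodic h 1)
    (w : ℂ) : ∃ M, ∀ᶠ z in 𝓝[(range γ)ᶜ] w, ‖cauchyArc γ h 0 1 z‖ ≤ M := by
  obtain ⟨δ, hδ⟩ := exists_isFlatArc_uniform hγ.contDiff hγ.periodic hγ.regular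
  have hδ0 := (hδ 0).pos
  obtain ⟨N, hN⟩ := exists_nat_gt (1 / δ)
  have hN0 : (0 : ℝ) < N := lt_trans (by positivity) hN
  have hNδ : 1 / (N : ℝ) ≤ δ := by
    rw [div_le_iff₀ hN0]
    rw [div_lt_iff₀ hδ0] at hN
    linarith
  -- The curve is injective on intervals of length `δ`, each of which therefore holds at most one
  -- parameter of `w`.
  have hcount : (γ ⁻¹' {w}).Countable := by
    have hcov : γ ⁻¹' {w} ⊆ ⋃ k : ℤ, γ ⁻¹' {w} ∩ Ico (k * δ) ((k + 1) * δ) := fun u hu => by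
      refine mem_iUnion.2 ⟨⌊u / δ⌋, hu, ?_, ?_⟩
      · exact (le_div_iff₀ hδ0).1 (Int.floor_le _)
      · exact (div_lt_iff₀ hδ0).1 (Int.lt_floor_add_one _)
    refine (countable_iUnion fun k => Subsingleton.countable ?_).mono hcov
    rintro u ⟨hu, hu'⟩ v ⟨hv, hv'⟩
    refine (hδ v).injOn (abs_le.2 ⟨?_, ?_⟩) (by simpa using hδ0.le) (hu.trans hv.symm)
    · linarith [hu'.1, hv'.2]
    · linarith [hu'.2, hv'.1]
  -- The partition is shifted so that none of its points is a parameter of `w`, since the Cauchy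
  -- integral of an open arc can be logarithmically unbounded at its ends.
  obtain ⟨x₀, hx₀⟩ := ((countable_iUnion fun i : ℕ =>
    hcount.image fun u => u - (i : ℝ) / N).dense_compl ℝ).nonempty
  set a : ℕ → ℝ := fun i => x₀ + (i : ℝ) / N with ha
  have hav : ∀ i, γ (a i) ≠ w := fun i hi => hx₀ (mem_iUnion.2 ⟨i, a i, hi, by simp [ha]⟩)
  have hstep : ∀ i, a (i + 1) - a i = 1 / N := fun i => by
    simp only [ha]; push_cast; ring
  have hpiece : ∀ i, ∃ M, ∀ᶠ z in 𝓝[(range γ)ᶜ] w, ‖cauchyArc γ h (a i) (a (i + 1)) z‖ ≤ M := by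
    intro i
    have hlt : a i < a (i + 1) := by
      have := hstep i
      have : 0 < 1 / (N : ℝ) := by positivity
      linarith
    have hbd : ∀ {l : Filter ℂ} {L : ℂ}, Tendsto (cauchyArc γ h (a i) (a (i + 1))) l (𝓝 L) →
        ∀ᶠ z in l, ‖cauchyArc γ h (a i) (a (i + 1)) z‖ ≤ ‖L‖ + 1 := fun hL =>
      (hL.norm.eventually_lt_const (lt_add_one _)).mono fun z hz => hz.le
    -- A piece through `w` is short enough for the local Plemelj formula, and left and right limits
    -- together control all nearby points off the curve. A piece that misses `w` gives a continuous
    -- function there.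
    by_cases hex : ∃ u ∈ Icc (a i) (a (i + 1)), γ u = w
    · obtain ⟨s, hs, rfl⟩ := hex
      have h1 : a i < s := lt_of_le_of_ne hs.1 fun h => hav i (by rw [h])
      have h2 : s < a (i + 1) := lt_of_le_of_ne hs.2 fun h => hav (i + 1) (by rw [← h])
      obtain ⟨Lp, Lm, hLp, hLm, -⟩ := (hδ s).exists_tendsto_cauchyArc hh h1 h2
        (by linarith [hstep i]) (by linarith [hstep i])
      refine ⟨max (‖Lp‖ + 1) (‖Lm‖ + 1),
        nhdsWithin_compl_range_le hγ.contDiff s (hγ.regular s) (mem_sup.2 ⟨?_, ?_⟩)⟩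
      · exact (hbd hLp).mono fun z hz => hz.trans (le_max_left _ _)
      · exact (hbd hLm).mono fun z hz => hz.trans (le_max_right _ _)
    · push Not at hex
      have := (differentiableAt_cauchyArc hγ.contDiff hh.continuous (a := a i) (b := a (i + 1))
        (z := w) (by rwa [uIcc_of_le hlt.le])).continuousAt
      exact ⟨_, nhdsWithin_le_nhds (hbd this)⟩
  choose M hM using hpiece
  refine ⟨∑ i ∈ Finset.range N, M i, ?_⟩
  have hall : ∀ᶠ z in 𝓝[(range γ)ᶜ] w, ∀ i ∈ Finset.range N,
      ‖cauchyArc γ h (a i) (a (i + 1)) z‖ ≤ M i :=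
    (eventually_all_finset _).2 fun i _ => hM i
  filter_upwards [hall, self_mem_nhdsWithin] with z hz hzΓ
  have hsum := intervalIntegral.sum_integral_adjacent_intervals (a := a) (n := N)
    (f := fun u => h u * deriv γ u / (γ u - z)) (μ := MeasureTheory.volume)
    fun i _ => intervalIntegrable_cauchy_integrand hγ.contDiff hh.continuous
      fun u _ he => hzΓ ⟨u, he⟩
  have e0 : a 0 = x₀ := by simp [ha]
  have eN : a N = x₀ + 1 := by simp [ha, div_self hN0.ne']
  rw [e0, eN] at hsum
  rw [hγ.cauchyArc_shift hp x₀, cauchyArc, ← hsum]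
  exact (norm_sum_le _ _).trans (Finset.sum_le_sum hz)

end IsPochhammerContour

end JacobiRH

end

noncomputable section

namespace JacobiRH

/-! ### Removability of Lipschitz graphs for continuous functions -/

/-- The integral of `f` over the boundary of the rectangle `[a, b] × [c, d]`. -/
def rectIntegral (f : ℂ → ℂ) (a b c d : ℝ) : ℂ :=
  (∫ x in a..b, f (x + c * I)) - (∫ x in a..b, f (x + d * I)) +
    I * (∫ y in c..d, f (b + y * I)) - I * ∫ y in c..d, f (a + y * I)

theorem intervalIntegrable_horizontal {f : ℂ → ℂ} {R : Set ℂ} (hf : ContinuousOn f R) {a b y : ℝ}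
    (h : ∀ x ∈ uIcc a b, (x + y * I : ℂ) ∈ R) :
    IntervalIntegrable (fun x : ℝ => f (x + y * I)) MeasureTheory.volume a b :=
  ContinuousOn.intervalIntegrable (hf.comp (by fun_prop) h)

theorem intervalIntegrable_vertical {f : ℂ → ℂ} {R : Set ℂ} (hf : ContinuousOn f R) {c d x : ℝ}
    (h : ∀ y ∈ uIcc c d, (x + y * I : ℂ) ∈ R) :
    IntervalIntegrable (fun y : ℝ => f (x + y * I)) MeasureTheory.volume c d :=
  ContinuousOn.intervalIntegrable (hf.comp (by fun_prop) h)

theorem mem_reProdIm_mk {s t : Set ℝ} {x y : ℝ} : (x + y * I : ℂ) ∈ s ×ℂ t ↔ x ∈ s ∧ y ∈ t := by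
  simp [mem_reProdIm]

/-- A constant integrates to zero over the closed boundary, so only the deviation from `w` counts.
-/
theorem norm_rectIntegral_le {f : ℂ → ℂ} {a b c d : ℝ} (hf : ContinuousOn f (uIcc a b ×ℂ uIcc c d))
    {w : ℂ} {ω : ℝ} (h : ∀ z ∈ uIcc a b ×ℂ uIcc c d, ‖f z - w‖ ≤ ω) :
    ‖rectIntegral f a b c d‖ ≤ 2 * ω * (|b - a| + |d - c|) := by
  have hH : ∀ y ∈ uIcc c d, ∫ x in a..b, f (x + y * I) =
      (∫ x in a..b, (f (x + y * I) - w)) + (b - a) * w := fun y hy => by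
    rw [intervalIntegral.integral_sub (intervalIntegrable_horizontal hf fun x hx =>
      mem_reProdIm_mk.2 ⟨hx, hy⟩) intervalIntegrable_const, intervalIntegral.integral_const,
      real_smul]
    push_cast; ring
  have hV : ∀ x ∈ uIcc a b, ∫ y in c..d, f (x + y * I) =
      (∫ y in c..d, (f (x + y * I) - w)) + (d - c) * w := fun x hx => by
    rw [intervalIntegral.integral_sub (intervalIntegrable_vertical hf fun y hy =>
      mem_reProdIm_mk.2 ⟨hx, hy⟩) intervalIntegrable_const, intervalIntegral.integral_const,
      real_smul]
    push_cast; ring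
  have nH : ∀ y ∈ uIcc c d, ‖∫ x in a..b, (f (x + y * I) - w)‖ ≤ ω * |b - a| := fun y hy =>
    intervalIntegral.norm_integral_le_of_norm_le_const fun x hx =>
      h _ (mem_reProdIm_mk.2 ⟨uIoc_subset_uIcc hx, hy⟩)
  have nV : ∀ x ∈ uIcc a b, ‖∫ y in c..d, (f (x + y * I) - w)‖ ≤ ω * |d - c| := fun x hx =>
    intervalIntegral.norm_integral_le_of_norm_le_const fun y hy =>
      h _ (mem_reProdIm_mk.2 ⟨hx, uIoc_subset_uIcc hy⟩)
  have e : rectIntegral f a b c d = (∫ x in a..b, (f (x + c * I) - w)) -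
      (∫ x in a..b, (f (x + d * I) - w)) + I * (∫ y in c..d, (f (b + y * I) - w)) -
      I * ∫ y in c..d, (f (a + y * I) - w) := by
    rw [rectIntegral, hH c left_mem_uIcc, hH d right_mem_uIcc, hV b right_mem_uIcc,
      hV a left_mem_uIcc]
    ring
  rw [e]
  refine (norm_sub_le _ _).trans ?_
  rw [norm_mul, norm_I, one_mul]
  refine (add_le_add_left (norm_add_le _ _) _).trans ?_
  rw [norm_mul, norm_I, one_mul]
  refine (add_le_add_left (add_le_add_left (norm_sub_le _ _) _) _).trans ?_
  linarith [nH c left_mem_uIcc, nH d right_mem_uIcc, nV b right_mem_uIcc, nV a left_mem_uIcc]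

theorem rectIntegral_eq_zero {f : ℂ → ℂ} {a b c d : ℝ} (hf : ContinuousOn f (uIcc a b ×ℂ uIcc c d))
    (hd : ∀ z ∈ Ioo (min a b) (max a b) ×ℂ Ioo (min c d) (max c d), DifferentiableAt ℂ f z) :
    rectIntegral f a b c d = 0 := by
  have := integral_boundary_rect_eq_zero_of_continuousOn_of_differentiableOn f (a + c * I)
    (b + d * I) (by simpa using hf) (by
      simp only [add_re, add_im, ofReal_re, ofReal_im, mul_re, mul_im, I_re, I_im, mul_zero,
        mul_one, sub_zero, add_zero, zero_add]
      exact fun z hz => (hd z hz).differentiableWithinAt)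
  simpa [rectIntegral] using this

theorem rectIntegral_add_horizontal {f : ℂ → ℂ} {R : Set ℂ} (hf : ContinuousOn f R)
    {a b e c d : ℝ} (h : ∀ x ∈ uIcc a b ∪ uIcc b e, (x + c * I : ℂ) ∈ R ∧ (x + d * I : ℂ) ∈ R) :
    rectIntegral f a b c d + rectIntegral f b e c d = rectIntegral f a e c d := by
  have h1 := intervalIntegral.integral_add_adjacent_intervals
    (intervalIntegrable_horizontal hf fun x hx => (h x (Or.inl hx)).1)
    (intervalIntegrable_horizontal hf fun x hx => (h x (Or.inr hx)).1)
  have h2 := intervalIntegral.integral_add_adjacent_intervals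
    (intervalIntegrable_horizontal hf fun x hx => (h x (Or.inl hx)).2)
    (intervalIntegrable_horizontal hf fun x hx => (h x (Or.inr hx)).2)
  rw [rectIntegral, rectIntegral, rectIntegral, ← h1, ← h2]
  ring

theorem rectIntegral_add_vertical {f : ℂ → ℂ} {R : Set ℂ} (hf : ContinuousOn f R)
    {a b c d e : ℝ} (h : ∀ y ∈ uIcc c d ∪ uIcc d e, (a + y * I : ℂ) ∈ R ∧ (b + y * I : ℂ) ∈ R) :
    rectIntegral f a b c d + rectIntegral f a b d e = rectIntegral f a b c e := by
  have h1 := intervalIntegral.integral_add_adjacent_intervals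
    (intervalIntegrable_vertical hf fun x hx => (h x (Or.inl hx)).1)
    (intervalIntegrable_vertical hf fun x hx => (h x (Or.inr hx)).1)
  have h2 := intervalIntegral.integral_add_adjacent_intervals
    (intervalIntegrable_vertical hf fun x hx => (h x (Or.inl hx)).2)
    (intervalIntegrable_vertical hf fun x hx => (h x (Or.inr hx)).2)
  rw [rectIntegral, rectIntegral, rectIntegral, ← h1, ← h2]
  ring

/-- Near a vertical line, the boundary integrals are of smaller order than the width. -/
theorem norm_rectIntegral_le_of_graph {f : ℂ → ℂ} {φ : ℝ → ℝ}
    (hφ : ∀ x x', |φ x - φ x'| ≤ |x - x'|) {x₀ x c d : ℝ} (hcd : c ≤ d)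
    (hf : ContinuousOn f (uIcc x₀ x ×ℂ Icc c d))
    (hd : ∀ z ∈ uIcc x₀ x ×ℂ Icc c d, z.im ≠ φ z.re → DifferentiableAt ℂ f z) {w : ℂ} {ω : ℝ}
    (h : ∀ z ∈ uIcc x₀ x ×ℂ Icc c d, |z.im - max c (min d (φ x₀))| ≤ |x - x₀| → ‖f z - w‖ ≤ ω) :
    ‖rectIntegral f x₀ x c d‖ ≤ 6 * ω * |x - x₀| := by
  set m := max c (min d (φ x₀)) with hm
  set r := |x - x₀| with hr
  have hr0 : 0 ≤ r := abs_nonneg _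
  have hcm : c ≤ m := le_max_left _ _
  have hmd : m ≤ d := max_le hcd (min_le_left _ _)
  set c' := max c (m - r) with hc'
  set d' := min d (m + r) with hd'
  have h1 : c ≤ c' := le_max_left _ _
  have h2 : c' ≤ m := max_le hcm (by linarith)
  have h3 : m ≤ d' := le_min hmd (by linarith)
  have h4 : d' ≤ d := min_le_left _ _
  have hx : ∀ {z : ℝ}, z ∈ uIcc x₀ x → |z - x₀| ≤ r := fun hz => abs_sub_left_of_mem_uIcc hz
  have hoff : ∀ z : ℂ, z.re ∈ uIcc x₀ x → z.im ∈ Icc c d → (z.im < c' ∨ d' < z.im) →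
      z.im ≠ φ z.re := by
    intro z hz hzc hor he
    have h5 := (hφ z.re x₀).trans (hx hz)
    rw [← he] at h5
    have h6 := abs_le.1 h5
    rcases hor with hor | hor
    · have h7 : z.im < m - r := (lt_max_iff.1 hor).resolve_left (not_lt.2 hzc.1)

      have h8 : m ≤ c ∨ m ≤ φ x₀ :=
        (le_max_iff.1 (le_of_eq hm)).imp_right fun h => h.trans (min_le_right _ _)
      rcases h8 with h8 | h8 <;> linarith [hzc.1, h6.1]
    · have h7 : m + r < z.im := (min_lt_iff.1 hor).resolve_left (not_lt.2 hzc.2)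
      have h8 : d ≤ m ∨ φ x₀ ≤ m :=
        min_le_iff.1 ((le_max_right c (min d (φ x₀))).trans (le_of_eq hm.symm))
      rcases h8 with h8 | h8 <;> linarith [hzc.2, h6.2]
  have hsub : ∀ {p q : ℝ}, c ≤ p → p ≤ q → q ≤ d →
      uIcc x₀ x ×ℂ uIcc p q ⊆ uIcc x₀ x ×ℂ Icc c d := fun hp hpq hq z hz => by
    rw [uIcc_of_le hpq] at hz
    exact ⟨hz.1, hp.trans hz.2.1, hz.2.2.trans hq⟩
  have hzero : ∀ {p q : ℝ}, c ≤ p → p ≤ q → q ≤ d → (∀ y ∈ Ioo p q, y < c' ∨ d' < y) →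
      rectIntegral f x₀ x p q = 0 := fun hp hpq hq hy => by
    refine rectIntegral_eq_zero (hf.mono (hsub hp hpq hq)) fun z hz => ?_
    rw [min_eq_left hpq, max_eq_right hpq] at hz
    have hz1 : z.re ∈ uIcc x₀ x := Ioo_subset_Icc_self hz.1
    have hz2 : z.im ∈ Icc c d := ⟨hp.trans hz.2.1.le, hz.2.2.le.trans hq⟩
    exact hd z ⟨hz1, hz2⟩ (hoff z hz1 hz2 (hy _ hz.2))
  have hadd : ∀ {p q e : ℝ}, c ≤ p → p ≤ q → q ≤ e → e ≤ d →
      rectIntegral f x₀ x p q + rectIntegral f x₀ x q e = rectIntegral f x₀ x p e := by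
    intro p q e hp hpq hqe he
    refine rectIntegral_add_vertical hf fun y hy => ?_
    have hy' : y ∈ Icc c d := by
      rw [uIcc_of_le hpq, uIcc_of_le hqe] at hy
      rcases hy with hy | hy
      · exact ⟨hp.trans hy.1, hy.2.trans (hqe.trans he)⟩
      · exact ⟨hp.trans (hpq.trans hy.1), hy.2.trans he⟩
    exact ⟨mem_reProdIm_mk.2 ⟨left_mem_uIcc, hy'⟩, mem_reProdIm_mk.2 ⟨right_mem_uIcc, hy'⟩⟩
  rw [← hadd le_rfl h1 ((h2.trans h3).trans h4) le_rfl,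
    ← hadd h1 (h2.trans h3) h4 le_rfl,
    hzero le_rfl h1 ((h2.trans h3).trans h4) fun y hy => Or.inl hy.2,
    hzero (h1.trans (h2.trans h3)) h4 le_rfl fun y hy => Or.inr hy.1, zero_add, add_zero]
  have hmem : ∀ z ∈ uIcc x₀ x ×ℂ uIcc c' d', ‖f z - w‖ ≤ ω := fun z hz => by
    refine h z (hsub h1 (h2.trans h3) h4 hz) ?_
    rw [uIcc_of_le (h2.trans h3)] at hz
    have h5 : m - r ≤ c' := le_max_right _ _
    have h6 : d' ≤ m + r := min_le_right _ _
    exact abs_le.2 ⟨by linarith [hz.2.1], by linarith [hz.2.2]⟩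
  have hω : 0 ≤ ω := (norm_nonneg _).trans
    (hmem (x₀ + c' * I) (mem_reProdIm_mk.2 ⟨left_mem_uIcc, left_mem_uIcc⟩))
  refine (norm_rectIntegral_le (hf.mono (hsub h1 (h2.trans h3) h4)) hmem).trans ?_
  -- The middle piece has width r and height at most 2r, which gives the constant 2 · 3 = 6.
  have h7 : |d' - c'| ≤ 2 * r := by
    have h5 : m - r ≤ c' := le_max_right _ _
    have h6 : d' ≤ m + r := min_le_right _ _
    exact abs_le.2 ⟨by linarith, by linarith⟩
  nlinarith

/-- As a function of its right edge the integral has derivative zero: by continuity of `f`, the thin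
rectangle over [x₀, x] contributes o(|x - x₀|). -/
theorem rectIntegral_eq_zero_of_graph {f : ℂ → ℂ} {φ : ℝ → ℝ}
    (hφ : ∀ x x', |φ x - φ x'| ≤ |x - x'|) {a b c d : ℝ} (hcd : c ≤ d)
    (hf : ContinuousOn f (uIcc a b ×ℂ Icc c d))
    (hd : ∀ z ∈ uIcc a b ×ℂ Icc c d, z.im ≠ φ z.re → DifferentiableAt ℂ f z) :
    rectIntegral f a b c d = 0 := by
  have hmem : ∀ {p q : ℝ}, p ∈ uIcc a b → q ∈ uIcc a b →
      uIcc p q ×ℂ Icc c d ⊆ uIcc a b ×ℂ Icc c d := fun hp hq z hz =>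
    ⟨uIcc_subset_uIcc hp hq hz.1, hz.2⟩
  have hderiv : ∀ x₀ ∈ uIcc a b,
      HasDerivWithinAt (fun x => rectIntegral f a x c d) 0 (uIcc a b) x₀ := by
    intro x₀ hx₀
    set m := max c (min d (φ x₀)) with hm
    have hmcd : m ∈ Icc c d := ⟨le_max_left _ _, max_le hcd (min_le_left _ _)⟩
    rw [hasDerivWithinAt_iff_isLittleO, Asymptotics.isLittleO_iff]
    intro ε hε
    have hc := Metric.continuousWithinAt_iff.1
      (hf (x₀ + m * I) (mem_reProdIm_mk.2 ⟨hx₀, hmcd⟩)) (ε / 6) (by positivity)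
    obtain ⟨η, hη, hc⟩ := hc
    filter_upwards [self_mem_nhdsWithin,
      mem_nhdsWithin_of_mem_nhds (Metric.ball_mem_nhds x₀ (half_pos hη))] with x hx hxη
    rw [Metric.mem_ball, Real.dist_eq] at hxη
    have hadd := rectIntegral_add_horizontal hf (a := a) (b := x₀) (e := x) (c := c) (d := d)
      fun y hy => by
        have hy' : y ∈ uIcc a b := by
          rcases hy with hy | hy
          · exact uIcc_subset_uIcc left_mem_uIcc hx₀ hy
          · exact uIcc_subset_uIcc hx₀ hx hy
        exact ⟨mem_reProdIm_mk.2 ⟨hy', left_mem_Icc.2 hcd⟩,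
          mem_reProdIm_mk.2 ⟨hy', right_mem_Icc.2 hcd⟩⟩
    rw [smul_zero, sub_zero, ← hadd, add_sub_cancel_left, Real.norm_eq_abs]
    refine (norm_rectIntegral_le_of_graph hφ hcd (hf.mono (hmem hx₀ hx))
      (fun z hz => hd z (hmem hx₀ hx hz)) (w := f (x₀ + m * I)) (ω := ε / 6) ?_).trans
      (le_of_eq (by ring))
    intro z hz hzm
    rw [← dist_eq_norm]
    refine (hc (hmem hx₀ hx hz) ?_).le
    rw [dist_eq_norm]
    refine (norm_le_abs_re_add_abs_im _).trans_lt ?_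
    have h1 : |z.re - x₀| ≤ |x - x₀| := abs_sub_left_of_mem_uIcc hz.1
    simp only [sub_re, sub_im, add_re, add_im, ofReal_re, ofReal_im, mul_re, mul_im, I_re, I_im,
      mul_zero, mul_one, sub_zero, add_zero, zero_add]
    linarith
  have hconst : rectIntegral f a b c d = rectIntegral f a a c d := by
    rcases le_total a b with hab | hab
    · rw [uIcc_of_le hab] at hderiv
      exact eq_of_hasDerivWithinAt_zero hderiv (right_mem_Icc.2 hab)
    · rw [uIcc_of_ge hab] at hderiv
      exact (eq_of_hasDerivWithinAt_zero hderiv (right_mem_Icc.2 hab)).symm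
  rw [hconst]
  simp [rectIntegral]

/-- A Lipschitz graph is removable for continuous functions. -/
theorem differentiableOn_ball_of_graph {f : ℂ → ℂ} {φ : ℝ → ℝ}
    (hφ : ∀ x x', |φ x - φ x'| ≤ |x - x'|) {z₀ : ℂ} {r : ℝ}
    (hf : ContinuousOn f (Metric.ball z₀ r))
    (hd : ∀ z ∈ Metric.ball z₀ r, z.im ≠ φ z.re → DifferentiableAt ℂ f z) :
    DifferentiableOn ℂ f (Metric.ball z₀ r) := by
  -- This is Morera's theorem: vanishing rectangle integrals give a primitive on the disc, whose
  -- derivative `f` is holomorphic.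
  refine IsExactOn.differentiableOn Metric.isOpen_ball
    (IsConservativeOn.isExactOn_ball hf fun z w hzw => ?_)
  rw [← add_eq_zero_iff_eq_neg, wedgeIntegral_add_wedgeIntegral_eq]
  change rectIntegral f z.re w.re z.im w.im = 0
  rcases le_total z.im w.im with h | h
  · have hsub : uIcc z.re w.re ×ℂ Icc z.im w.im ⊆ Metric.ball z₀ r := by
      rwa [← uIcc_of_le h]
    exact rectIntegral_eq_zero_of_graph hφ h (hf.mono hsub) fun z hz => hd z (hsub hz)
  · have hsub : uIcc z.re w.re ×ℂ Icc w.im z.im ⊆ Metric.ball z₀ r := by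
      rwa [← uIcc_of_ge h]
    have := rectIntegral_eq_zero_of_graph hφ h (hf.mono hsub) fun z hz => hd z (hsub hz)
    rw [← neg_eq_zero, ← this, rectIntegral, rectIntegral, intervalIntegral.integral_symm w.im,
      intervalIntegral.integral_symm w.im]
    ring

end JacobiRH

end

/-! ### Removable singularities and Liouville's theorem for functions without jump -/

noncomputable section

namespace JacobiRH

/-- The singularities of a function at a finite set, near which it is bounded, are removable. -/
theorem differentiable_limUnder {G : ℂ → ℂ} {S : Set ℂ} (hS : S.Finite)
    (hG : ∀ z ∉ S, DifferentiableAt ℂ G z)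
    (hb : ∀ t ∈ S, ∃ M : ℝ, ∀ᶠ z in 𝓝[≠] t, ‖G z‖ ≤ M) :
    (Differentiable ℂ fun z => limUnder (𝓝[≠] z) G) ∧ ∀ z ∉ S, limUnder (𝓝[≠] z) G = G z := by
  have heq : ∀ z ∉ S, limUnder (𝓝[≠] z) G = G z := fun z hz =>
    ((hG z hz).continuousAt.tendsto.mono_left nhdsWithin_le_nhds).limUnder_eq
  refine ⟨fun z₀ => ?_, heq⟩
  have hb' : ∃ M : ℝ, ∀ᶠ z in 𝓝[≠] z₀, ‖G z‖ ≤ M := by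
    by_cases hz : z₀ ∈ S
    · exact hb z₀ hz
    · exact ⟨_, nhdsWithin_le_nhds
        (((hG z₀ hz).continuousAt.norm.eventually_lt_const (lt_add_one _)).mono fun z hz => hz.le)⟩
  obtain ⟨M, hM⟩ := hb'
  have hS' : ∀ᶠ z in 𝓝[≠] z₀, z ∉ S := by
    have h1 : (S \ {z₀})ᶜ ∈ 𝓝 z₀ :=
      (hS.subset sdiff_subset).isClosed.isOpen_compl.mem_nhds fun h => h.2 rfl
    filter_upwards [nhdsWithin_le_nhds h1, self_mem_nhdsWithin] with z h2 h3 h4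
    exact h2 ⟨h4, h3⟩
  obtain ⟨V, hV, hVsub⟩ := mem_nhdsWithin_iff_exists_mem_nhds_inter.1 (hM.and hS')
  have hd := differentiableOn_update_limUnder_of_bddAbove hV (f := G)
    (fun z hz => (hG z (hVsub hz).2).differentiableWithinAt)
    ⟨M, by rintro _ ⟨z, hz, rfl⟩; exact (hVsub hz).1⟩
  refine (hd.differentiableAt hV).congr_of_eventuallyEq ?_
  filter_upwards [hV] with z hz
  rcases eq_or_ne z z₀ with rfl | hne
  · rw [Function.update_self]
  · rw [Function.update_of_ne hne, heq z (hVsub ⟨hz, hne⟩).2]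

/-- Over a flat arc, rotated to be nearly horizontal, the curve is a Lipschitz graph. -/
theorem IsFlatArc.exists_graph {γ : ℝ → ℂ} {s δ : ℝ} (hγ : IsFlatArc γ s δ) :
    ∃ φ : ℝ → ℝ, (∀ x x', |φ x - φ x'| ≤ |x - x'|) ∧ ∀ u, |u - s| ≤ δ →
      ((γ u - γ s) / deriv γ s).im = φ ((γ u - γ s) / deriv γ s).re := by
  have hss : |s - s| ≤ δ := by rw [sub_self, abs_zero]; exact hγ.pos.le
  set g : ℝ → ℂ := fun u => (γ u - γ s) / deriv γ s with hg
  have hdiff : ∀ u t, |u - s| ≤ δ → |t - s| ≤ δ → |(g u).im - (g t).im| ≤ |(g u).re - (g t).re| := by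
    intro u t hu ht
    have h1 := hγ.norm_div_sub_le hu (p := (t, 0)) ht
    simp only [sidePoint, ofReal_zero, zero_mul, add_zero, sub_zero, abs_zero] at h1
    have e : (γ u - γ t) / deriv γ s = g u - g t := by
      simp only [hg]; rw [← sub_div]; congr 1; ring
    rw [e] at h1
    have h2 := (abs_re_le_norm _).trans h1
    have h3 := (abs_im_le_norm _).trans h1
    simp only [sub_re, sub_im, ofReal_re, ofReal_im, sub_zero] at h2 h3
    have h4 := abs_sub_abs_le_abs_sub (u - t) ((g u).re - (g t).re)
    rw [abs_sub_comm (u - t)] at h4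
    linarith [abs_nonneg (u - t)]
  set D := {x : ℝ | ∃ u, |u - s| ≤ δ ∧ (g u).re = x} with hD
  classical
  set φ₀ : ℝ → ℝ := fun x => if hx : x ∈ D then (g hx.choose).im else 0 with hφ₀
  have hval : ∀ u, |u - s| ≤ δ → φ₀ (g u).re = (g u).im := by
    intro u hu
    have hx : (g u).re ∈ D := ⟨u, hu, rfl⟩
    have h1 := hdiff _ u hx.choose_spec.1 hu
    rw [hx.choose_spec.2, sub_self, abs_zero] at h1
    simp only [hφ₀, dif_pos hx]
    exact sub_eq_zero.1 (abs_nonpos_iff.1 h1)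
  have hlip : LipschitzOnWith 1 φ₀ D := LipschitzOnWith.of_dist_le_mul fun x hx y hy => by
    obtain ⟨u, hu, rfl⟩ := hx
    obtain ⟨t, ht, rfl⟩ := hy
    rw [hval u hu, hval t ht, Real.dist_eq, Real.dist_eq, NNReal.coe_one, one_mul]
    exact hdiff u t hu ht
  obtain ⟨φ, hφ, hφe⟩ := hlip.extend_real
  refine ⟨φ, fun x x' => ?_, fun u hu => ?_⟩
  · have := hφ.dist_le_mul x x'
    rwa [Real.dist_eq, Real.dist_eq, NNReal.coe_one, one_mul] at this
  · rw [← hφe ⟨u, hu, rfl⟩]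
    exact (hval u hu).symm

namespace IsPochhammerContour

variable {ξ : Ioo (-1 : ℝ) 1} {γ : ℝ → ℂ} (hγ : IsPochhammerContour ξ γ)

include hγ

theorem isCompact_range : IsCompact (range γ) := by
  have : range γ = γ '' Icc 0 1 := by
    refine Subset.antisymm ?_ (image_subset_range _ _)
    rintro _ ⟨u, rfl⟩
    refine ⟨Int.fract u, ⟨Int.fract_nonneg u, (Int.fract_lt_one u).le⟩, ?_⟩
    rw [← hγ.apply_add_int (Int.fract u) ⌊u⌋, Int.fract_add_floor]
  rw [this]
  exact isCompact_Icc.image hγ.contDiff.continuous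

theorem finite_selfIntersections : (selfIntersections γ).Finite :=
  finite_of_ncard_ne_zero (by rw [hγ.three_selfIntersections]; norm_num)

theorem eventually_notMem_selfIntersections {z : ℂ} (hz : z ∉ selfIntersections γ) :
    ∀ᶠ z' in 𝓝 z, z' ∉ selfIntersections γ :=
  hγ.finite_selfIntersections.isClosed.isOpen_compl.mem_nhds hz

/-- A continuous function which is differentiable off the contour is differentiable at the simple
points of the contour. -/
theorem differentiableAt_of_continuousAt {G : ℂ → ℂ} (hc : ∀ z ∉ selfIntersections γ,
    ContinuousAt G z) (hd : ∀ z ∉ range γ, DifferentiableAt ℂ G z) {z : ℂ}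
    (hz : z ∉ selfIntersections γ) : DifferentiableAt ℂ G z := by
  by_cases hzΓ : z ∈ range γ
  swap
  · exact hd z hzΓ
  obtain ⟨s, rfl⟩ := id hzΓ
  obtain ⟨δ, hδ⟩ := exists_isFlatArc hγ.contDiff (hγ.regular s)
  obtain ⟨φ, hφ, hφγ⟩ := hδ.exists_graph
  set τ := deriv γ s with hτ
  have hτ0 : τ ≠ 0 := hγ.regular s
  have hev : ∀ᶠ ζ in 𝓝 (0 : ℂ), γ s + τ * ζ ∉ selfIntersections γ ∧
      ∀ u, γ u = γ s + τ * ζ → ∃ n : ℤ, |u + n - s| < δ := by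
    have hcont : ContinuousAt (fun ζ => γ s + τ * ζ) 0 := by fun_prop
    rw [ContinuousAt, mul_zero, add_zero] at hcont
    exact hcont.eventually ((hγ.eventually_notMem_selfIntersections hz).and
      (hγ.eventually_nhds_of_mem_openContour ⟨hzΓ, hz⟩ hδ.pos))
  obtain ⟨r, hr, hball⟩ := Metric.eventually_nhds_iff_ball.1 hev
  -- In the coordinate ζ, rotated to the tangent, the contour lies on the graph of `φ` near 0.
  have hdiff : DifferentiableOn ℂ (fun ζ => G (γ s + τ * ζ)) (Metric.ball 0 r) := by
    refine differentiableOn_ball_of_graph hφ (fun ζ hζ => ?_) fun ζ hζ hne => ?_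
    · exact ((hc _ (hball ζ hζ).1).comp (f := fun ζ => γ s + τ * ζ)
        (by fun_prop)).continuousWithinAt
    · refine (hd _ ?_).comp (f := fun ζ => γ s + τ * ζ) ζ (by fun_prop)
      rintro ⟨u, hu⟩
      obtain ⟨n, hn⟩ := (hball ζ hζ).2 u hu
      have h1 := hφγ (u + n) hn.le
      rw [hγ.apply_add_int, hu, add_sub_cancel_left, mul_div_cancel_left₀ _ hτ0] at h1
      exact hne h1
  have h0 := hdiff.differentiableAt (Metric.ball_mem_nhds 0 hr)
  have h1 : DifferentiableAt ℂ (fun z => (z - γ s) / τ) (γ s) := by fun_prop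
  have h2 : DifferentiableAt ℂ (fun ζ => G (γ s + τ * ζ)) ((γ s - γ s) / τ) := by
    rwa [sub_self, zero_div]
  have h3 := h2.comp (γ s) (f := fun z => (z - γ s) / τ) h1
  refine h3.congr_of_eventuallyEq (Eventually.of_forall fun z => ?_)
  simp only [Function.comp_apply]
  rw [mul_div_cancel₀ _ hτ0, add_sub_cancel]

/-- A function without jump over the contour, bounded at the self-intersections, is constant when it
has a limit at infinity. -/
theorem eq_of_no_jump {F : ℂ → ℂ} (hF : DifferentiableOn ℂ F (range γ)ᶜ) {Fc : ℂ → ℂ}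
    (hFc : ContinuousOn Fc (openContour γ))
    (hlim : ∀ s ∈ Ico (0 : ℝ) 1, γ s ∈ openContour γ →
      Tendsto F (leftSide γ s) (𝓝 (Fc (γ s))) ∧ Tendsto F (rightSide γ s) (𝓝 (Fc (γ s))))
    (hb : ∀ t ∈ selfIntersections γ, ∃ M : ℝ, ∀ᶠ z in 𝓝[(range γ)ᶜ] t, ‖F z‖ ≤ M) {c : ℂ}
    (hc : Tendsto F (Bornology.cobounded ℂ) (𝓝 c)) : ∀ z ∉ range γ, F z = c := by
  have hlim' : ∀ s, γ s ∈ openContour γ →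
      Tendsto F (leftSide γ s) (𝓝 (Fc (γ s))) ∧ Tendsto F (rightSide γ s) (𝓝 (Fc (γ s))) := by
    intro s hs
    have e := hγ.apply_add_int (Int.fract s) ⌊s⌋
    have el := hγ.map_sidePoint_add_int (Int.fract s) ⌊s⌋ (𝓝[>] 0)
    have er := hγ.map_sidePoint_add_int (Int.fract s) ⌊s⌋ (𝓝[<] 0)
    rw [Int.fract_add_floor] at e el er
    rw [leftSide_eq, rightSide_eq, el, er, e]
    exact hlim _ ⟨Int.fract_nonneg s, Int.fract_lt_one s⟩ (by rwa [← e])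
  have hopen : IsOpen (range γ)ᶜ := hγ.isCompact_range.isClosed.isOpen_compl
  have hsub : selfIntersections γ ⊆ range γ := by
    rintro _ ⟨s, -, t, -, -, rfl, -⟩
    exact ⟨s, rfl⟩
  classical
  -- Filling in the common boundary values makes the function continuous at every simple point.
  set G : ℂ → ℂ := fun z => if z ∈ range γ then Fc z else F z with hGdef
  have hGF : ∀ z ∉ range γ, G z = F z := fun z hz => if_neg hz
  have hGFc : ∀ z ∈ range γ, G z = Fc z := fun z hz => if_pos hz
  have hGd : ∀ z ∉ range γ, DifferentiableAt ℂ G z := fun z hz =>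
    (hF.differentiableAt (hopen.mem_nhds hz)).congr_of_eventuallyEq
      (by filter_upwards [hopen.mem_nhds hz] with z' hz' using hGF z' hz')
  have hGc : ∀ z ∉ selfIntersections γ, ContinuousAt G z := by
    intro z hz
    by_cases hzΓ : z ∈ range γ
    swap
    · exact (hGd z hzΓ).continuousAt
    obtain ⟨s, rfl⟩ := id hzΓ
    obtain ⟨hl, hr⟩ := hlim' s ⟨hzΓ, hz⟩
    rw [ContinuousAt, hGFc _ hzΓ, ← nhdsWithin_univ, ← union_compl_self (range γ),
      nhdsWithin_union]
    refine Tendsto.sup ?_ ?_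
    · have h1 : 𝓝[range γ] (γ s) ≤ 𝓝[openContour γ] (γ s) := by
        refine le_inf nhdsWithin_le_nhds (le_principal_iff.2 ?_)
        filter_upwards [self_mem_nhdsWithin,
          nhdsWithin_le_nhds (hγ.eventually_notMem_selfIntersections hz)] with z h2 h3
        exact ⟨h2, h3⟩
      refine Tendsto.congr' ?_ ((hFc (γ s) ⟨hzΓ, hz⟩).mono_left h1)
      filter_upwards [self_mem_nhdsWithin] with z hz using (hGFc z hz).symm
    · refine Tendsto.congr' ?_ ((hl.sup hr).mono_left
        (nhdsWithin_compl_range_le hγ.contDiff s (hγ.regular s)))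
      filter_upwards [self_mem_nhdsWithin] with z hz using (hGF z hz).symm
  have hGb : ∀ t ∈ selfIntersections γ, ∃ M : ℝ, ∀ᶠ z in 𝓝[≠] t, ‖G z‖ ≤ M := by
    intro t ht
    obtain ⟨M, hM⟩ := hb t ht
    obtain ⟨U, hUo, htU, hU⟩ := eventually_nhds_iff.1 (eventually_nhdsWithin_iff.1 hM) |>.imp
      fun U h => (⟨h.2.1, h.2.2, h.1⟩ : IsOpen U ∧ t ∈ U ∧ _)
    refine ⟨M, ?_⟩
    have hiso : ∀ᶠ z in 𝓝[≠] t, z ∉ selfIntersections γ := by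
      have h1 : (selfIntersections γ \ {t})ᶜ ∈ 𝓝 t :=
        (hγ.finite_selfIntersections.subset sdiff_subset).isClosed.isOpen_compl.mem_nhds
          fun h => h.2 rfl
      filter_upwards [nhdsWithin_le_nhds h1, self_mem_nhdsWithin] with z h2 h3 h4
      exact h2 ⟨h4, h3⟩
    filter_upwards [nhdsWithin_le_nhds (hUo.mem_nhds htU), hiso] with z hzU hzS
    by_cases hzΓ : z ∈ range γ
    swap
    · rw [hGF z hzΓ]
      exact hU z hzU hzΓ
    obtain ⟨s, rfl⟩ := id hzΓ
    have hs : γ s ∈ openContour γ := ⟨hzΓ, hzS⟩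
    rw [hGFc _ hzΓ]
    have : (leftSide γ s).NeBot := by rw [leftSide_eq]; infer_instance
    -- On the contour itself the bound is inherited by a limit from the left.
    refine le_of_tendsto (hlim' s hs).1.norm (hγ.leftSide_le hs ?_)
    filter_upwards [self_mem_nhdsWithin, nhdsWithin_le_nhds (hUo.mem_nhds hzU)] with z h1 h2
    exact hU z h2 h1
  obtain ⟨hH, hHG⟩ := differentiable_limUnder hγ.finite_selfIntersections
    (fun z hz => hγ.differentiableAt_of_continuousAt hGc hGd hz) hGb
  have hHF : ∀ z ∉ range γ, limUnder (𝓝[≠] z) G = F z := fun z hz => by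
    rw [hHG z fun h => hz (hsub h), hGF z hz]
  have hHc : Tendsto (fun z => limUnder (𝓝[≠] z) G) (cocompact ℂ) (𝓝 c) := by
    rw [← Metric.cobounded_eq_cocompact]
    refine hc.congr' ?_
    filter_upwards [Bornology.isBounded_def.1 hγ.isCompact_range.isBounded] with z hz
      using (hHF z hz).symm
  intro z hz
  rw [← hHF z hz]
  -- The extended function is entire with a limit at infinity, so Liouville's theorem applies.
  exact hH.apply_eq_of_tendsto_cocompact z hHc

end IsPochhammerContour

end JacobiRH

end

/-! ### Products with adjugates, uniqueness, and Cauchy transforms at infinity -/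

noncomputable section

namespace JacobiRH

open Polynomial

theorem tendsto_mul_adjugate {A B : ℂ → Matrix (Fin 2) (Fin 2) ℂ} {l : Filter ℂ}
    {P Q : Matrix (Fin 2) (Fin 2) ℂ} (hA : Tendsto A l (𝓝 P)) (hB : Tendsto B l (𝓝 Q))
    (i j : Fin 2) :
    Tendsto (fun z => (A z * (B z).adjugate) i j) l (𝓝 ((P * Q.adjugate) i j)) := by
  have hadj : Tendsto (fun z => (B z).adjugate) l (𝓝 Q.adjugate) :=
    (Continuous.matrix_adjugate continuous_id).continuousAt.tendsto.comp hB
  exact tendsto_pi_nhds.1 (tendsto_pi_nhds.1 (hA.mul hadj) i) j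

theorem differentiableOn_mul_adjugate {A B : ℂ → Matrix (Fin 2) (Fin 2) ℂ} {U : Set ℂ}
    (hA : ∀ k l, DifferentiableOn ℂ (fun z => A z k l) U)
    (hB : ∀ k l, DifferentiableOn ℂ (fun z => B z k l) U) (i j : Fin 2) :
    DifferentiableOn ℂ (fun z => (A z * (B z).adjugate) i j) U := by
  have hadj : ∀ k l, DifferentiableOn ℂ (fun z => (B z).adjugate k l) U := by
    simp only [Fin.forall_fin_two, Matrix.adjugate_fin_two, Matrix.of_apply, Matrix.cons_val',
      Matrix.cons_val_zero, Matrix.cons_val_one, Matrix.cons_val_fin_one]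
    exact ⟨⟨hB 1 1, (hB 0 1).neg⟩, (hB 1 0).neg, hB 0 0⟩
  simp only [Matrix.mul_apply, Fin.sum_univ_two]
  exact ((hA i 0).fun_mul (hadj 0 j)).fun_add ((hA i 1).fun_mul (hadj 1 j))

theorem norm_mul_adjugate_le {A B : Matrix (Fin 2) (Fin 2) ℂ} {M M' : ℝ}
    (hA : ∀ k l, ‖A k l‖ ≤ M) (hB : ∀ k l, ‖B k l‖ ≤ M') (i j : Fin 2) :
    ‖(A * B.adjugate) i j‖ ≤ M * M' + M * M' := by
  have hadj : ∀ k l, ‖B.adjugate k l‖ ≤ M' := by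
    simp only [Fin.forall_fin_two, Matrix.adjugate_fin_two, Matrix.of_apply, Matrix.cons_val',
      Matrix.cons_val_zero, Matrix.cons_val_one, Matrix.cons_val_fin_one, norm_neg]
    exact ⟨⟨hB 1 1, hB 0 1⟩, hB 1 0, hB 0 0⟩
  have hmul : ∀ k, ‖A i k * B.adjugate k j‖ ≤ M * M' := fun k => by
    rw [norm_mul]
    exact mul_le_mul (hA i k) (hadj k j) (norm_nonneg _) ((norm_nonneg _).trans (hA i k))
  rw [Matrix.mul_apply, Fin.sum_univ_two]
  exact (norm_add_le _ _).trans (add_le_add (hmul 0) (hmul 1))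

/-- Common right factors of determinant `1` cancel in `A * adj B`. -/
theorem mul_mul_adjugate_mul (A B : Matrix (Fin 2) (Fin 2) ℂ) {D : Matrix (Fin 2) (Fin 2) ℂ}
    (hD : D.det = 1) : A * D * (B * D).adjugate = A * B.adjugate := by
  rw [Matrix.adjugate_mul_distrib, Matrix.mul_assoc, ← Matrix.mul_assoc D, Matrix.mul_adjugate, hD,
    one_smul, Matrix.one_mul]

/-! ### Uniqueness -/

namespace IsRHSolution

variable {ξ : Ioo (-1 : ℝ) 1} {γ : ℝ → ℂ} {n : ℕ} {α β : ℂ} {Y Z : ℂ → Matrix (Fin 2) (Fin 2) ℂ}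

theorem exists_factor_tendsto (hY : IsRHSolution ξ γ n α β Y) :
    ∃ A : ℂ → Matrix (Fin 2) (Fin 2) ℂ, Tendsto A (Bornology.cobounded ℂ) (𝓝 1) ∧
      ∀ᶠ z in Bornology.cobounded ℂ, Y z = A z * !![z ^ n, 0; 0, (z ^ n)⁻¹] := by
  obtain ⟨E, hE, hYE⟩ := hY.normalized
  refine ⟨fun z => 1 + E z, ?_, hYE⟩
  have h0 : Tendsto E (Bornology.cobounded ℂ) (𝓝 0) := by
    refine tendsto_pi_nhds.2 fun i => tendsto_pi_nhds.2 fun j => ?_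
    refine (hE i j).trans_tendsto ?_
    simpa using tendsto_inv₀_cobounded (α := ℂ)
  simpa using h0.const_add 1

/-- The adjugate stands in for the inverse, so that no invertibility of Z is needed beforehand. Jump
matrix and diagonal factor have determinant 1 and cancel, leaving entries without jump that tend to
those of the identity. -/
theorem mul_adjugate_eq_one (hγ : IsPochhammerContour ξ γ) (hY : IsRHSolution ξ γ n α β Y)
    (hZ : IsRHSolution ξ γ n α β Z) {z : ℂ} (hz : z ∉ range γ) :
    Y z * (Z z).adjugate = 1 := by
  obtain ⟨Yp, Ym, hYp, -, hYs⟩ := hY.jump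
  obtain ⟨Zp, Zm, hZp, -, hZs⟩ := hZ.jump
  ext i j
  refine hγ.eq_of_no_jump (F := fun z => (Y z * (Z z).adjugate) i j)
    (Fc := fun z => (Yp z * (Zp z).adjugate) i j) ?_ ?_ ?_ ?_ ?_ z hz
  · exact differentiableOn_mul_adjugate (fun k l => (hY.analytic k l).differentiableOn)
      (fun k l => (hZ.analytic k l).differentiableOn) i j
  · exact fun t ht => tendsto_mul_adjugate (hYp t ht) (hZp t ht) i j
  · intro s hs hso
    obtain ⟨hY1, hY2, hY3⟩ := hYs s hs hso
    obtain ⟨hZ1, hZ2, hZ3⟩ := hZs s hs hso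
    refine ⟨tendsto_mul_adjugate hY1 hZ1 i j, ?_⟩
    have e : Yp (γ s) * (Zp (γ s)).adjugate = Ym (γ s) * (Zm (γ s)).adjugate := by
      rw [hY3, hZ3, mul_mul_adjugate_mul _ _ (by simp [Matrix.det_fin_two_of])]
    simp only [e]
    exact tendsto_mul_adjugate hY2 hZ2 i j
  · intro t ht
    obtain ⟨M, hM⟩ := hY.bounded t ht
    obtain ⟨M', hM'⟩ := hZ.bounded t ht
    refine ⟨M * M' + M * M', ?_⟩
    filter_upwards [hM, hM'] with z h1 h2 using norm_mul_adjugate_le h1 h2 i j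
  · obtain ⟨A, hA, hYA⟩ := hY.exists_factor_tendsto
    obtain ⟨B, hB, hZB⟩ := hZ.exists_factor_tendsto
    have h1 := tendsto_mul_adjugate hA hB i j
    rw [Matrix.adjugate_one, Matrix.mul_one] at h1
    refine h1.congr' ?_
    filter_upwards [hYA, hZB, Bornology.eventually_ne_cobounded (0 : ℂ)] with z h2 h3 h4
    rw [h2, h3, mul_mul_adjugate_mul _ _ (by simp [Matrix.det_fin_two_of, h4])]

/-- Applied to Z and itself, the product formula shows that adj Z is the inverse of Z, which then
cancels from Y adj Z = 1. -/
theorem eqOn (hγ : IsPochhammerContour ξ γ) (hY : IsRHSolution ξ γ n α β Y)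
    (hZ : IsRHSolution ξ γ n α β Z) : EqOn Y Z (range γ)ᶜ := fun z hz => by
  have h1 := mul_adjugate_eq_one hγ hY hZ hz
  have h2 := mul_adjugate_eq_one hγ hZ hZ hz
  rw [mul_eq_one_comm] at h2
  rw [← Matrix.mul_one (Y z), ← h2, ← Matrix.mul_assoc, h1, Matrix.one_mul]

end IsRHSolution

/-! ### The explicit solution -/

/-- The quotient of a polynomial of degree less than `n` by `z ^ n` is `O(1 / z)` at infinity. -/
theorem isBigO_eval_mul_inv_pow {q : ℂ[X]} {n : ℕ} (hq : q.natDegree < n) :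
    (fun z => q.eval z * (z ^ n)⁻¹) =O[Bornology.cobounded ℂ] fun z => 1 / z := by
  simp only [eval_eq_sum_range' hq, Finset.sum_mul]
  refine Asymptotics.IsBigO.fun_sum (A := fun k (z : ℂ) => q.coeff k * z ^ k * (z ^ n)⁻¹)
    fun k hk => ?_
  simp only [mul_assoc]
  suffices h : (fun z : ℂ => z ^ k * (z ^ n)⁻¹) =O[Bornology.cobounded ℂ] fun z => 1 / z from
    h.const_mul_left _
  refine Asymptotics.IsBigO.of_bound 1 ?_
  filter_upwards [(tendsto_norm_cobounded_atTop (E := ℂ)).eventually_ge_atTop 1] with z hz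
  have hk' : k + 1 ≤ n := Finset.mem_range.1 hk
  have h0 : 0 < ‖z‖ := by linarith
  rw [one_mul, norm_mul, norm_inv, norm_pow, norm_pow, norm_div, norm_one,
    ← div_eq_mul_inv, div_le_div_iff₀ (by positivity) h0, one_mul, ← pow_succ]
  exact pow_le_pow_right₀ hz hk'

namespace IsPochhammerContour

variable {ξ : Ioo (-1 : ℝ) 1} {γ : ℝ → ℂ} (hγ : IsPochhammerContour ξ γ) (α β : ℂ) (p : ℂ[X])

include hγ

theorem contDiff_weight : ContDiff ℝ 1 (weight ξ γ α β) := by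
  rw [contDiff_one_iff_deriv]
  refine ⟨fun s => (hγ.hasDerivAt_weight α β s).differentiableAt, ?_⟩
  rw [funext fun s => (hγ.hasDerivAt_weight α β s).deriv]
  have h := hγ.contDiff.continuous
  exact (hγ.continuous_weight α β).mul (((continuous_const.div (continuous_const.add h)
    hγ.one_add_ne_zero).sub (continuous_const.div (continuous_const.sub h)
    hγ.one_sub_ne_zero)).mul hγ.continuous_deriv)

theorem contDiff_eval_mul_weight : ContDiff ℝ 1 fun u => p.eval (γ u) * weight ξ γ α β u := by
  have h : ContDiff ℂ 1 fun z : ℂ => p.eval z := p.contDiff_aeval 1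
  exact ((h.restrict_scalars ℝ).comp hγ.contDiff).mul (hγ.contDiff_weight α β)

theorem periodic_eval_mul_weight :
    Function.Periodic (fun u => p.eval (γ u) * weight ξ γ α β u) 1 := fun u => by
  simp only []
  rw [hγ.periodic u, hγ.periodic_weight α β u]

omit hγ in
theorem weightedIntegral_div_eq (z : ℂ) :
    weightedIntegral ξ γ α β (fun t => p.eval t / (t - z)) =
      cauchyArc γ (fun u => p.eval (γ u) * weight ξ γ α β u) 0 1 z := by
  simp only [weightedIntegral, cauchyArc]
  congr 1; ext u; ring

theorem differentiableAt_cauchyTransform {z : ℂ} (hz : z ∉ range γ) : DifferentiableAt ℂ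
    (fun z => weightedIntegral ξ γ α β (fun t => p.eval t / (t - z))) z := by
  simp only [weightedIntegral_div_eq]
  exact differentiableAt_cauchyArc hγ.contDiff (hγ.contDiff_eval_mul_weight α β p).continuous
    fun u _ h => hz ⟨u, h⟩

theorem isBigO_cauchyTransform : (fun z => weightedIntegral ξ γ α β fun t => p.eval t / (t - z))
    =O[Bornology.cobounded ℂ] fun z => 1 / z := by
  obtain ⟨R, hR⟩ := (isCompact_Icc (a := (0 : ℝ)) (b := 1)).exists_bound_of_continuousOn
    hγ.contDiff.continuous.continuousOn
  obtain ⟨M, hM⟩ := (isCompact_Icc (a := (0 : ℝ)) (b := 1)).exists_bound_of_continuousOn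
    (f := fun u => p.eval (γ u) * weight ξ γ α β u * deriv γ u)
    ((hγ.contDiff_eval_mul_weight α β p).continuous.mul hγ.continuous_deriv).continuousOn
  refine Asymptotics.IsBigO.of_bound (2 * M) ?_
  filter_upwards [(tendsto_norm_cobounded_atTop (E := ℂ)).eventually_ge_atTop (2 * R),
    (tendsto_norm_cobounded_atTop (E := ℂ)).eventually_gt_atTop 0] with z hz hz0
  rw [weightedIntegral_div_eq, cauchyArc]
  have h := intervalIntegral.norm_integral_le_of_norm_le_const (a := 0) (b := 1)
    (f := fun u => p.eval (γ u) * weight ξ γ α β u * deriv γ u / (γ u - z))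
    (C := M / (‖z‖ / 2)) fun u hu => by
      rw [uIoc_of_le zero_le_one] at hu
      have hu' : u ∈ Icc (0 : ℝ) 1 := ⟨hu.1.le, hu.2⟩
      have h1 := hR u hu'
      have h2 : ‖z‖ / 2 ≤ ‖γ u - z‖ := by
        have := norm_sub_norm_le z (γ u)
        rw [norm_sub_rev] at this
        linarith
      rw [norm_div]
      exact div_le_div₀ ((norm_nonneg _).trans (hM u hu')) (hM u hu') (by positivity) h2
  refine h.trans (le_of_eq ?_)
  rw [norm_div, norm_one]
  simp only [sub_zero, abs_one]
  field_simp

/-- Under the integral, z/(t - z) = t/(t - z) - 1. -/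
theorem mul_cauchyTransform {z : ℂ} (hz : z ∉ range γ) :
    z * weightedIntegral ξ γ α β (fun t => p.eval t / (t - z)) =
      weightedIntegral ξ γ α β (fun t => (X * p).eval t / (t - z)) -
        weightedIntegral ξ γ α β fun t => p.eval t := by
  rw [weightedIntegral_div_eq, weightedIntegral_div_eq, cauchyArc, cauchyArc, weightedIntegral,
    ← intervalIntegral.integral_const_mul, ← intervalIntegral.integral_sub
      (intervalIntegrable_cauchy_integrand hγ.contDiff
        (hγ.contDiff_eval_mul_weight α β _).continuous fun u _ h => hz ⟨u, h⟩)
      (hγ.intervalIntegrable_integrand α β p.continuous 0 1)]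
  congr 1
  ext u
  have h : γ u - z ≠ 0 := sub_ne_zero.2 fun h => hz ⟨u, h⟩
  rw [eval_mul, eval_X]
  field_simp
  ring

/-- Each factor `z` is absorbed at the cost of one moment, and these moments vanish. By
`isBigO_cauchyTransform` the right side is O(1/z), so orthogonality becomes decay. -/
theorem pow_mul_cauchyTransform {z : ℂ} (hz : z ∉ range γ) {n : ℕ}
    (h : ∀ k < n, weightedIntegral ξ γ α β (fun t => t ^ k * p.eval t) = 0) :
    z ^ n * weightedIntegral ξ γ α β (fun t => p.eval t / (t - z)) =
      weightedIntegral ξ γ α β (fun t => (X ^ n * p).eval t / (t - z)) := by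
  induction n with
  | zero => simp
  | succ n ih =>
    have h1 := h n n.lt_succ_self
    rw [pow_succ', mul_assoc, ih fun k hk => h k (hk.trans n.lt_succ_self),
      hγ.mul_cauchyTransform α β _ hz, pow_succ', mul_assoc]
    simp only [eval_mul, eval_pow, eval_X] at h1 ⊢
    rw [h1, sub_zero]

theorem pow_succ_mul_cauchyTransform {z : ℂ} (hz : z ∉ range γ) {n : ℕ}
    (h : ∀ k < n, weightedIntegral ξ γ α β (fun t => t ^ k * p.eval t) = 0) :
    z ^ (n + 1) * weightedIntegral ξ γ α β (fun t => p.eval t / (t - z)) =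
      weightedIntegral ξ γ α β (fun t => (X ^ (n + 1) * p).eval t / (t - z)) -
        weightedIntegral ξ γ α β (fun t => t ^ n * p.eval t) := by
  rw [pow_succ', mul_assoc, hγ.pow_mul_cauchyTransform α β p hz h,
      hγ.mul_cauchyTransform α β _ hz, pow_succ', mul_assoc]
  simp only [eval_mul, eval_pow, eval_X]

end IsPochhammerContour

end JacobiRH

end

/-! ### The explicit matrix solves the Riemann-Hilbert problem -/

noncomputable section

namespace JacobiRH

open Polynomial

namespace IsPochhammerContour

variable {ξ : Ioo (-1 : ℝ) 1} {γ : ℝ → ℂ} (hγ : IsPochhammerContour ξ γ) (n : ℕ) (α β : ℂ)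

include hγ

theorem analyticOnNhd_explicitSolution (i j : Fin 2) :
    AnalyticOnNhd ℂ (fun z => explicitSolution ξ γ n α β z i j) (range γ)ᶜ := by
  refine DifferentiableOn.analyticOnNhd ?_ hγ.isCompact_range.isClosed.isOpen_compl
  have hK : ∀ p : ℂ[X], DifferentiableOn ℂ
      (fun z => weightedIntegral ξ γ α β fun t => p.eval t / (t - z)) (range γ)ᶜ := fun p z hz =>
    (hγ.differentiableAt_cauchyTransform α β p hz).differentiableWithinAt
  have hp : ∀ p : ℂ[X], DifferentiableOn ℂ (fun z => p.eval z) (range γ)ᶜ := fun p =>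
    p.differentiableOn
  revert i j
  simp only [Fin.forall_fin_two, explicitSolution, Matrix.of_apply, Matrix.cons_val',
    Matrix.cons_val_zero, Matrix.cons_val_one, Matrix.cons_val_fin_one]
  exact ⟨⟨(hp _).const_mul _, (hK _).const_mul _⟩, (hp _).const_mul _, (hK _).const_mul _⟩

omit hγ in
theorem tendsto_explicitSolution {l : Filter ℂ} {w L₁ L₂ : ℂ} (hl : l ≤ 𝓝 w)
    (h₁ : Tendsto (fun z => weightedIntegral ξ γ α β fun t => (jacobi n α β).eval t / (t - z))
      l (𝓝 L₁))
    (h₂ : Tendsto (fun z => weightedIntegral ξ γ α β fun t =>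
      (jacobi (n - 1) α β).eval t / (t - z)) l (𝓝 L₂)) :
    Tendsto (explicitSolution ξ γ n α β) l
      (𝓝 !![monicConst n α β * (jacobi n α β).eval w,
          monicConst n α β / (2 * Real.pi * I) * L₁;
        secondConst ξ γ (n - 1) α β * (jacobi (n - 1) α β).eval w,
          secondConst ξ γ (n - 1) α β / (2 * Real.pi * I) * L₂]) := by
  have hp : ∀ p : ℂ[X], Tendsto (fun z => p.eval z) l (𝓝 (p.eval w)) := fun p =>
    (p.continuous.tendsto w).mono_left hl
  refine tendsto_pi_nhds.2 fun i => tendsto_pi_nhds.2 fun j => ?_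
  revert i j
  simp only [Fin.forall_fin_two, explicitSolution, Matrix.of_apply, Matrix.cons_val',
    Matrix.cons_val_zero, Matrix.cons_val_one, Matrix.cons_val_fin_one]
  exact ⟨⟨(hp _).const_mul _, h₁.const_mul _⟩, (hp _).const_mul _, h₂.const_mul _⟩

theorem exists_tendsto_cauchyTransform (p : ℂ[X]) {s : ℝ} (hs : γ s ∈ openContour γ) :
    ∃ Lp Lm,
      Tendsto (fun z => weightedIntegral ξ γ α β fun t => p.eval t / (t - z)) (leftSide γ s)
        (𝓝 Lp) ∧
      Tendsto (fun z => weightedIntegral ξ γ α β fun t => p.eval t / (t - z)) (rightSide γ s)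
        (𝓝 Lm) ∧
      Lp = Lm + 2 * Real.pi * I * (p.eval (γ s) * weight ξ γ α β s) := by
  obtain ⟨Lp, Lm, h1, h2, h3⟩ := hγ.exists_tendsto_cauchyArc (hγ.contDiff_eval_mul_weight α β p)
    (hγ.periodic_eval_mul_weight α β p) hs
  simp only [weightedIntegral_div_eq]
  exact ⟨Lp, Lm, h1, h2, by rw [← h3]; ring⟩

/-- The polynomial column does not jump, and the Plemelj formula adds the weight times that column
to the second one. -/
theorem exists_tendsto_explicitSolution {s : ℝ} (hs : γ s ∈ openContour γ) :
    ∃ Lp Lm, Tendsto (explicitSolution ξ γ n α β) (leftSide γ s) (𝓝 Lp) ∧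
      Tendsto (explicitSolution ξ γ n α β) (rightSide γ s) (𝓝 Lm) ∧
      Lp = Lm * !![1, weight ξ γ α β s; 0, 1] := by
  obtain ⟨P, M, h1, h2, h3⟩ := hγ.exists_tendsto_cauchyTransform α β (jacobi n α β) hs
  obtain ⟨P', M', h1', h2', h3'⟩ :=
    hγ.exists_tendsto_cauchyTransform α β (jacobi (n - 1) α β) hs
  refine ⟨_, _,
    tendsto_explicitSolution n α β ((hγ.leftSide_le hs).trans nhdsWithin_le_nhds) h1 h1',
    tendsto_explicitSolution n α β ((hγ.rightSide_le hs).trans nhdsWithin_le_nhds) h2 h2', ?_⟩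
  have hπ : (2 * Real.pi * I : ℂ) ≠ 0 := two_pi_I_ne_zero
  have e : ∀ c x m w : ℂ, c / (2 * Real.pi * I) * (m + 2 * Real.pi * I * (x * w)) =
      c * x * w + c / (2 * Real.pi * I) * m := fun c x m w => by
    field_simp
    ring
  rw [h3, h3', e, e, Matrix.mul_fin_two]
  simp only [mul_one, mul_zero, add_zero]

theorem jump_explicitSolution : ∃ Yp Ym : ℂ → Matrix (Fin 2) (Fin 2) ℂ,
    ContinuousOn Yp (openContour γ) ∧ ContinuousOn Ym (openContour γ) ∧
    ∀ s ∈ Ico (0 : ℝ) 1, γ s ∈ openContour γ →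
      Tendsto (explicitSolution ξ γ n α β) (leftSide γ s) (𝓝 (Yp (γ s))) ∧
      Tendsto (explicitSolution ξ γ n α β) (rightSide γ s) (𝓝 (Ym (γ s))) ∧
      Yp (γ s) = Ym (γ s) * !![1, weight ξ γ α β s; 0, 1] := by
  have : T3Space (Matrix (Fin 2) (Fin 2) ℂ) := inferInstanceAs (T3Space (Fin 2 → Fin 2 → ℂ))
  obtain ⟨Yp, hYp, hYp'⟩ := hγ.exists_boundary_function (f := explicitSolution ξ γ n α β)
    (R := Ioi 0) (by simp [closure_Ioi]) fun s hs =>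
      let ⟨Lp, _, h, _⟩ := hγ.exists_tendsto_explicitSolution n α β hs
      ⟨Lp, h⟩
  obtain ⟨Ym, hYm, hYm'⟩ := hγ.exists_boundary_function (f := explicitSolution ξ γ n α β)
    (R := Iio 0) (by simp [closure_Iio]) fun s hs =>
      let ⟨_, Lm, _, h, _⟩ := hγ.exists_tendsto_explicitSolution n α β hs
      ⟨Lm, h⟩
  refine ⟨Yp, Ym, hYp, hYm, fun s _ hs => ⟨hYp' s hs, hYm' s hs, ?_⟩⟩
  obtain ⟨Lp, Lm, h1, h2, h3⟩ := hγ.exists_tendsto_explicitSolution n α β hs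
  have : (leftSide γ s).NeBot := by rw [leftSide_eq]; infer_instance
  have : (rightSide γ s).NeBot := by rw [rightSide_eq]; infer_instance
  have e1 : Yp (γ s) = Lp := tendsto_nhds_unique (hYp' s hs) h1
  have e2 : Ym (γ s) = Lm := tendsto_nhds_unique (hYm' s hs) h2
  rw [e1, e2, h3]

theorem exists_bound_explicitSolution (t : ℂ) :
    ∃ M : ℝ, ∀ᶠ z in 𝓝[(range γ)ᶜ] t, ∀ i j, ‖explicitSolution ξ γ n α β z i j‖ ≤ M := by
  have hK : ∀ (c : ℂ) (p : ℂ[X]), ∃ M : ℝ, ∀ᶠ z in 𝓝[(range γ)ᶜ] t,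
      ‖c * weightedIntegral ξ γ α β fun t => p.eval t / (t - z)‖ ≤ M := fun c p => by
    obtain ⟨M, hM⟩ := hγ.exists_bound_cauchyArc (hγ.contDiff_eval_mul_weight α β p)
      (hγ.periodic_eval_mul_weight α β p) t
    refine ⟨‖c‖ * M, hM.mono fun z hz => ?_⟩
    rw [weightedIntegral_div_eq, norm_mul]
    exact mul_le_mul_of_nonneg_left hz (norm_nonneg _)
  have hp : ∀ (c : ℂ) (p : ℂ[X]), ∃ M : ℝ, ∀ᶠ z in 𝓝[(range γ)ᶜ] t, ‖c * p.eval z‖ ≤ M :=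
    fun c p => by
      have hc : ContinuousAt (fun z => c * p.eval z) t :=
        (continuous_const.mul p.continuous).continuousAt
      exact ⟨_, nhdsWithin_le_nhds ((hc.norm.eventually_lt_const (lt_add_one _)).mono
        fun z hz => hz.le)⟩
  have hall : ∀ i j, ∃ M : ℝ, ∀ᶠ z in 𝓝[(range γ)ᶜ] t,
      ‖explicitSolution ξ γ n α β z i j‖ ≤ M := by
    simp only [Fin.forall_fin_two, explicitSolution, Matrix.of_apply, Matrix.cons_val',
      Matrix.cons_val_zero, Matrix.cons_val_one, Matrix.cons_val_fin_one]
    exact ⟨⟨hp _ _, hK _ _⟩, hp _ _, hK _ _⟩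
  choose M hM using hall
  refine ⟨∑ i, ∑ j, |M i j|, ?_⟩
  filter_upwards [eventually_all.2 fun i => eventually_all.2 fun j => hM i j] with z hz i j
  refine (hz i j).trans ((le_abs_self _).trans ?_)
  refine (Finset.single_le_sum (f := fun j => |M i j|) (fun _ _ => abs_nonneg _)
    (Finset.mem_univ j)).trans ?_
  exact Finset.single_le_sum (f := fun i => ∑ j, |M i j|)
    (fun _ _ => Finset.sum_nonneg fun _ _ => abs_nonneg _) (Finset.mem_univ i)

theorem normalized_explicitSolution {n : ℕ} (hn : 1 ≤ n) {α β : ℂ}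
    (hαβ : ∀ k : ℕ, 1 ≤ k → -(n : ℂ) - α - β ≠ k)
    (hI : jacobiNorm ξ γ (n - 1) α β ≠ 0) :
    ∃ E : ℂ → Matrix (Fin 2) (Fin 2) ℂ,
      (∀ i j, (fun z => E z i j) =O[Bornology.cobounded ℂ] fun z => 1 / z) ∧
      ∀ᶠ z in Bornology.cobounded ℂ,
        explicitSolution ξ γ n α β z = (1 + E z) * !![z ^ n, 0; 0, (z ^ n)⁻¹] := by
  obtain ⟨m, rfl⟩ : ∃ m, n = m + 1 := ⟨n - 1, by omega⟩
  rw [Nat.add_sub_cancel] at hI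
  have hπ : (2 * Real.pi * I : ℂ) ≠ 0 := two_pi_I_ne_zero
  have hmonic := monic_monicConst_mul_jacobi hαβ
  have hdeg := natDegree_jacobi hαβ
  have hc : monicConst (m + 1) α β ≠ 0 := fun h => by simp [h] at hmonic
  set c := monicConst (m + 1) α β with hcdef
  set d := secondConst ξ γ m α β with hd
  have hout : ∀ᶠ z in Bornology.cobounded ℂ, z ∉ range γ :=
    Bornology.isBounded_def.1 hγ.isCompact_range.isBounded
  -- The error matrix is forced by solving the asymptotic relation for it. In its first column
  -- degrees decide, in its second the vanishing moments.
  refine ⟨fun z => explicitSolution ξ γ (m + 1) α β z * !![(z ^ (m + 1))⁻¹, 0; 0, z ^ (m + 1)] - 1,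
    ?_, ?_⟩
  · have h00 : (fun z => c * (jacobi (m + 1) α β).eval z * (z ^ (m + 1))⁻¹ - 1)
        =O[Bornology.cobounded ℂ] fun z => 1 / z := by
      have hlt : (C c * jacobi (m + 1) α β - X ^ (m + 1)).natDegree < m + 1 := by
        have hdeg' : (C c * jacobi (m + 1) α β).natDegree = m + 1 := by
          rw [natDegree_C_mul hc, hdeg]
        refine Nat.lt_succ_of_le (natDegree_le_iff_coeff_eq_zero.2 fun N hN => ?_)
        rw [coeff_sub, coeff_X_pow]
        rcases (Nat.succ_le_of_lt hN).eq_or_lt with rfl | hlt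
        · have h1 := hmonic.coeff_natDegree
          rw [hdeg'] at h1
          rw [if_pos rfl, h1, sub_self]
        · rw [if_neg hlt.ne', coeff_eq_zero_of_natDegree_lt (by rwa [hdeg']), sub_zero]
      refine (isBigO_eval_mul_inv_pow hlt).congr' ?_ EventuallyEq.rfl
      filter_upwards [Bornology.eventually_ne_cobounded (0 : ℂ)] with z hz
      simp only [eval_sub, eval_mul, eval_C, eval_pow, eval_X]
      field_simp
    have h10 : (fun z => d * (jacobi m α β).eval z * (z ^ (m + 1))⁻¹)
        =O[Bornology.cobounded ℂ] fun z => 1 / z := by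
      have hlt : (C d * jacobi m α β).natDegree < m + 1 :=
        Nat.lt_succ_of_le ((natDegree_C_mul_le _ _).trans (natDegree_jacobi_le m α β))
      refine (isBigO_eval_mul_inv_pow hlt).congr_left fun z => ?_
      rw [eval_mul, eval_C]
    have h01 : (fun z => c / (2 * Real.pi * I) * (weightedIntegral ξ γ α β fun t =>
        (jacobi (m + 1) α β).eval t / (t - z)) * z ^ (m + 1))
        =O[Bornology.cobounded ℂ] fun z => 1 / z := by
      refine ((hγ.isBigO_cauchyTransform α β (X ^ (m + 1) * jacobi (m + 1) α β)).const_mul_left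
        (c / (2 * Real.pi * I))).congr' ?_ EventuallyEq.rfl
      filter_upwards [hout] with z hz
      rw [← hγ.pow_mul_cauchyTransform α β _ hz fun k hk =>
        hγ.weightedIntegral_pow_mul_jacobi_of_lt hk α β]
      ring
    have h11 : (fun z => d / (2 * Real.pi * I) * (weightedIntegral ξ γ α β fun t =>
        (jacobi m α β).eval t / (t - z)) * z ^ (m + 1) - 1)
        =O[Bornology.cobounded ℂ] fun z => 1 / z := by
      refine ((hγ.isBigO_cauchyTransform α β (X ^ (m + 1) * jacobi m α β)).const_mul_left
        (d / (2 * Real.pi * I))).congr' ?_ EventuallyEq.rfl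
      filter_upwards [hout] with z hz
      have h1 := hγ.pow_succ_mul_cauchyTransform α β (jacobi m α β) hz (n := m) fun k hk =>
        hγ.weightedIntegral_pow_mul_jacobi_of_lt hk α β
      -- The first nonvanishing moment of P_m is I_m, and `d` is normalized so that it produces the
      -- diagonal entry 1.
      have h2 : d / (2 * Real.pi * I) *
          (weightedIntegral ξ γ α β fun t => t ^ m * (jacobi m α β).eval t) = -1 := by
        change d / (2 * Real.pi * I) * jacobiNorm ξ γ m α β = -1
        rw [hd, secondConst]
        field_simp
      linear_combination d / (2 * Real.pi * I) * (-h1) + h2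
    simp only [Fin.forall_fin_two, explicitSolution, Matrix.mul_fin_two, Matrix.one_fin_two,
      Matrix.sub_apply, Matrix.of_apply, Matrix.cons_val', Matrix.cons_val_zero,
      Matrix.cons_val_one, Matrix.cons_val_fin_one, mul_zero, add_zero, zero_add, sub_zero,
      Nat.add_sub_cancel]
    exact ⟨⟨h00, h01⟩, h10, h11⟩
  · filter_upwards [Bornology.eventually_ne_cobounded (0 : ℂ)] with z hz
    have hz' : z ^ (m + 1) ≠ 0 := pow_ne_zero _ hz
    rw [add_sub_cancel, Matrix.mul_assoc, Matrix.mul_fin_two]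
    simp only [mul_zero, zero_mul, add_zero, zero_add, mul_inv_cancel₀ hz', inv_mul_cancel₀ hz']
    rw [← Matrix.one_fin_two, Matrix.mul_one]

end IsPochhammerContour

end JacobiRH

end

theorem proposition3p1 (n : ℕ) (hn : 1 ≤ n) (α β : ℂ)
    (hαβ : ∀ k : ℕ, 1 ≤ k → -(n : ℂ) - α - β ≠ k)
    (hα : ∀ k : ℕ, 1 ≤ k → (n : ℂ) + α ≠ k)
    (hβ : ∀ k : ℕ, 1 ≤ k → (n : ℂ) + β ≠ k)
    (ξ : Set.Ioo (-1 : ℝ) 1) (γ : ℝ → ℂ) (hγ : JacobiRH.IsPochhammerContour ξ γ) :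
    (Polynomial.C (JacobiRH.monicConst n α β) * JacobiRH.jacobi n α β).Monic ∧
    (JacobiRH.jacobi n α β).natDegree = n ∧
    JacobiRH.jacobiNorm ξ γ (n - 1) α β ≠ 0 ∧
    JacobiRH.IsRHSolution ξ γ n α β (JacobiRH.explicitSolution ξ γ n α β) ∧
    ∀ Y : ℂ → Matrix (Fin 2) (Fin 2) ℂ, JacobiRH.IsRHSolution ξ γ n α β Y →
      Set.EqOn Y (JacobiRH.explicitSolution ξ γ n α β) (Set.range γ)ᶜ := by
  have hI := hγ.jacobiNorm_ne_zero hn hαβ hα hβ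
  have hsol : JacobiRH.IsRHSolution ξ γ n α β (JacobiRH.explicitSolution ξ γ n α β) :=
    ⟨hγ.analyticOnNhd_explicitSolution n α β, hγ.jump_explicitSolution n α β,
      hγ.normalized_explicitSolution hn hαβ hI,
      fun t _ => hγ.exists_bound_explicitSolution n α β t⟩
  exact ⟨JacobiRH.monic_monicConst_mul_jacobi hαβ, JacobiRH.natDegree_jacobi hαβ, hI, hsol,
    fun Y hY => hY.eqOn hγ hsol⟩
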